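/- **Setting.** Let $\mathbf P$ be a set of integers $\ge 2$. For $p\in\mathbf P$ let $\theta_p:\{-1,1\}^p\to\mathbb R$ be a random function, the $\theta_p$ being independent, and let $h:\{-1,1\}\to\mathbb R$ be a random function. Assume that for each $p\in\mathbf P$ there are i.i.d. random functions $f_{p,1},\dots,f_{p,p}:\{-1,1\}\to\mathbb R$ and a pair of random variables $(a_p,b_p)$ independent of them with $$\exp\theta_p(\sigma_1,\dots,\sigma_p)=a_p\bigl(1+b_pf_{p,1}(\sigma_1)\cdots f_{p,p}(\sigma_p)\bigr),\qquad \mathbb E[(-b_p)^n]\ge 0\ (n\ge 1),\qquad |b_pf_{p,1}(\sigma_1)\cdots f_{p,p}(\sigma_p)|<1\ \text{a.s.},$$ and that $p$ is even or $f_{p,1}\ge 0$ a.s. Assume also that for some constant $\kappa>0$, a.s. $|h|\le\kappa$ and $|\theta_p|\le\kappa$ for all $p\in\mathbf P$. For each $N$ let $d^N=(d^N_i)_{1\le i\le N}\in\mathbb N^N$ and $E^N=(E^N_p)_{p\in\mathbf P}\in\mathbb N^{\mathbf P}$ satisfy $\sum_i d_i^N=\sum_p pE_p^N$. Assume that there are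 probability measures $\mu$ on $\mathbb N$ and $\nu$ on $\mathbf P$ such that, with $\mu_N(k)=\frac1N\#\{i:d_i^N=k\}$ and $\nu_N(p)=E_p^N/\sum_qE_q^N$, one has $\sum_k k|\mu_N(k)-\mu(k)|\to 0$, $\sum_p p|\nu_N(p)-\nu(p)|\to0$, $\sup_{N\ge 1}\frac1N\sum_i(d_i^N)^2<\infty$, $\sum_n n^2\mu(n)<\infty$ and $\sum_n n\nu(n)<\infty$. For finitely supported families $E=(E_p)$, $S=(S_p)$ of nonnegative integers, let $G(E,S)$ be the random graph on $\{1,\dots,N\}$ with $E_p$ hyperedges of size $p$ and $S_p$ sites (hyperedges with a single vertex) of type $p$, obtained by giving vertex $i$ exactly $d_i^N$ half-edges, each $p$-edge $p$ half-edges, each site one half-edge, and choosing uniformly an injective matching of all half-edges of hyperedges and sites to half-edges of vertices (some of the latter may remain free). Let $\Gamma$ be a countable set, $(x^\gamma)_{\gamma\in\Gamma}$ a family of real random variables with an arbitrary joint law, and $(v_\gamma)_{\gamma\in\Gamma}$ nonnegative random variables with $\sum_\gamma v_\gamma=1$. For $\epsilon\in\{-1,1\}^p$ put $\mathcal E_p(\epsilon)=\exp\theta_p(\epsilon)$.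 For a function $f$ on $\{-1,1\}^p$ and real numbers $x=(x_l)$ let $$\langle f\rangle_x=\frac{\sum_{\epsilon\in\{\pm1\}^p}f(\epsilon)e^{\sum_{l=1}^px_l\epsilon_l}}{\sum_{\epsilon\in\{\pm1\}^p}e^{\sum_{l=1}^px_l\epsilon_l}},\qquad \langle f\rangle_x^-(s)=\frac{\sum_{\epsilon\in\{\pm1\}^{p-1}}f(\epsilon_1,\dots,\epsilon_{p-1},s)e^{\sum_{l=1}^{p-1}x_l\epsilon_l}}{\sum_{\epsilon\in\{\pm1\}^{p-1}}e^{\sum_{l=1}^{p-1}x_l\epsilon_l}} .$$ For a graph $G$ and $\sigma\in\{-1,1\}^N$ define $$-H_G^\gamma(\sigma)=\sum_p\Bigl(\sum_{e}\theta_{p,e}(\sigma_{\partial e})+\sum_s\log\langle \exp\theta_{p,s}\rangle^-_{x^{s,\gamma}}(\sigma_{\partial s})\Bigr)+\sum_ih_i(\sigma_i),$$ where $e$ and $s$ run over the hyperedges of size $p$ and the sites of type $p$, $\sigma_{\partial e}$ and $\sigma_{\partial s}$ are the spins at the vertices of $e$ and $s$, the $\theta_{p,e},\theta_{p,s}$ are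 independent copies of $\theta_p$, the $h_i$ are independent copies of $h$, and the $(x^{s,\gamma}_l)_{\gamma\in\Gamma}$ ($l\ge1$, $s$ a site) are independent copies of $(x^\gamma)_{\gamma\in\Gamma}$; all of these, the weights $(v_\gamma)$ and the graph are independent. If $G$ has no sites, $H_G^\gamma$ does not depend on $\gamma$ and is written $H_G$. Let $\langle\cdot\rangle_G$ be the average for the probability measure on $\{-1,1\}^N\times\Gamma$ proportional to $v_\gamma\exp(-H^\gamma_G(\sigma))$, and $$F_N=\frac1N\mathbb E\log\sum_\sigma e^{-H_{G(E^N,0)}(\sigma)},\qquad \widetilde F_N=\frac1N\mathbb E\log\sum_{\sigma,\gamma}v_\gamma e^{-H^\gamma_{\widetilde G_N}(\sigma)} .$$ Here $\mathbf Q=\{p\in\mathbf P: pE_p^N\ge\max(15,2p^2)\}$ and $\widetilde G_N=G(\widetilde E,\widetilde S)$ with $(\widetilde E_p,\widetilde S_p)=(0,pE^N_p)$ for $p\in\mathbf Q$ and $(\widetilde E_p,\widetilde S_p)=(E_p^N,0)$ for $p\notin\mathbf Q$. For each $N$ let $p_1,\dots,p_k$ be any enumeration of $\{p:E_p^N\ne0\}$.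 For $p=p_i\in\mathbf Q$ put $\delta_p=\bigl\lceil\sqrt{\widetilde S_p\log\widetilde S_p}\,\bigr\rceil$, $\tau_p=\widetilde S_p-2\delta_p$, and, for $1\le t\le\tau_p$, let $G^{p,t}$ be the random graph $G(E,S)$ with $(E_{p_j},S_{p_j})=(E^N_{p_j},0)$ for $j<i$, $(E_{p_j},S_{p_j})=(\widetilde E_{p_j},\widetilde S_{p_j})$ for $j>i$, and $E_p=X_1+\dots+X_{t-1}$, $S_p=\tau_p-t$, where the $X_k$ are i.i.d., independent of everything else, with $\mathbb P(X_k=1)=1-\mathbb P(X_k=0)=1/p$. **Theorem (A general bound).** There is a sequence $o_N(1)\to0$ such that for all $N\ge1$ $$F_N\le\widetilde F_N-\frac1N\sum_{p\in\mathbf Q}\sum_{t=1}^{\tau_p}\frac{p-1}p\,\mathbb E\log\bigl\langle\langle\mathcal E_p\rangle_{x^\gamma}\bigr\rangle_{G^{p,t}}+o_N(1).$$ In the last term $x^\gamma=(x_1^\gamma,\dots,x_p^\gamma)$, where the $(x_l^\gamma)_{\gamma\in\Gamma}$, $1\le l\le p$, are independent copies of $(x^\gamma)_{\gamma\in\Gamma}$,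 $\mathcal E_p=\exp\theta_p$, and $(x^\gamma_l)_{l,\gamma}$ and $\theta_p$ are independent of each other and of the randomness in $\langle\cdot\rangle_{G^{p,t}}$. The expectation is over all the randomness (walk, graph, functions, fields, weights); the event that no matching with the prescribed numbers of hyperedges and sites exists contributes $0$ to it. -/

import Mathlib

open MeasureTheory Filter Topology

namespace Diluted

noncomputable section

/-- Spins: the two-element type `{1, -1}`. -/
abbrev Spin : Type := ℤˣ

/-- Real functions of `p` spins. -/
abbrev EdgeFun (p : ℕ) : Type := (Fin p → Spin) → ℝ

/-! ### The local averages and the site functions -/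

/-- The average `⟨f⟩_x` of a function of `p` spins; coordinates are numbered from `0`. -/
def bracket {p : ℕ} (f : EdgeFun p) (x : ℕ → ℝ) : ℝ :=
  (∑ ε : Fin p → Spin, f ε * Real.exp (∑ l : Fin p, x l * ((ε l : ℤ) : ℝ))) /
    ∑ ε : Fin p → Spin, Real.exp (∑ l : Fin p, x l * ((ε l : ℤ) : ℝ))

/-- The average `⟨f⟩_x^-(s)` over the first `p - 1` spins, the last spin being fixed to `s`. -/
def bracketMinus {p : ℕ} (f : EdgeFun p) (x : ℕ → ℝ) (s : Spin) : ℝ :=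
  (∑ ε : Fin (p - 1) → Spin,
      f (fun j => if hj : (j : ℕ) < p - 1 then ε ⟨j, hj⟩ else s) *
        Real.exp (∑ l : Fin (p - 1), x l * ((ε l : ℤ) : ℝ))) /
    ∑ ε : Fin (p - 1) → Spin, Real.exp (∑ l : Fin (p - 1), x l * ((ε l : ℤ) : ℝ))

/-- `𝓔_p = exp θ_p`. -/
def expFun {p : ℕ} (θ : EdgeFun p) : EdgeFun p := fun ε => Real.exp (θ ε)

/-- The site function `U_p(θ, x_1, …, x_{p-1}, s) = log ⟨exp θ⟩_x^-(s)`. -/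
def siteFun {p : ℕ} (θ : EdgeFun p) (x : ℕ → ℝ) (s : Spin) : ℝ :=
  Real.log (bracketMinus (expFun θ) x s)

/-! ### Laws of the random ingredients -/

/-- The laws of the random functions `θ_p`, of the random function `h`, of the
random field `(x^γ)_γ` and of the random weights `(v_γ)_γ`. -/
structure Laws (P : Set ℕ) (Γ : Type*) where
  /-- law of `θ_p` -/
  θ : (p : P) → ProbabilityMeasure (EdgeFun p)
  /-- law of `h` -/
  h : ProbabilityMeasure (Spin → ℝ)
  /-- joint law of `(x^γ)_γ` -/
  x : ProbabilityMeasure (Γ → ℝ)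
  /-- joint law of `(v_γ)_γ` -/
  v : ProbabilityMeasure (Γ → ℝ)

/-- The structural assumption on the law of a random function `θ` of `p` spins:
`exp θ(σ) = a (1 + b f_1(σ_1) ⋯ f_p(σ_p))` with `f_1, …, f_p` i.i.d. (of law `φ`) and independent of
the pair `(a, b)` (of law `κ`), where `E[(-b)^n] ≥ 0` for `n ≥ 1`,
`|b f_1(σ_1) ⋯ f_p(σ_p)| < 1` almost surely, and `p` is even or `f ≥ 0` almost surely.
Below `w.1.1 = a`, `w.1.2 = b` and `w.2 l = f_l`. -/
def Factorizes (p : ℕ) (θ : ProbabilityMeasure (EdgeFun p)) : Prop :=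
  ∃ (κ : ProbabilityMeasure (ℝ × ℝ)) (φ : ProbabilityMeasure (Spin → ℝ)),
    (θ : Measure (EdgeFun p)) =
      ((κ : Measure (ℝ × ℝ)).prod (Measure.pi fun _ : Fin p => (φ : Measure (Spin → ℝ)))).map
        (fun w σ => Real.log (w.1.1 * (1 + w.1.2 * ∏ l, w.2 l (σ l)))) ∧
    (∀ᵐ w ∂((κ : Measure (ℝ × ℝ)).prod
        (Measure.pi fun _ : Fin p => (φ : Measure (Spin → ℝ)))), ∀ σ : Fin p → Spin,
        0 < w.1.1 * (1 + w.1.2 * ∏ l, w.2 l (σ l)) ∧ |w.1.2 * ∏ l, w.2 l (σ l)| < 1) ∧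
    (∀ n : ℕ, 1 ≤ n →
      Integrable (fun c : ℝ × ℝ => (-c.2) ^ n) (κ : Measure (ℝ × ℝ)) ∧
        0 ≤ ∫ c, (-c.2) ^ n ∂(κ : Measure (ℝ × ℝ))) ∧
    (Even p ∨ ∀ᵐ g ∂(φ : Measure (Spin → ℝ)), ∀ s, 0 ≤ g s)

/-! ### The disorder

A point of the canonical probability space consists of the functions `θ_{p,ℓ}` of the edges,
the functions `θ_{p,ℓ}` of the sites, the functions `h_i` of the vertices, the fields
`x^{s,γ}_l` of the sites (`s` being the `ℓ`-th site of type `p`) and the weights `v_γ`. -/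

/-- The canonical space carrying all the disorder. -/
abbrev Disorder (P : Set ℕ) (Γ : Type*) : Type _ :=
  ((i : P × ℕ) → EdgeFun i.1) × ((i : P × ℕ) → EdgeFun i.1) × (ℕ → Spin → ℝ) ×
    (P × ℕ × ℕ → Γ → ℝ) × (Γ → ℝ)

section Projections

variable {P : Set ℕ} {Γ : Type*}

/-- the function of the `ℓ`-th edge of size `p` -/
def Disorder.edge (ω : Disorder P Γ) (p : P) (ℓ : ℕ) : EdgeFun p := ω.1 (p, ℓ)

/-- the function of the `ℓ`-th site of type `p` -/
def Disorder.site (ω : Disorder P Γ) (p : P) (ℓ : ℕ) : EdgeFun p := ω.2.1 (p, ℓ)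

/-- the function of the `i`-th vertex -/
def Disorder.vertex (ω : Disorder P Γ) (i : ℕ) : Spin → ℝ := ω.2.2.1 i

/-- the field `x_l^{s,γ}` of the `ℓ`-th site `s` of type `p` -/
def Disorder.field (ω : Disorder P Γ) (p : P) (ℓ l : ℕ) (γ : Γ) : ℝ := ω.2.2.2.1 (p, ℓ, l) γ

/-- the weight `v_γ` -/
def Disorder.weight (ω : Disorder P Γ) (γ : Γ) : ℝ := ω.2.2.2.2 γ

/-- The law of the disorder: all its components are independent, with the prescribed laws. -/
def Laws.disorder (L : Laws P Γ) : Measure (Disorder P Γ) :=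
  (Measure.infinitePi fun i : P × ℕ => (L.θ i.1 : Measure (EdgeFun i.1))).prod <|
  (Measure.infinitePi fun i : P × ℕ => (L.θ i.1 : Measure (EdgeFun i.1))).prod <|
  (Measure.infinitePi fun _ : ℕ => (L.h : Measure (Spin → ℝ))).prod <|
  (Measure.infinitePi fun _ : P × ℕ × ℕ => (L.x : Measure (Γ → ℝ))).prod
  (L.v : Measure (Γ → ℝ))

/-- The law of an independent triple: the disorder, a fresh copy of `θ_p`, and a sequence of
fresh independent copies `(x_l^γ)_γ`, `l = 0, 1, …`, of `(x^γ)_γ`. -/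
def Laws.disorderFresh (L : Laws P Γ) (p : P) :
    Measure (Disorder P Γ × EdgeFun p × (ℕ → Γ → ℝ)) :=
  L.disorder.prod <|
    (L.θ p : Measure (EdgeFun p)).prod (Measure.infinitePi fun _ : ℕ => (L.x : Measure (Γ → ℝ)))

end Projections

/-! ### Random graphs: complete matchings of half-edges

`d i` is the degree bound of the vertex `i`, `E p` the number of `p`-edges and `S p` the number of
sites of type `p`. -/

section Graphs

variable {P : Set ℕ} {Γ : Type*} {N : ℕ}

/-- Half-edges attached to vertices. -/
abbrev VertexHalf (d : Fin N → ℕ) : Type := (i : Fin N) × Fin (d i)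

/-- Half-edges `(p, ℓ, j)` of the hyperedges. -/
abbrev EdgeHalf (E : P →₀ ℕ) : Type := (p : E.support) × Fin (E p.1) × Fin (p.1 : ℕ)

/-- Half-edges `(p, ℓ)` of the sites. -/
abbrev SiteHalf (S : P →₀ ℕ) : Type := (p : S.support) × Fin (S p.1)

/-- Complete matchings: all half-edges of hyperedges and sites are matched to distinct half-edges
of vertices (some of the latter may stay free). Such a matching describes a random graph in the
configuration model. -/
abbrev Matching (d : Fin N → ℕ) (E S : P →₀ ℕ) : Type := EdgeHalf E ⊕ SiteHalf S ↪ VertexHalf d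

/-- Average over a uniform complete matching (`0` if there is no complete matching). -/
def matchAvg (d : Fin N → ℕ) (E S : P →₀ ℕ) (Φ : Matching d E S → ℝ) : ℝ :=
  (Fintype.card (Matching d E S) : ℝ)⁻¹ * ∑ m, Φ m

variable {d : Fin N → ℕ} {E S : P →₀ ℕ}

/-- `-H` for a graph, without the contribution of the sites:
`∑_p ∑_{e ∈ E_p} θ_{p,e}(σ_{∂e}) + ∑_i h_i(σ_i)`. -/
def edgeEnergy (ω : Disorder P Γ) (m : Matching d E S) (σ : Fin N → Spin) : ℝ :=
  (∑ p : E.support, ∑ ℓ : Fin (E p.1),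
      ω.edge p.1 ℓ (fun j => σ (m (Sum.inl ⟨p, ℓ, j⟩)).1)) +
    ∑ i : Fin N, ω.vertex i (σ i)

/-- The contribution `∑_p ∑_{s ∈ S_p} U^γ_{p,s}(σ_{∂s})` of the sites to `-H^γ`. -/
def siteEnergy (ω : Disorder P Γ) (m : Matching d E S) (γ : Γ) (σ : Fin N → Spin) : ℝ :=
  ∑ p : S.support, ∑ ℓ : Fin (S p.1),
    siteFun (ω.site p.1 ℓ) (fun l => ω.field p.1 ℓ l γ) (σ (m (Sum.inr ⟨p, ℓ⟩)).1)

/-- The Gibbs weight `v_γ exp (-H^γ(σ))`. -/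
def gibbsWeight (ω : Disorder P Γ) (m : Matching d E S) (γ : Γ) (σ : Fin N → Spin) : ℝ :=
  ω.weight γ * Real.exp (edgeEnergy ω m σ + siteEnergy ω m γ σ)

/-- The weighted partition function `∑_{σ,γ} v_γ exp (-H^γ(σ))`. -/
def partitionFun (ω : Disorder P Γ) (m : Matching d E S) : ℝ :=
  ∑' γ, ∑ σ, gibbsWeight ω m γ σ

/-- The Gibbs average on configurations and `Γ`. -/
def gibbsAvg (ω : Disorder P Γ) (m : Matching d E S) (g : (Fin N → Spin) → Γ → ℝ) : ℝ :=
  (∑' γ, ∑ σ, gibbsWeight ω m γ σ * g σ γ) / partitionFun ω m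

/-- The free energy `F_N = N⁻¹ E log ∑_σ exp (-H_G(σ))` for the random graph `G` with degrees `d` and
`E p` hyperedges of size `p`. -/
def freeEnergy (L : Laws P Γ) (d : Fin N → ℕ) (E : P →₀ ℕ) : ℝ :=
  (N : ℝ)⁻¹ * matchAvg d E 0 fun m =>
    ∫ ω, Real.log (∑ σ, Real.exp (edgeEnergy ω m σ)) ∂L.disorder

/-- The weighted free energy `N⁻¹ E log ∑_{σ,γ} v_γ exp (-H_G^γ(σ))` of the random graph `G` with
`E p` hyperedges of size `p` and `S p` sites of type `p`. -/
def weightedFreeEnergy (L : Laws P Γ) (d : Fin N → ℕ) (E S : P →₀ ℕ) : ℝ :=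
  (N : ℝ)⁻¹ * matchAvg d E S fun m => ∫ ω, Real.log (partitionFun ω m) ∂L.disorder

/-! ### The interpolation path -/

/-- The set `Q` of sizes `p` with `p E_p ≥ max (15, 2 p²)`. -/
def bigSizes (E : P →₀ ℕ) : Finset P :=
  E.support.filter fun p => max 15 (2 * (p : ℕ) ^ 2) ≤ (p : ℕ) * E p

open Classical in
/-- Numbers of hyperedges at the start of the path: only those of sizes outside `Q` are kept. -/
def startEdges (E : P →₀ ℕ) : P →₀ ℕ :=
  Finsupp.indicator E.support fun p _ => if p ∈ bigSizes E then 0 else E p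

open Classical in
/-- Numbers of sites at the start of the path: `p E_p` sites of each type `p` in `Q`. -/
def startSites (E : P →₀ ℕ) : P →₀ ℕ :=
  Finsupp.indicator E.support fun p _ => if p ∈ bigSizes E then (p : ℕ) * E p else 0

/-- `δ_p = ⌈√(s log s)⌉` where `s = p E_p`. -/
def gap (E : P →₀ ℕ) (p : P) : ℕ :=
  ⌈Real.sqrt (((p * E p : ℕ) : ℝ) * Real.log ((p * E p : ℕ) : ℝ))⌉₊

/-- `τ_p = p E_p - 2 δ_p`, the number of steps of the walk for the size `p`
(for `p` in `Q` the subtraction does not truncate). -/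
def steps (E : P →₀ ℕ) (p : P) : ℕ := p * E p - 2 * gap E p

open Classical in
/-- Numbers of hyperedges during the walk for the size `p`, when there are `n` hyperedges of size
`p`. The sizes of smaller rank have been treated already, those of larger rank have not. -/
def pathEdges (E : P →₀ ℕ) (rank : P → ℕ) (p : P) (n : ℕ) : P →₀ ℕ :=
  Finsupp.indicator E.support fun q _ =>
    if rank q < rank p then E q else if q = p then n else startEdges E q

open Classical in
/-- Numbers of sites during the walk for the size `p`, when there are `n` sites of type `p`. -/
def pathSites (E : P →₀ ℕ) (rank : P → ℕ) (p : P) (n : ℕ) : P →₀ ℕ :=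
  Finsupp.indicator E.support fun q _ =>
    if rank q < rank p then 0 else if q = p then n else startSites E q

/-- Expectation of a function of i.i.d. random variables `X_1, …, X_t` with
`P(X = 1) = 1 - P(X = 0) = 1/p` (the value `1` is `true`). -/
def walkAvg (p t : ℕ) (Φ : (Fin t → Bool) → ℝ) : ℝ :=
  ∑ X : Fin t → Bool, (∏ k, if X k then (1 / p : ℝ) else 1 - 1 / p) * Φ X

/-- `E log ⟨⟨𝓔_p⟩_{x^γ}⟩_G`, where `G` is the random graph at the step from time `t` to time `t + 1`
of the walk for the size `p`: it has `X_1 + ⋯ + X_t` hyperedges of size `p` and `(τ_p - t) - 1` sites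
of type `p`. -/
def pathTerm (L : Laws P Γ) (d : Fin N → ℕ) (E : P →₀ ℕ) (rank : P → ℕ) (p : P) (t : ℕ) : ℝ :=
  walkAvg p t fun X =>
    matchAvg d (pathEdges E rank p (∑ k, (X k).toNat)) (pathSites E rank p (steps E p - t - 1))
      fun m => ∫ z, Real.log (gibbsAvg z.1 m fun _ γ =>
        bracket (expFun z.2.1) fun l => z.2.2 l γ) ∂(L.disorderFresh p)

end Graphs

end

end Diluted

namespace Diluted

noncomputable section

set_option linter.unusedSectionVars false

/-! ### Uniform averages -/

/-! The comparison is a discrete interpolation. For each size `p` in `bigSizes E`, in the order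
given by `rank`, the `s = p E_p` sites of type `p` are traded for the `E_p` hyperedges of size `p`.
A step of the walk deletes one site and adds one hyperedge with probability `1/p`, so the number of
half-edges in use is preserved on average.

One step compares a graph with the same graph plus an edge, or plus a site. A uniform matching of
the larger graph is a uniform matching of the smaller one followed by a uniform choice among the
free half-edges, and the variables of the added object are independent of the rest. Both increments
of the expected log partition function are therefore expected logarithms of Gibbs averages:
`edgeGain` and `siteGain`. The core is the inequality (1/p) edge − site + ((p−1)/p) cavity ≤ 0, up
to a small error (`tripleComb_logZ_le`). If the vertices are chosen with replacement there is no
error (`fixedGraph_inequality`). To see this, write exp θ = a(1 + b f_1 ⋯ f_p); the constants log a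
cancel, and log(1 + bY) is expanded in powers, where E(−b)^n ≥ 0. The n-th power of a Gibbs average
is an average over n replicas. For fixed replicas the p places are i.i.d., so the three terms become
A^p, A B^(p−1) and B^p, where A is the mean of a place occupied by a graph spin and B that of a
place averaged in a field. It remains to use p A B^(p−1) ≤ A^p + (p−1) B^p, valid for even p or A, B
≥ 0. Sampling without replacement instead costs 2κp/M, where M is the number of free half-edges.

Along the walk M = 2δ − (pn − t) with n edges after t removals. The process pn − t is a centred
martingale with variance t(p−1), so Chebyshev's bound handles the event that M drops below δ
(`WalkData.truncated_step`). Summing the steps, and correcting for the 2δ half-edges held back at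
both ends, gives an error of κ s times a quantity tending to 0 as s grows with p fixed
(`WalkData.bound`); this is where δ = ⌈√(s log s)⌉ is used.

That rate is not uniform in p. Sizes whose number of half-edges lies below a threshold depending on
p receive the trivial error 3κs. By the weighted convergence of the size distributions they carry
only a vanishing fraction of the O(N) half-edges (`eventually_sum_small_le`). The differences over
the sizes telescope (`sum_pathFree_sub`). -/

/-- The average of a function on a finite type (`0` if the type is empty). -/
def unifAvg {α : Type*} [Fintype α] (f : α → ℝ) : ℝ := (Fintype.card α : ℝ)⁻¹ * ∑ a, f a

section UnifAvg

variable {α β : Type*} [Fintype α] [Fintype β]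

lemma unifAvg_equiv (e : α ≃ β) (f : β → ℝ) : unifAvg (fun a => f (e a)) = unifAvg f := by
  unfold unifAvg
  rw [Fintype.card_congr e, Equiv.sum_comp e f]

lemma unifAvg_add (f g : α → ℝ) : unifAvg (fun a => f a + g a) = unifAvg f + unifAvg g := by
  simp only [unifAvg, Finset.sum_add_distrib, mul_add]

lemma unifAvg_sub (f g : α → ℝ) : unifAvg (fun a => f a - g a) = unifAvg f - unifAvg g := by
  simp only [unifAvg, Finset.sum_sub_distrib, mul_sub]

lemma unifAvg_mul_left (c : ℝ) (f : α → ℝ) : unifAvg (fun a => c * f a) = c * unifAvg f := by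
  simp only [unifAvg, ← Finset.mul_sum]
  ring

lemma unifAvg_mono {f g : α → ℝ} (h : ∀ a, f a ≤ g a) : unifAvg f ≤ unifAvg g :=
  mul_le_mul_of_nonneg_left (Finset.sum_le_sum fun a _ => h a) (by positivity)

lemma unifAvg_const [Nonempty α] (c : ℝ) : unifAvg (fun _ : α => c) = c := by
  have : (Fintype.card α : ℝ) ≠ 0 := by exact_mod_cast Fintype.card_ne_zero
  simp only [unifAvg, Finset.sum_const, Finset.card_univ, nsmul_eq_mul]
  field_simp

lemma abs_unifAvg_le {f : α → ℝ} {c : ℝ} (hc : 0 ≤ c) (h : ∀ a, |f a| ≤ c) :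
    |unifAvg f| ≤ c := by
  rcases isEmpty_or_nonempty α with hα | hα
  · simpa [unifAvg] using hc
  · rw [abs_le, ← unifAvg_const (α := α) c, ← unifAvg_const (α := α) (-_)]
    refine ⟨unifAvg_mono fun a => ?_, unifAvg_mono fun a => (abs_le.mp (h a)).2⟩
    rw [unifAvg_const]
    exact (abs_le.mp (h a)).1

/-- Averaging in two stages is uniform because all fibres have the same number of points. -/
lemma unifAvg_sigma {γ : α → Type*} [∀ a, Fintype (γ a)] {M : ℕ}
    (hM : ∀ a, Fintype.card (γ a) = M) (f : (Σ a, γ a) → ℝ) :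
    unifAvg f = unifAvg fun a => unifAvg fun c : γ a => f ⟨a, c⟩ := by
  simp only [unifAvg, hM, ← Finset.mul_sum, ← mul_assoc, Fintype.sum_sigma, Fintype.card_sigma,
    Finset.sum_const, Finset.card_univ, smul_eq_mul, Nat.cast_mul, mul_inv]

/-- This is the birthday bound: p draws from M points are distinct with probability at least 1 −
p²/M. It is multiplied out, so that no division occurs in the induction. -/
lemma descFactorial_lower (M p : ℕ) (hp : p ≤ M) :
    (M : ℝ) ^ p * (M - (p : ℝ) ^ 2) ≤ M * M.descFactorial p := by
  induction p with
  | zero => simp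
  | succ p ih =>
    have hpM : (p : ℝ) + 1 ≤ M := by exact_mod_cast hp
    have h := ih (by omega)
    rw [Nat.descFactorial_succ, Nat.cast_mul, Nat.cast_sub (by omega)]
    have h2 := mul_le_mul_of_nonneg_left h (by linarith : (0 : ℝ) ≤ M - p)
    have h3 : (M : ℝ) ^ (p + 1) * (M - ((p + 1 : ℕ) : ℝ) ^ 2) ≤
        (M - p) * ((M : ℝ) ^ p * (M - (p : ℝ) ^ 2)) := by
      -- This is the exact difference of the two sides.
      have : 0 ≤ (M : ℝ) ^ p * ((p + 1) * M + (p : ℝ) ^ 3) := by positivity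
      push_cast
      rw [pow_succ]
      nlinarith
    linarith

/-- Sampling with and without replacement differ little. -/
lemma abs_unifAvg_embedding_sub_le {F : Type*} [Fintype F] {p : ℕ} (hp : p ≤ Fintype.card F)
    (hF : 0 < Fintype.card F) {c : ℝ} (hc : 0 ≤ c) (g : (Fin p → F) → ℝ) (hg : ∀ i, |g i| ≤ c) :
    |unifAvg (fun i : Fin p ↪ F => g i) - unifAvg g| ≤
      2 * c * ((p : ℝ) ^ 2 / Fintype.card F) := by
  classical
  set M := Fintype.card F with hM
  have hM0 : (0 : ℝ) < M := by exact_mod_cast hF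
  have hMp : (0 : ℝ) < (M : ℝ) ^ p := by positivity
  set I : ℝ := (Fintype.card (Fin p ↪ F) : ℝ) with hI
  have hIM : I = M.descFactorial p := by
    rw [hI, Fintype.card_embedding_eq, Fintype.card_fin]
  have hI0 : 0 < I := by
    rw [hIM]; exact_mod_cast Nat.descFactorial_pos.mpr hp
  have hT : (Fintype.card (Fin p → F) : ℝ) = (M : ℝ) ^ p := by simp [hM]
  let s : Finset (Fin p → F) := Finset.univ.filter fun i => Function.Injective i
  have hs : ∑ i : Fin p ↪ F, g i = ∑ i ∈ s, g i := by
    have := Finset.sum_map (Finset.univ : Finset (Fin p ↪ F))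
      ⟨fun i => (i : Fin p → F), DFunLike.coe_injective⟩ g
    rw [show s = Finset.univ.map
      (⟨fun i => (i : Fin p → F), DFunLike.coe_injective⟩ : (Fin p ↪ F) ↪ (Fin p → F)) from ?_]
    · exact this.symm
    · ext i
      simp only [s, Finset.mem_filter, Finset.mem_univ, true_and, Finset.mem_map,
        Function.Embedding.coeFn_mk]
      exact ⟨fun h => ⟨⟨i, h⟩, rfl⟩, by rintro ⟨a, rfl⟩; exact a.injective⟩
  have hscard : (s.card : ℝ) = I := by
    rw [hI, ← Finset.card_univ, ← Finset.card_map
      (⟨fun i => (i : Fin p → F), DFunLike.coe_injective⟩ : (Fin p ↪ F) ↪ (Fin p → F))]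
    congr 2
    ext i
    simp only [s, Finset.mem_filter, Finset.mem_univ, true_and, Finset.mem_map,
      Function.Embedding.coeFn_mk]
    exact ⟨fun h => ⟨⟨i, h⟩, rfl⟩, by rintro ⟨a, rfl⟩; exact a.injective⟩
  have hsc : (sᶜ.card : ℝ) = (M : ℝ) ^ p - I := by
    have := Finset.card_add_card_compl s
    rw [← hscard, ← hT, ← this]
    push_cast; ring
  have b1 : |∑ i ∈ s, g i| ≤ I * c := by
    refine (Finset.abs_sum_le_sum_abs _ _).trans ?_
    rw [← hscard, ← nsmul_eq_mul]
    exact Finset.sum_le_card_nsmul _ _ _ fun i _ => hg i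
  have b2 : |∑ i ∈ sᶜ, g i| ≤ ((M : ℝ) ^ p - I) * c := by
    refine (Finset.abs_sum_le_sum_abs _ _).trans ?_
    rw [← hsc, ← nsmul_eq_mul]
    exact Finset.sum_le_card_nsmul _ _ _ fun i _ => hg i
  have hIT : I ≤ (M : ℝ) ^ p := by
    have : (0 : ℝ) ≤ sᶜ.card := by positivity
    linarith
  have hlow : 1 - I / (M : ℝ) ^ p ≤ (p : ℝ) ^ 2 / M := by
    have := descFactorial_lower M p hp
    rw [← hIM] at this
    rw [sub_le_iff_le_add, div_add_div _ _ hM0.ne' hMp.ne', le_div_iff₀ (by positivity)]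
    nlinarith
  -- The injective tuples are reweighted and the others lose their mass; each of the two changes is
  -- at most c(1 − I/M^p).
  have key : unifAvg (fun i : Fin p ↪ F => g i) - unifAvg g =
      (I⁻¹ - ((M : ℝ) ^ p)⁻¹) * ∑ i ∈ s, g i - ((M : ℝ) ^ p)⁻¹ * ∑ i ∈ sᶜ, g i := by
    unfold unifAvg
    rw [hT, hs, ← Finset.sum_add_sum_compl s g]
    ring
  rw [key]
  have hinv : 0 ≤ I⁻¹ - ((M : ℝ) ^ p)⁻¹ := sub_nonneg.mpr (inv_anti₀ hI0 hIT)
  calc _ ≤ |(I⁻¹ - ((M : ℝ) ^ p)⁻¹) * ∑ i ∈ s, g i| + |((M : ℝ) ^ p)⁻¹ * ∑ i ∈ sᶜ, g i| :=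
        abs_sub _ _
    _ ≤ (I⁻¹ - ((M : ℝ) ^ p)⁻¹) * (I * c) + ((M : ℝ) ^ p)⁻¹ * (((M : ℝ) ^ p - I) * c) := by
        rw [abs_mul, abs_mul, abs_of_nonneg hinv, abs_of_pos (inv_pos.mpr hMp)]
        gcongr
    _ = 2 * c * (1 - I / (M : ℝ) ^ p) := by field_simp; ring
    _ ≤ _ := by gcongr

end UnifAvg

lemma matchAvg_eq_unifAvg {P : Set ℕ} {N : ℕ} (d : Fin N → ℕ) (E S : P →₀ ℕ)
    (Φ : Matching d E S → ℝ) : matchAvg d E S Φ = unifAvg Φ := rfl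

/-! ### Extending a uniform injection -/

section Extension

variable {A B V : Type*}

/-- The points that are not in the range of an injection. -/
def Free (f : A ↪ V) : Type _ := ↥(Set.range f)ᶜ

/-- The inclusion of the free points. -/
def Free.val {f : A ↪ V} (v : Free f) : V := Subtype.val (p := fun x => x ∈ (Set.range f)ᶜ) v

instance (f : A ↪ V) [Finite V] : Fintype (Free f) :=
  @Fintype.ofFinite _ (inferInstanceAs (Finite ↥(Set.range f)ᶜ))

lemma card_free [Fintype A] [Fintype V] (f : A ↪ V) :
    Fintype.card (Free f) = Fintype.card V - Fintype.card A := by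
  classical
  rw [← Set.card_range_of_injective f.injective, ← Fintype.card_compl_set]
  exact Fintype.card_congr (Equiv.refl _)

/-- The injection on a sum obtained from an injection and an injection into the free points. -/
def joinEmb (f : A ↪ V) (i : B ↪ Free f) : A ⊕ B ↪ V :=
  Equiv.sumEmbeddingEquivSigmaEmbeddingRestricted.symm ⟨f, i⟩

lemma joinEmb_inl (f : A ↪ V) (i : B ↪ Free f) (a : A) : joinEmb f i (Sum.inl a) = f a := rfl

lemma joinEmb_inr (f : A ↪ V) (i : B ↪ Free f) (b : B) :
    joinEmb f i (Sum.inr b) = (i b).val := rfl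

/-- The number of extensions of an injection does not depend on the injection, so a uniform
injection can be built one block at a time. -/
lemma unifAvg_embedding_sum [Fintype A] [Fintype B] [Fintype V] (Φ : (A ⊕ B ↪ V) → ℝ) :
    unifAvg Φ = unifAvg fun f : A ↪ V => unifAvg fun i : B ↪ Free f => Φ (joinEmb f i) := by
  let e : (A ⊕ B ↪ V) ≃ Σ f : A ↪ V, B ↪ Free f :=
    Equiv.sumEmbeddingEquivSigmaEmbeddingRestricted
  rw [← unifAvg_equiv e.symm]
  refine (unifAvg_sigma (α := A ↪ V) (γ := fun f => B ↪ Free f)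
    (M := Nat.descFactorial (Fintype.card V - Fintype.card A) (Fintype.card B)) ?_ _).trans rfl
  intro f
  rw [Fintype.card_embedding_eq, card_free]

end Extension

/-! ### Adding one hyperedge or one site to a graph -/

section AddOne

variable {P : Set ℕ}

/-- `E'` has exactly one more object of type `p` than `E`. -/
structure IsSuccAt (p : P) (E E' : P →₀ ℕ) : Prop where
  at_self : E' p = E p + 1
  at_ne : ∀ q, q ≠ p → E' q = E q

variable {p : P} {E E' S S' : P →₀ ℕ}

lemma IsSuccAt.le (h : IsSuccAt p E E') (q : P) : E q ≤ E' q := by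
  by_cases hq : q = p
  · subst hq; rw [h.at_self]; omega
  · rw [h.at_ne q hq]

lemma IsSuccAt.mem_support (h : IsSuccAt p E E') {q : P} (hq : q ∈ E.support) :
    q ∈ E'.support := by
  rw [Finsupp.mem_support_iff] at hq ⊢
  have := h.le q
  omega

lemma IsSuccAt.self_mem (h : IsSuccAt p E E') : p ∈ E'.support := by
  rw [Finsupp.mem_support_iff, h.at_self]; omega

/-- Old sites among the new ones. -/
def IsSuccAt.castSite (h : IsSuccAt p E E') (x : SiteHalf E) : SiteHalf E' :=
  ⟨⟨x.1, h.mem_support x.1.2⟩, ⟨x.2, x.2.2.trans_le (h.le _)⟩⟩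

/-- The new site. -/
def IsSuccAt.newSite (h : IsSuccAt p E E') : SiteHalf E' :=
  ⟨⟨p, h.self_mem⟩, ⟨E p, by simp [h.at_self]⟩⟩

/-- Old edge half-edges among the new ones. -/
def IsSuccAt.castHalf (h : IsSuccAt p E E') (x : EdgeHalf E) : EdgeHalf E' :=
  ⟨⟨x.1, h.mem_support x.1.2⟩, ⟨x.2.1, x.2.1.2.trans_le (h.le _)⟩, x.2.2⟩

/-- The half-edges of the new edge. -/
def IsSuccAt.newHalf (h : IsSuccAt p E E') (j : Fin (p : ℕ)) : EdgeHalf E' :=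
  ⟨⟨p, h.self_mem⟩, ⟨E p, by simp [h.at_self]⟩, j⟩

/-- The new object takes the last index `E p` of its type. Hence the old graph never reads the
disorder variables attached to it, which makes the resampling below possible. -/
lemma IsSuccAt.bijective_site (h : IsSuccAt p E E') :
    Function.Bijective (Sum.elim h.castSite fun _ : Unit => h.newSite) := by
  constructor
  · rintro (⟨⟨q, hq⟩, ⟨l, hl⟩⟩ | _) (⟨⟨q', hq'⟩, ⟨l', hl'⟩⟩ | _) hxy
    · simp only [Sum.elim_inl, IsSuccAt.castSite, Sigma.mk.injEq, Subtype.mk.injEq] at hxy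
      obtain ⟨rfl, h2⟩ := hxy
      simp at h2
      subst h2; rfl
    · simp only [Sum.elim_inl, Sum.elim_inr, IsSuccAt.castSite, IsSuccAt.newSite, Sigma.mk.injEq,
        Subtype.mk.injEq] at hxy
      obtain ⟨rfl, h2⟩ := hxy
      simp at h2
      simp at hl; omega
    · simp only [Sum.elim_inl, Sum.elim_inr, IsSuccAt.castSite, IsSuccAt.newSite, Sigma.mk.injEq,
        Subtype.mk.injEq] at hxy
      obtain ⟨rfl, h2⟩ := hxy
      simp at h2
      simp at hl'; omega
    · rfl
  · rintro ⟨⟨q, hq⟩, ⟨l, hl⟩⟩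
    by_cases hqp : q = p ∧ l = E p
    · obtain ⟨rfl, rfl⟩ := hqp
      exact ⟨Sum.inr (), rfl⟩
    · have hl2 : l < E q := by
        simp only at hl
        by_cases hq' : q = p
        · subst hq'
          rw [h.at_self] at hl
          have : l ≠ E q := fun hh => hqp ⟨rfl, hh⟩
          omega
        · rwa [h.at_ne q hq'] at hl
      exact ⟨Sum.inl ⟨⟨q, Finsupp.mem_support_iff.mpr (by omega)⟩, ⟨l, hl2⟩⟩, rfl⟩

lemma IsSuccAt.bijective_half (h : IsSuccAt p E E') :
    Function.Bijective (Sum.elim h.castHalf h.newHalf) := by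
  constructor
  · rintro (⟨⟨q, hq⟩, ⟨l, hl⟩, j⟩ | j) (⟨⟨q', hq'⟩, ⟨l', hl'⟩, j'⟩ | j') hxy
    · simp only [Sum.elim_inl, IsSuccAt.castHalf, Sigma.mk.injEq, Subtype.mk.injEq] at hxy
      obtain ⟨rfl, h2⟩ := hxy
      simp at h2
      obtain ⟨rfl, rfl⟩ := h2; rfl
    · simp only [Sum.elim_inl, Sum.elim_inr, IsSuccAt.castHalf, IsSuccAt.newHalf, Sigma.mk.injEq,
        Subtype.mk.injEq] at hxy
      obtain ⟨rfl, h2⟩ := hxy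
      simp at h2
      simp at hl; omega
    · simp only [Sum.elim_inl, Sum.elim_inr, IsSuccAt.castHalf, IsSuccAt.newHalf, Sigma.mk.injEq,
        Subtype.mk.injEq] at hxy
      obtain ⟨rfl, h2⟩ := hxy
      simp at h2
      simp at hl'; omega
    · simp only [Sum.elim_inr, IsSuccAt.newHalf, Sigma.mk.injEq] at hxy
      simpa using hxy
  · rintro ⟨⟨q, hq⟩, ⟨l, hl⟩, j⟩
    by_cases hqp : q = p ∧ l = E p
    · obtain ⟨rfl, rfl⟩ := hqp
      exact ⟨Sum.inr j, rfl⟩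
    · have hl2 : l < E q := by
        simp only at hl
        by_cases hq' : q = p
        · subst hq'
          rw [h.at_self] at hl
          have : l ≠ E q := fun hh => hqp ⟨rfl, hh⟩
          omega
        · rwa [h.at_ne q hq'] at hl
      exact ⟨Sum.inl ⟨⟨q, Finsupp.mem_support_iff.mpr (by omega)⟩, ⟨l, hl2⟩, j⟩, rfl⟩

/-- Half-edges of a graph with one more edge. -/
def IsSuccAt.edgeEquiv (h : IsSuccAt p E E') (S : P →₀ ℕ) :
    (EdgeHalf E ⊕ SiteHalf S) ⊕ Fin (p : ℕ) ≃ EdgeHalf E' ⊕ SiteHalf S :=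
  ((Equiv.sumAssoc _ _ _).trans ((Equiv.refl _).sumCongr (Equiv.sumComm _ _))).trans <|
    (Equiv.sumAssoc _ _ _).symm.trans <|
      (Equiv.ofBijective _ h.bijective_half).sumCongr (Equiv.refl _)

/-- Half-edges of a graph with one more site. -/
def IsSuccAt.siteEquiv (h : IsSuccAt p S S') (E : P →₀ ℕ) :
    (EdgeHalf E ⊕ SiteHalf S) ⊕ Unit ≃ EdgeHalf E ⊕ SiteHalf S' :=
  (Equiv.sumAssoc _ _ _).trans <|
    (Equiv.refl _).sumCongr (Equiv.ofBijective _ h.bijective_site)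

variable {N : ℕ} {d : Fin N → ℕ}

/-- Adding an edge to a matching. -/
def IsSuccAt.addEdge (h : IsSuccAt p E E') (m : Matching d E S) (i : Fin (p : ℕ) ↪ Free m) :
    Matching d E' S :=
  (h.edgeEquiv S).symm.toEmbedding.trans (joinEmb m i)

/-- Adding a site to a matching. -/
def IsSuccAt.addSite (h : IsSuccAt p S S') (m : Matching d E S) (i : Free m) :
    Matching d E S' :=
  (h.siteEquiv E).symm.toEmbedding.trans
    (joinEmb m ⟨fun _ : Unit => i, fun _ _ _ => rfl⟩)

lemma IsSuccAt.addEdge_inl_cast (h : IsSuccAt p E E') (m : Matching d E S)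
    (i : Fin (p : ℕ) ↪ Free m) (x : EdgeHalf E) :
    h.addEdge m i (Sum.inl (h.castHalf x)) = m (Sum.inl x) := by
  have : (h.edgeEquiv S).symm (Sum.inl (h.castHalf x)) = Sum.inl (Sum.inl x) := by
    rw [Equiv.symm_apply_eq]; rfl
  simp only [addEdge, Function.Embedding.trans_apply, Equiv.coe_toEmbedding, this, joinEmb_inl]

lemma IsSuccAt.addEdge_inl_new (h : IsSuccAt p E E') (m : Matching d E S)
    (i : Fin (p : ℕ) ↪ Free m) (j : Fin (p : ℕ)) :
    h.addEdge m i (Sum.inl (h.newHalf j)) = (i j).val := by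
  have : (h.edgeEquiv S).symm (Sum.inl (h.newHalf j)) = Sum.inr j := by
    rw [Equiv.symm_apply_eq]; rfl
  simp only [addEdge, Function.Embedding.trans_apply, Equiv.coe_toEmbedding, this, joinEmb_inr]

lemma IsSuccAt.addEdge_inr (h : IsSuccAt p E E') (m : Matching d E S)
    (i : Fin (p : ℕ) ↪ Free m) (x : SiteHalf S) :
    h.addEdge m i (Sum.inr x) = m (Sum.inr x) := by
  have : (h.edgeEquiv S).symm (Sum.inr x) = Sum.inl (Sum.inr x) := by
    rw [Equiv.symm_apply_eq]; rfl
  simp only [addEdge, Function.Embedding.trans_apply, Equiv.coe_toEmbedding, this, joinEmb_inl]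

lemma IsSuccAt.addSite_inl (h : IsSuccAt p S S') (m : Matching d E S) (i : Free m)
    (x : EdgeHalf E) : h.addSite m i (Sum.inl x) = m (Sum.inl x) := by
  have : (h.siteEquiv E).symm (Sum.inl x) = Sum.inl (Sum.inl x) := by
    rw [Equiv.symm_apply_eq]; rfl
  simp only [addSite, Function.Embedding.trans_apply, Equiv.coe_toEmbedding, this, joinEmb_inl]

lemma IsSuccAt.addSite_inr_cast (h : IsSuccAt p S S') (m : Matching d E S) (i : Free m)
    (x : SiteHalf S) : h.addSite m i (Sum.inr (h.castSite x)) = m (Sum.inr x) := by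
  have : (h.siteEquiv E).symm (Sum.inr (h.castSite x)) = Sum.inl (Sum.inr x) := by
    rw [Equiv.symm_apply_eq]; rfl
  simp only [addSite, Function.Embedding.trans_apply, Equiv.coe_toEmbedding, this, joinEmb_inl]

lemma IsSuccAt.addSite_inr_new (h : IsSuccAt p S S') (m : Matching d E S) (i : Free m) :
    h.addSite m i (Sum.inr h.newSite) = i.val := by
  have : (h.siteEquiv E).symm (Sum.inr h.newSite) = Sum.inr () := by
    rw [Equiv.symm_apply_eq]; rfl
  simp only [addSite, Function.Embedding.trans_apply, Equiv.coe_toEmbedding, this, joinEmb_inr]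
  rfl

/-- Sequential construction of the uniform matching. Averages over empty types are 0, so the
identity also holds when the new half-edges do not fit. -/
lemma IsSuccAt.matchAvg_edge (h : IsSuccAt p E E') (Φ : Matching d E' S → ℝ) :
    matchAvg d E' S Φ = matchAvg d E S fun m =>
      unifAvg fun i : Fin (p : ℕ) ↪ Free m => Φ (h.addEdge m i) := by
  rw [matchAvg_eq_unifAvg, matchAvg_eq_unifAvg,
    ← unifAvg_equiv ((h.edgeEquiv S).embeddingCongr (Equiv.refl (VertexHalf d))) Φ,
    unifAvg_embedding_sum]
  rfl

lemma IsSuccAt.matchAvg_site (h : IsSuccAt p S S') (Φ : Matching d E S' → ℝ) :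
    matchAvg d E S' Φ = matchAvg d E S fun m =>
      unifAvg fun i : Free m => Φ (h.addSite m i) := by
  rw [matchAvg_eq_unifAvg, matchAvg_eq_unifAvg,
    ← unifAvg_equiv ((h.siteEquiv E).embeddingCongr (Equiv.refl (VertexHalf d))) Φ,
    unifAvg_embedding_sum]
  congr 1
  ext m
  rw [← unifAvg_equiv (Equiv.uniqueEmbeddingEquivResult (α := Unit) (β := Free m)).symm]
  rfl

variable {Γ : Type*}

/-- The pairs (type, index) label hyperedges just as well as sites, so this splitting is used for
both energies. -/
lemma IsSuccAt.sum_site (h : IsSuccAt p E E') (f : SiteHalf E' → ℝ) :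
    ∑ q : E'.support, ∑ l : Fin (E' q.1), f ⟨q, l⟩ =
      (∑ q : E.support, ∑ l : Fin (E q.1), f (h.castSite ⟨q, l⟩)) + f h.newSite := by
  rw [← Fintype.sum_sigma', ← Fintype.sum_sigma' (f := fun q l => f (h.castSite ⟨q, l⟩)),
    ← (Equiv.ofBijective _ h.bijective_site).sum_comp]
  simp

lemma IsSuccAt.edgeEnergy_addEdge (h : IsSuccAt p E E') (ω : Disorder P Γ) (m : Matching d E S)
    (i : Fin (p : ℕ) ↪ Free m) (σ : Fin N → Spin) :
    edgeEnergy ω (h.addEdge m i) σ =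
      edgeEnergy ω m σ + ω.edge p (E p) fun j => σ (i j).val.1 := by
  unfold edgeEnergy
  rw [h.sum_site (fun x : SiteHalf E' => ω.edge x.1.1 x.2
    (fun j => σ ((h.addEdge m i) (Sum.inl ⟨x.1, x.2, j⟩)).1))]
  have h1 : ∀ j, (h.addEdge m i) (Sum.inl ⟨h.newSite.1, h.newSite.2, j⟩) = (i j).val :=
    fun j => h.addEdge_inl_new m i j
  have h2 : ∀ (q : E.support) (l : Fin (E q.1)) j,
      (h.addEdge m i) (Sum.inl ⟨(h.castSite ⟨q, l⟩).1, (h.castSite ⟨q, l⟩).2, j⟩) =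
        m (Sum.inl ⟨q, l, j⟩) := fun q l j => h.addEdge_inl_cast m i ⟨q, l, j⟩
  simp only [h1, h2]
  simp only [castSite, newSite]
  ring

lemma IsSuccAt.siteEnergy_addEdge (h : IsSuccAt p E E') (ω : Disorder P Γ) (m : Matching d E S)
    (i : Fin (p : ℕ) ↪ Free m) (γ : Γ) (σ : Fin N → Spin) :
    siteEnergy ω (h.addEdge m i) γ σ = siteEnergy ω m γ σ := by
  simp only [siteEnergy, h.addEdge_inr]

lemma IsSuccAt.edgeEnergy_addSite (h : IsSuccAt p S S') (ω : Disorder P Γ) (m : Matching d E S)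
    (i : Free m) (σ : Fin N → Spin) :
    edgeEnergy ω (h.addSite m i) σ = edgeEnergy ω m σ := by
  simp only [edgeEnergy, h.addSite_inl]

lemma IsSuccAt.siteEnergy_addSite (h : IsSuccAt p S S') (ω : Disorder P Γ) (m : Matching d E S)
    (i : Free m) (γ : Γ) (σ : Fin N → Spin) :
    siteEnergy ω (h.addSite m i) γ σ = siteEnergy ω m γ σ +
      siteFun (ω.site p (S p)) (fun l => ω.field p (S p) l γ) (σ i.val.1) := by
  unfold siteEnergy
  rw [h.sum_site (fun x : SiteHalf S' => siteFun (ω.site x.1.1 x.2)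
    (fun l => ω.field x.1.1 x.2 l γ) (σ ((h.addSite m i) (Sum.inr x)).1))]
  simp only [h.addSite_inr_new, h.addSite_inr_cast]
  simp only [castSite, newSite]

end AddOne

/-! ### Resampling components of a product measure -/

section Resample

/-- Replacing a coordinate by an independent copy keeps the law; it suffices to check this on finite
boxes. -/
lemma measurePreserving_update_infinitePi {ι : Type*} [DecidableEq ι] {X : ι → Type*}
    [∀ i, MeasurableSpace (X i)] (μ : ∀ i, Measure (X i)) [∀ i, IsProbabilityMeasure (μ i)]
    (i : ι) :
    MeasurePreserving (fun z : (∀ i, X i) × X i => Function.update z.1 i z.2)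
      ((Measure.infinitePi μ).prod (μ i)) (Measure.infinitePi μ) := by
  have hm : Measurable (fun z : (∀ i, X i) × X i => Function.update z.1 i z.2) := by
    refine measurable_pi_iff.mpr fun j => ?_
    by_cases hj : j = i
    · subst hj; simpa using measurable_snd
    · simpa [Function.update_of_ne hj, Function.comp_def] using
        (measurable_pi_apply j).comp measurable_fst
  refine ⟨hm, Measure.eq_infinitePi _ fun s t ht => ?_⟩
  rw [Measure.map_apply hm (MeasurableSet.pi s.countable_toSet fun j _ => ht j)]
  have hpre : (fun z : (∀ i, X i) × X i => Function.update z.1 i z.2) ⁻¹' Set.pi (s : Set ι) t =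
      (Set.pi ((s.erase i : Finset ι) : Set ι) t) ×ˢ (if i ∈ s then t i else Set.univ) := by
    ext ⟨x, y⟩
    simp only [Set.mem_preimage, Set.mem_pi, Set.mem_prod, Finset.mem_coe, Finset.mem_erase]
    constructor
    · intro h
      refine ⟨fun j hj => by simpa [Function.update_of_ne hj.1] using h j hj.2, ?_⟩
      split_ifs with hi
      · simpa using h i hi
      · trivial
    · rintro ⟨h1, h2⟩ j hj
      by_cases hji : j = i
      · subst hji
        simpa [hj] using h2
      · simpa [Function.update_of_ne hji] using h1 j ⟨hji, hj⟩
  rw [hpre, Measure.prod_prod, Measure.infinitePi_pi _ fun j _ => ht j]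
  split_ifs with hi
  · rw [mul_comm, Finset.mul_prod_erase s (fun j => μ j (t j)) hi]
  · rw [Finset.erase_eq_of_notMem hi, measure_univ, mul_one]

/-- Infinitely many coordinates are replaced at once, namely those in the range of `e`. The left
inverse `r` makes membership in that range the test `e (r i) = i`. This is applied to the whole
sequence of fields of one site. -/
lemma measurePreserving_replace_infinitePi {I J X : Type*} [DecidableEq I] [MeasurableSpace X]
    (μ : Measure X) [IsProbabilityMeasure μ] (e : J → I) (r : I → J) (_hr : ∀ j, r (e j) = j) :
    MeasurePreserving
      (fun (z : (I → X) × (J → X)) i => if e (r i) = i then z.2 (r i) else z.1 i)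
      ((Measure.infinitePi fun _ : I => μ).prod (Measure.infinitePi fun _ : J => μ))
      (Measure.infinitePi fun _ : I => μ) := by
  classical
  have hm : Measurable
      (fun (z : (I → X) × (J → X)) i => if e (r i) = i then z.2 (r i) else z.1 i) := by
    refine measurable_pi_iff.mpr fun j => ?_
    split_ifs with hj
    · exact (measurable_pi_apply _).comp measurable_snd
    · exact (measurable_pi_apply _).comp measurable_fst
  refine ⟨hm, Measure.eq_infinitePi _ fun s t ht => ?_⟩
  rw [Measure.map_apply hm (MeasurableSet.pi s.countable_toSet fun j _ => ht j)]
  have hpre : (fun (z : (I → X) × (J → X)) i => if e (r i) = i then z.2 (r i) else z.1 i) ⁻¹'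
      Set.pi (s : Set I) t =
      (Set.pi ((s.filter fun i => ¬ e (r i) = i : Finset I) : Set I) t) ×ˢ
        (Set.pi (((s.filter fun i => e (r i) = i).image r : Finset J) : Set J)
          fun j => t (e j)) := by
    ext ⟨x, y⟩
    simp only [Set.mem_preimage, Set.mem_pi, Set.mem_prod, Finset.mem_coe, Finset.mem_filter,
      Finset.mem_image]
    constructor
    · intro h
      refine ⟨fun j hj => by simpa [hj.2] using h j hj.1, ?_⟩
      rintro _ ⟨i, ⟨hi, hi2⟩, rfl⟩
      simpa [hi2] using h i hi
    · rintro ⟨h1, h2⟩ j hj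
      split_ifs with hc
      · simpa [hc] using h2 (r j) ⟨j, ⟨hj, hc⟩, rfl⟩
      · exact h1 j ⟨hj, hc⟩
  have hinj : Set.InjOn r (s.filter fun i => e (r i) = i : Finset I) := by
    intro a ha b hb hab
    simp only [Finset.coe_filter, Set.mem_ofPred_eq] at ha hb
    rw [← ha.2, ← hb.2, hab]
  rw [hpre, Measure.prod_prod, Measure.infinitePi_pi _ fun j _ => ht j,
    Measure.infinitePi_pi _ fun j _ => ht (e j), Finset.prod_image hinj,
    ← Finset.prod_filter_not_mul_prod_filter s fun i => e (r i) = i]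
  congr 1
  refine Finset.prod_congr rfl fun i hi => ?_
  rw [(Finset.mem_filter.mp hi).2]

variable {A B R T : Type*} [MeasurableSpace A] [MeasurableSpace B] [MeasurableSpace R]
  [MeasurableSpace T] {μA : Measure A} {μB : Measure B} {μR : Measure R} {μT : Measure T}
  [SFinite μA] [SFinite μB] [SFinite μR] [SFinite μT]

lemma measurePreserving_resample_right {U : R × T → R}
    (hU : MeasurePreserving U (μR.prod μT) μR) :
    MeasurePreserving (fun z : (A × R) × T => (z.1.1, U (z.1.2, z.2)))
      ((μA.prod μR).prod μT) (μA.prod μR) :=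
  ((MeasurePreserving.id μA).prod hU).comp (measurePreserving_prodAssoc μA μR μT)

lemma measurePreserving_resample_left {U : B × T → B}
    (hU : MeasurePreserving U (μB.prod μT) μB) :
    MeasurePreserving (fun z : (B × R) × T => (U (z.1.1, z.2), z.1.2))
      ((μB.prod μR).prod μT) (μB.prod μR) :=
  (Measure.measurePreserving_swap (μ := μR) (ν := μB)).comp <|
    (measurePreserving_resample_right hU).comp <|
      (Measure.measurePreserving_swap (μ := μB) (ν := μR)).prod (MeasurePreserving.id μT)

end Resample

/-! ### Resampling the variables of one edge or one site -/

section Disorder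

variable {P : Set ℕ} {Γ : Type*} (L : Laws P Γ)

instance : IsProbabilityMeasure L.disorder := by
  unfold Laws.disorder; infer_instance

instance (p : P) : IsProbabilityMeasure (L.disorderFresh p) := by
  unfold Laws.disorderFresh; infer_instance

/-- The disorder with the function of an edge replaced. -/
def Disorder.setEdge (ω : Disorder P Γ) (p : P) (n : ℕ) (θ : EdgeFun p) : Disorder P Γ :=
  (Function.update ω.1 (p, n) θ, ω.2)

/-- The disorder with the function of a site and its fields replaced. -/
def Disorder.setSite (ω : Disorder P Γ) (p : P) (n : ℕ) (θ : EdgeFun p) (x : ℕ → Γ → ℝ) :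
    Disorder P Γ :=
  (ω.1, Function.update ω.2.1 (p, n) θ, ω.2.2.1,
    (fun i => if (p, n, i.2.2) = i then x i.2.2 else ω.2.2.2.1 i), ω.2.2.2.2)

/-- The function of a new edge may be regarded as a fresh copy, independent of the disorder of the
old graph; the next lemma does the same for a site and its fields. -/
lemma measurePreserving_setEdge (p : P) (n : ℕ) :
    MeasurePreserving (fun z : Disorder P Γ × EdgeFun p => z.1.setEdge p n z.2)
      (L.disorder.prod (L.θ p : Measure (EdgeFun p))) L.disorder := by
  have := measurePreserving_update_infinitePi
    (fun i : P × ℕ => (L.θ i.1 : Measure (EdgeFun i.1))) (p, n)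
  exact measurePreserving_resample_left
    (μR := (Measure.infinitePi fun i : P × ℕ => (L.θ i.1 : Measure (EdgeFun i.1))).prod <|
      (Measure.infinitePi fun _ : ℕ => (L.h : Measure (Spin → ℝ))).prod <|
      (Measure.infinitePi fun _ : P × ℕ × ℕ => (L.x : Measure (Γ → ℝ))).prod
        (L.v : Measure (Γ → ℝ))) this

lemma measurePreserving_setSite (p : P) (n : ℕ) :
    MeasurePreserving (fun z : Disorder P Γ × EdgeFun p × (ℕ → Γ → ℝ) =>
      z.1.setSite p n z.2.1 z.2.2) (L.disorderFresh p) L.disorder := by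
  have h1 := measurePreserving_update_infinitePi
    (fun i : P × ℕ => (L.θ i.1 : Measure (EdgeFun i.1))) (p, n)
  have h2 := measurePreserving_replace_infinitePi (L.x : Measure (Γ → ℝ))
    (fun l : ℕ => ((p, n, l) : P × ℕ × ℕ)) (fun i => i.2.2) fun _ => rfl
  have h1' := measurePreserving_resample_right
    (μA := Measure.infinitePi fun i : P × ℕ => (L.θ i.1 : Measure (EdgeFun i.1)))
    (measurePreserving_resample_left
    (μR := (Measure.infinitePi fun _ : ℕ => (L.h : Measure (Spin → ℝ))).prod <|
      (Measure.infinitePi fun _ : P × ℕ × ℕ => (L.x : Measure (Γ → ℝ))).prod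
        (L.v : Measure (Γ → ℝ))) h1)
  have h2' := measurePreserving_resample_right
    (μA := Measure.infinitePi fun i : P × ℕ => (L.θ i.1 : Measure (EdgeFun i.1)))
    (measurePreserving_resample_right
    (μA := Measure.infinitePi fun i : P × ℕ => (L.θ i.1 : Measure (EdgeFun i.1)))
    (measurePreserving_resample_right
    (μA := Measure.infinitePi fun _ : ℕ => (L.h : Measure (Spin → ℝ)))
    (measurePreserving_resample_left (μR := (L.v : Measure (Γ → ℝ))) h2)))
  have h3 := (h2'.comp (h1'.prod (MeasurePreserving.id
    (Measure.infinitePi fun _ : ℕ => (L.x : Measure (Γ → ℝ)))))).comp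
      (MeasurePreserving.symm MeasurableEquiv.prodAssoc (measurePreserving_prodAssoc L.disorder
        (L.θ p : Measure (EdgeFun p)) (Measure.infinitePi fun _ : ℕ => (L.x : Measure (Γ → ℝ)))))
  exact h3

/-- The graph only reads indices below `E p`, and the replaced entry has index `E p`. -/
lemma edgeEnergy_setEdge {p : P} {E S : P →₀ ℕ} {N : ℕ} {d : Fin N → ℕ}
    (ω : Disorder P Γ) (θ : EdgeFun p) (m : Matching d E S) (σ : Fin N → Spin) :
    edgeEnergy (ω.setEdge p (E p) θ) m σ = edgeEnergy ω m σ := by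
  unfold edgeEnergy
  congr 1
  refine Finset.sum_congr rfl fun q _ => Finset.sum_congr rfl fun l _ => ?_
  have : ((q.1, (l : ℕ)) : P × ℕ) ≠ (p, E p) := by
    intro h
    rw [Prod.mk.injEq] at h
    obtain ⟨h1, h2⟩ := h
    have h3 := l.2
    have h4 : E q.1 = E p := congrArg E h1
    omega
  simp only [Disorder.edge, Disorder.setEdge, Function.update_of_ne this]

lemma siteEnergy_setEdge {p : P} {E S : P →₀ ℕ} {N : ℕ} {d : Fin N → ℕ} {n : ℕ}
    (ω : Disorder P Γ) (θ : EdgeFun p) (m : Matching d E S) (γ : Γ) (σ : Fin N → Spin) :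
    siteEnergy (ω.setEdge p n θ) m γ σ = siteEnergy ω m γ σ := rfl

lemma edgeEnergy_setSite {p : P} {E S : P →₀ ℕ} {N : ℕ} {d : Fin N → ℕ} {n : ℕ}
    (ω : Disorder P Γ) (θ : EdgeFun p) (x : ℕ → Γ → ℝ) (m : Matching d E S) (σ : Fin N → Spin) :
    edgeEnergy (ω.setSite p n θ x) m σ = edgeEnergy ω m σ := rfl

lemma siteEnergy_setSite {p : P} {E S : P →₀ ℕ} {N : ℕ} {d : Fin N → ℕ}
    (ω : Disorder P Γ) (θ : EdgeFun p) (x : ℕ → Γ → ℝ) (m : Matching d E S) (γ : Γ)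
    (σ : Fin N → Spin) :
    siteEnergy (ω.setSite p (S p) θ x) m γ σ = siteEnergy ω m γ σ := by
  unfold siteEnergy
  refine Finset.sum_congr rfl fun q _ => Finset.sum_congr rfl fun l _ => ?_
  have hne : ∀ k : ℕ, ¬ (((p, S p, k) : P × ℕ × ℕ) = (q.1, (l : ℕ), k)) := by
    intro k h
    rw [Prod.mk.injEq, Prod.mk.injEq] at h
    obtain ⟨h1, h2, -⟩ := h
    have h3 := l.2
    have h4 : S p = S q.1 := congrArg S h1
    omega
  have : ((q.1, (l : ℕ)) : P × ℕ) ≠ (p, S p) := by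
    intro h
    rw [Prod.mk.injEq] at h
    exact hne 0 (Prod.ext h.1.symm (Prod.ext h.2.symm rfl))
  simp only [Disorder.site, Disorder.field, Disorder.setSite, Function.update_of_ne this,
    if_neg (hne _)]

end Disorder

/-! ### Local averages -/

section Brackets

variable {p : ℕ}

lemma weighted_mean_mem {ι : Type*} [Fintype ι] [Nonempty ι] {w f : ι → ℝ} (hw : ∀ i, 0 < w i)
    {lo hi : ℝ} (hf : ∀ i, f i ∈ Set.Icc lo hi) :
    (∑ i, f i * w i) / ∑ i, w i ∈ Set.Icc lo hi := by
  have hpos : 0 < ∑ i, w i := Finset.sum_pos (fun i _ => hw i) Finset.univ_nonempty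
  rw [Set.mem_Icc, le_div_iff₀ hpos, div_le_iff₀ hpos, Finset.mul_sum, Finset.mul_sum]
  exact ⟨Finset.sum_le_sum fun i _ => mul_le_mul_of_nonneg_right (hf i).1 (hw i).le,
    Finset.sum_le_sum fun i _ => mul_le_mul_of_nonneg_right (hf i).2 (hw i).le⟩

lemma bracket_mem {f : EdgeFun p} {lo hi : ℝ} (hf : ∀ ε, f ε ∈ Set.Icc lo hi) (x : ℕ → ℝ) :
    bracket f x ∈ Set.Icc lo hi :=
  weighted_mean_mem (fun _ => Real.exp_pos _) hf

lemma bracketMinus_mem {f : EdgeFun p} {lo hi : ℝ} (hf : ∀ ε, f ε ∈ Set.Icc lo hi) (x : ℕ → ℝ)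
    (s : Spin) : bracketMinus f x s ∈ Set.Icc lo hi :=
  weighted_mean_mem (fun _ => Real.exp_pos _) fun _ => hf _

lemma expFun_mem {θ : EdgeFun p} {κ : ℝ} (h : ∀ ε, |θ ε| ≤ κ) (ε : Fin p → Spin) :
    expFun θ ε ∈ Set.Icc (Real.exp (-κ)) (Real.exp κ) :=
  ⟨Real.exp_le_exp.mpr (abs_le.mp (h ε)).1, Real.exp_le_exp.mpr (abs_le.mp (h ε)).2⟩

lemma bracket_expFun_nonneg (θ : EdgeFun p) (x : ℕ → ℝ) : 0 ≤ bracket (expFun θ) x :=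
  div_nonneg (Finset.sum_nonneg fun _ _ => mul_nonneg (Real.exp_pos _).le (Real.exp_pos _).le)
    (Finset.sum_nonneg fun _ _ => (Real.exp_pos _).le)

lemma bracketMinus_expFun_pos (θ : EdgeFun p) (x : ℕ → ℝ) (s : Spin) :
    0 < bracketMinus (expFun θ) x s :=
  div_pos (Finset.sum_pos (fun _ _ => mul_pos (Real.exp_pos _) (Real.exp_pos _))
      Finset.univ_nonempty)
    (Finset.sum_pos (fun _ _ => Real.exp_pos _) Finset.univ_nonempty)

lemma abs_log_le_of_mem {y κ : ℝ} (hy : y ∈ Set.Icc (Real.exp (-κ)) (Real.exp κ)) :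
    |Real.log y| ≤ κ := by
  have hpos := (Real.exp_pos (-κ)).trans_le hy.1
  rw [abs_le, Real.le_log_iff_exp_le hpos, Real.log_le_iff_le_exp hpos]
  exact hy

lemma abs_siteFun_le {θ : EdgeFun p} {κ : ℝ} (h : ∀ ε, |θ ε| ≤ κ) (x : ℕ → ℝ) (s : Spin) :
    |siteFun θ x s| ≤ κ :=
  abs_log_le_of_mem (bracketMinus_mem (expFun_mem h) x s)

lemma exp_siteFun (θ : EdgeFun p) (x : ℕ → ℝ) (s : Spin) :
    Real.exp (siteFun θ x s) = bracketMinus (expFun θ) x s :=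
  Real.exp_log (bracketMinus_expFun_pos θ x s)

variable {α : Type*} [MeasurableSpace α]

lemma measurable_bracket_expFun {θ : α → EdgeFun p} {x : α → ℕ → ℝ} (hθ : Measurable θ)
    (hx : Measurable x) : Measurable fun a => bracket (expFun (θ a)) (x a) := by
  unfold bracket expFun
  fun_prop

lemma measurable_bracketMinus_expFun {θ : α → EdgeFun p} {x : α → ℕ → ℝ} (hθ : Measurable θ)
    (hx : Measurable x) (s : Spin) :
    Measurable fun a => bracketMinus (expFun (θ a)) (x a) s := by
  unfold bracketMinus expFun
  fun_prop

end Brackets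

/-! ### Almost sure bounds on the disorder -/

section Good

variable {P : Set ℕ} {Γ : Type*}

/-- A realization of the disorder for which the almost sure bounds hold. -/
structure Disorder.Good (κ : ℝ) (ω : Disorder P Γ) : Prop where
  edge : ∀ p l ε, |ω.edge p l ε| ≤ κ
  site : ∀ p l ε, |ω.site p l ε| ≤ κ
  vertex : ∀ i s, |ω.vertex i s| ≤ κ
  weight_nonneg : ∀ γ, 0 ≤ ω.weight γ
  weight_sum : HasSum ω.weight 1

variable (L : Laws P Γ) {κ : ℝ}

lemma ae_good (hθκ : ∀ p : P, ∀ᵐ θ ∂(L.θ p : Measure (EdgeFun p)), ∀ σ, |θ σ| ≤ κ)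
    (hhκ : ∀ᵐ g ∂(L.h : Measure (Spin → ℝ)), ∀ s, |g s| ≤ κ)
    (hv : ∀ᵐ v ∂(L.v : Measure (Γ → ℝ)), (∀ γ, 0 ≤ v γ) ∧ HasSum v 1) :
    ∀ᵐ ω ∂L.disorder, Disorder.Good κ ω := by
  have e1 : ∀ᵐ a ∂(Measure.infinitePi fun i : P × ℕ => (L.θ i.1 : Measure (EdgeFun i.1))),
      ∀ i : P × ℕ, ∀ σ, |a i σ| ≤ κ := by
    rw [ae_all_iff]
    intro i
    exact (measurePreserving_eval_infinitePi
      (fun i : P × ℕ => (L.θ i.1 : Measure (EdgeFun i.1))) i).quasiMeasurePreserving.ae (hθκ i.1)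
  have e2 : ∀ᵐ a ∂(Measure.infinitePi fun _ : ℕ => (L.h : Measure (Spin → ℝ))),
      ∀ i : ℕ, ∀ s, |a i s| ≤ κ := by
    rw [ae_all_iff]
    intro i
    exact (measurePreserving_eval_infinitePi
      (fun _ : ℕ => (L.h : Measure (Spin → ℝ))) i).quasiMeasurePreserving.ae hhκ
  have h1 := (Measure.quasiMeasurePreserving_fst (μ := (Measure.infinitePi fun i : P × ℕ =>
    (L.θ i.1 : Measure (EdgeFun i.1)))) (ν := (Measure.infinitePi fun i : P × ℕ =>
    (L.θ i.1 : Measure (EdgeFun i.1))).prod <|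
      (Measure.infinitePi fun _ : ℕ => (L.h : Measure (Spin → ℝ))).prod <|
      (Measure.infinitePi fun _ : P × ℕ × ℕ => (L.x : Measure (Γ → ℝ))).prod
        (L.v : Measure (Γ → ℝ)))).ae e1
  have q2 := Measure.quasiMeasurePreserving_snd (μ := (Measure.infinitePi fun i : P × ℕ =>
    (L.θ i.1 : Measure (EdgeFun i.1)))) (ν := (Measure.infinitePi fun i : P × ℕ =>
    (L.θ i.1 : Measure (EdgeFun i.1))).prod <|
      (Measure.infinitePi fun _ : ℕ => (L.h : Measure (Spin → ℝ))).prod <|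
      (Measure.infinitePi fun _ : P × ℕ × ℕ => (L.x : Measure (Γ → ℝ))).prod
        (L.v : Measure (Γ → ℝ)))
  have h2 := q2.ae (Measure.quasiMeasurePreserving_fst.ae e1)
  have h3 := q2.ae (Measure.quasiMeasurePreserving_snd.ae
    (Measure.quasiMeasurePreserving_fst.ae e2))
  have h4 := q2.ae (Measure.quasiMeasurePreserving_snd.ae
    (Measure.quasiMeasurePreserving_snd.ae (Measure.quasiMeasurePreserving_snd.ae hv)))
  have h1' : ∀ᵐ ω ∂L.disorder, ∀ i : P × ℕ, ∀ σ, |ω.1 i σ| ≤ κ := h1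
  have h2' : ∀ᵐ ω ∂L.disorder, ∀ i : P × ℕ, ∀ σ, |ω.2.1 i σ| ≤ κ := h2
  have h3' : ∀ᵐ ω ∂L.disorder, ∀ i : ℕ, ∀ σ, |ω.2.2.1 i σ| ≤ κ := h3
  have h4' : ∀ᵐ ω ∂L.disorder, (∀ γ, 0 ≤ ω.2.2.2.2 γ) ∧ HasSum ω.2.2.2.2 1 := h4
  filter_upwards [h1', h2', h3', h4'] with ω a1 a2 a3 a4
  exact ⟨fun p l => a1 (p, l), fun p l => a2 (p, l), a3, a4.1, a4.2⟩

end Good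

/-! ### Gibbs averages -/

section Gibbs

variable {P : Set ℕ} {Γ : Type*} {N : ℕ} {d : Fin N → ℕ} {E S : P →₀ ℕ} {κ : ℝ}

/-- A bound for the energy of a graph. -/
def energyBound (κ : ℝ) (N : ℕ) (E S : P →₀ ℕ) : ℝ :=
  (∑ q : E.support, (E q.1 : ℝ) * κ) + N * κ + ∑ q : S.support, (S q.1 : ℝ) * κ

lemma abs_energy_le {ω : Disorder P Γ} (hω : ω.Good κ) (m : Matching d E S) (γ : Γ)
    (σ : Fin N → Spin) :
    |edgeEnergy ω m σ + siteEnergy ω m γ σ| ≤ energyBound κ N E S := by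
  unfold edgeEnergy siteEnergy energyBound
  refine (abs_add_le _ _).trans (add_le_add ((abs_add_le _ _).trans (add_le_add ?_ ?_)) ?_)
  · refine (Finset.abs_sum_le_sum_abs _ _).trans (Finset.sum_le_sum fun q _ => ?_)
    refine (Finset.abs_sum_le_sum_abs _ _).trans
      ((Finset.sum_le_sum fun l _ => hω.edge _ _ _).trans ?_)
    simp
  · refine (Finset.abs_sum_le_sum_abs _ _).trans
      ((Finset.sum_le_sum fun l _ => hω.vertex _ _).trans ?_)
    simp
  · refine (Finset.abs_sum_le_sum_abs _ _).trans (Finset.sum_le_sum fun q _ => ?_)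
    refine (Finset.abs_sum_le_sum_abs _ _).trans
      ((Finset.sum_le_sum fun l _ => abs_siteFun_le (hω.site _ _) _ _).trans ?_)
    simp

lemma gibbsWeight_nonneg {ω : Disorder P Γ} (hω : ω.Good κ) (m : Matching d E S) (γ : Γ)
    (σ : Fin N → Spin) : 0 ≤ gibbsWeight ω m γ σ :=
  mul_nonneg (hω.weight_nonneg γ) (Real.exp_pos _).le

lemma gibbsWeight_le {ω : Disorder P Γ} (hω : ω.Good κ) (m : Matching d E S) (γ : Γ)
    (σ : Fin N → Spin) :
    gibbsWeight ω m γ σ ≤ ω.weight γ * Real.exp (energyBound κ N E S) :=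
  mul_le_mul_of_nonneg_left (Real.exp_le_exp.mpr (abs_le.mp (abs_energy_le hω m γ σ)).2)
    (hω.weight_nonneg γ)

lemma le_gibbsWeight {ω : Disorder P Γ} (hω : ω.Good κ) (m : Matching d E S) (γ : Γ)
    (σ : Fin N → Spin) :
    ω.weight γ * Real.exp (-energyBound κ N E S) ≤ gibbsWeight ω m γ σ :=
  mul_le_mul_of_nonneg_left (Real.exp_le_exp.mpr (abs_le.mp (abs_energy_le hω m γ σ)).1)
    (hω.weight_nonneg γ)

lemma summable_gibbsWeight {ω : Disorder P Γ} (hω : ω.Good κ) (m : Matching d E S) :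
    Summable fun k : Γ × (Fin N → Spin) => gibbsWeight ω m k.1 k.2 := by
  refine Summable.of_nonneg_of_le (fun k => gibbsWeight_nonneg hω m k.1 k.2)
    (fun k => gibbsWeight_le hω m k.1 k.2) ?_
  rw [summable_prod_of_nonneg fun k => mul_nonneg (hω.weight_nonneg _) (Real.exp_pos _).le]
  refine ⟨fun γ => Summable.of_finite, ?_⟩
  simp only [tsum_fintype, Finset.sum_const, nsmul_eq_mul]
  exact (hω.weight_sum.summable.mul_right _).mul_left _

lemma partitionFun_eq_tsum {ω : Disorder P Γ} (hω : ω.Good κ) (m : Matching d E S) :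
    partitionFun ω m = ∑' k : Γ × (Fin N → Spin), gibbsWeight ω m k.1 k.2 := by
  rw [(summable_gibbsWeight hω m).tsum_prod]
  simp only [tsum_fintype]
  rfl

lemma partitionFun_mem {ω : Disorder P Γ} (hω : ω.Good κ) (m : Matching d E S) :
    partitionFun ω m ∈ Set.Icc
      (Fintype.card (Fin N → Spin) * Real.exp (-energyBound κ N E S))
      (Fintype.card (Fin N → Spin) * Real.exp (energyBound κ N E S)) := by
  have hs : Summable fun γ => ∑ σ, gibbsWeight ω m γ σ := by
    have := (summable_gibbsWeight hω m).prod
    simpa only [tsum_fintype] using this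
  have hc : ∀ c : ℝ, HasSum (fun γ => ∑ _σ : Fin N → Spin, ω.weight γ * c)
      (Fintype.card (Fin N → Spin) * c) := by
    intro c
    simp only [Finset.sum_const, nsmul_eq_mul, Finset.card_univ]
    simpa using (hω.weight_sum.mul_right c).mul_left (Fintype.card (Fin N → Spin) : ℝ)
  constructor
  · rw [← (hc _).tsum_eq]
    exact (hc _).summable.tsum_le_tsum
      (fun γ => Finset.sum_le_sum fun σ _ => le_gibbsWeight hω m γ σ) hs
  · rw [← (hc _).tsum_eq]
    exact hs.tsum_le_tsum
      (fun γ => Finset.sum_le_sum fun σ _ => gibbsWeight_le hω m γ σ) (hc _).summable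

lemma partitionFun_pos {ω : Disorder P Γ} (hω : ω.Good κ) (m : Matching d E S) :
    0 < partitionFun ω m :=
  (mul_pos (Nat.cast_pos.mpr Fintype.card_pos) (Real.exp_pos _)).trans_le
    (partitionFun_mem hω m).1

lemma abs_log_partitionFun_le {ω : Disorder P Γ} (hω : ω.Good κ) (m : Matching d E S) :
    |Real.log (partitionFun ω m)| ≤
      Real.log (Fintype.card (Fin N → Spin)) + energyBound κ N E S := by
  have hc : (1 : ℝ) ≤ Fintype.card (Fin N → Spin) := by exact_mod_cast Fintype.card_pos
  have h := partitionFun_mem hω m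
  have hpos := partitionFun_pos hω m
  have hc0 : (0 : ℝ) < Fintype.card (Fin N → Spin) := by linarith
  have h1 := Real.log_le_log (by positivity) h.1
  have h2 := Real.log_le_log hpos h.2
  rw [Real.log_mul hc0.ne' (Real.exp_pos _).ne', Real.log_exp] at h1 h2
  have := Real.log_nonneg hc
  rw [abs_le]
  constructor <;> linarith

/-- The Gibbs average is the integral for a probability measure. -/
lemma exists_gibbsMeasure [Countable Γ] {ω : Disorder P Γ} (hω : ω.Good κ)
    (m : Matching d E S) (mK : MeasurableSpace (Γ × (Fin N → Spin)))
    [DiscreteMeasurableSpace (Γ × (Fin N → Spin))] :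
    ∃ ρ : Measure (Γ × (Fin N → Spin)), IsProbabilityMeasure ρ ∧
      ∀ (g : (Fin N → Spin) → Γ → ℝ) (C : ℝ), (∀ σ γ, |g σ γ| ≤ C) →
        gibbsAvg ω m g = ∫ k, g k.2 k.1 ∂ρ := by
  have hZ := partitionFun_pos hω m
  have hsum : HasSum (fun k : Γ × (Fin N → Spin) => gibbsWeight ω m k.1 k.2 / partitionFun ω m)
      1 := by
    have := (summable_gibbsWeight hω m).hasSum.div_const (partitionFun ω m)
    rwa [← partitionFun_eq_tsum hω m, div_self hZ.ne'] at this
  have hnn : ∀ k : Γ × (Fin N → Spin), 0 ≤ gibbsWeight ω m k.1 k.2 / partitionFun ω m :=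
    fun k => div_nonneg (gibbsWeight_nonneg hω m _ _) hZ.le
  -- As `Γ` is countable, normalizing the Gibbs weights gives a discrete probability, and the Gibbs
  -- average becomes an integral to which Fubini's theorem applies.
  let q : PMF (Γ × (Fin N → Spin)) :=
    ⟨fun k => ENNReal.ofReal (gibbsWeight ω m k.1 k.2 / partitionFun ω m), by
      have := ENNReal.hasSum_coe.mpr
        ((NNReal.hasSum_coe (r := 1)).mp (by
          simpa only [NNReal.coe_one, Real.coe_toNNReal _ (hnn _)] using hsum) :
          HasSum (fun k : Γ × (Fin N → Spin) =>
            (gibbsWeight ω m k.1 k.2 / partitionFun ω m).toNNReal) 1)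
      simpa [ENNReal.ofReal] using this⟩
  refine ⟨q.toMeasure, inferInstance, fun g C hC => ?_⟩
  have hint : Integrable (fun k : Γ × (Fin N → Spin) => g k.2 k.1) q.toMeasure :=
    Integrable.of_bound (measurable_of_countable _).aestronglyMeasurable C
      (ae_of_all _ fun k => hC _ _)
  have hs2 : Summable fun k : Γ × (Fin N → Spin) => gibbsWeight ω m k.1 k.2 * g k.2 k.1 := by
    refine Summable.of_norm_bounded ((summable_gibbsWeight hω m).mul_right C) fun k => ?_
    rw [norm_mul, Real.norm_eq_abs, Real.norm_eq_abs, abs_of_nonneg (gibbsWeight_nonneg hω m _ _)]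
    exact mul_le_mul_of_nonneg_left (hC _ _) (gibbsWeight_nonneg hω m _ _)
  rw [PMF.integral_eq_tsum _ _ hint]
  unfold gibbsAvg
  have h1 : ∑' γ, ∑ σ, gibbsWeight ω m γ σ * g σ γ =
      ∑' k : Γ × (Fin N → Spin), gibbsWeight ω m k.1 k.2 * g k.2 k.1 := by
    rw [hs2.tsum_prod]
    simp only [tsum_fintype]
  rw [h1, ← tsum_div_const]
  refine tsum_congr fun k => ?_
  change _ = (ENNReal.ofReal (gibbsWeight ω m k.1 k.2 / partitionFun ω m)).toReal • _
  rw [ENNReal.toReal_ofReal (hnn k), smul_eq_mul]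
  ring

lemma gibbsAvg_mem [Countable Γ] {ω : Disorder P Γ} (hω : ω.Good κ) (m : Matching d E S)
    {g : (Fin N → Spin) → Γ → ℝ} {lo hi : ℝ} (hg : ∀ σ γ, g σ γ ∈ Set.Icc lo hi) :
    gibbsAvg ω m g ∈ Set.Icc lo hi := by
  let mK : MeasurableSpace (Γ × (Fin N → Spin)) := ⊤
  have : DiscreteMeasurableSpace (Γ × (Fin N → Spin)) := ⟨fun _ => trivial⟩
  obtain ⟨ρ, hρ, h⟩ := exists_gibbsMeasure hω m mK
  have hb : ∀ σ γ, |g σ γ| ≤ max |lo| |hi| := fun σ γ =>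
    abs_le_max_abs_abs (hg σ γ).1 (hg σ γ).2
  rw [h g _ hb]
  have hint : Integrable (fun k : Γ × (Fin N → Spin) => g k.2 k.1) ρ :=
    Integrable.of_bound (measurable_of_countable _).aestronglyMeasurable _
      (ae_of_all _ fun k => hb _ _)
  constructor
  · simpa using integral_mono (integrable_const lo) hint fun k => (hg k.2 k.1).1
  · simpa using integral_mono hint (integrable_const hi) fun k => (hg k.2 k.1).2

/-- The cavity identity Z' = Z ⟨g⟩. The lower bound `lo` keeps ⟨g⟩ positive, so that the logarithm
splits. -/
lemma log_partitionFun_of_mul [Countable Γ] {E' S' : P →₀ ℕ} {ω ω' : Disorder P Γ}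
    (hω : ω.Good κ) (m : Matching d E S) (m' : Matching d E' S') {g : (Fin N → Spin) → Γ → ℝ}
    {lo hi : ℝ} (hlo : 0 < lo) (hg : ∀ σ γ, g σ γ ∈ Set.Icc lo hi)
    (h : ∀ γ σ, gibbsWeight ω' m' γ σ = gibbsWeight ω m γ σ * g σ γ) :
    Real.log (partitionFun ω' m') =
      Real.log (partitionFun ω m) + Real.log (gibbsAvg ω m g) := by
  have hZ := partitionFun_pos hω m
  rw [← Real.log_mul hZ.ne' (hlo.trans_le (gibbsAvg_mem hω m hg).1).ne']
  unfold gibbsAvg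
  rw [mul_div_cancel₀ _ hZ.ne']
  simp only [partitionFun, h]

/-! ### Measurability -/

/-- A series of nonnegative terms is measurable as an `ENNReal` series; the signs are only known
almost surely, whence the almost everywhere version. -/
lemma aemeasurable_tsum_of_nonneg [Countable Γ] {α : Type*} [MeasurableSpace α] {μ : Measure α}
    {f : Γ → α → ℝ} (hf : ∀ γ, Measurable (f γ)) (h0 : ∀ᵐ a ∂μ, ∀ γ, 0 ≤ f γ a) :
    AEMeasurable (fun a => ∑' γ, f γ a) μ := by
  refine ⟨fun a => (∑' γ, ENNReal.ofReal (f γ a)).toReal,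
    (Measurable.tsum fun γ => (hf γ).ennreal_ofReal).ennreal_toReal, ?_⟩
  filter_upwards [h0] with a ha
  rw [ENNReal.tsum_toReal_eq fun _ => ENNReal.ofReal_ne_top]
  exact tsum_congr fun γ => (ENNReal.toReal_ofReal (ha γ)).symm

lemma measurable_gibbsWeight (m : Matching d E S) (γ : Γ) (σ : Fin N → Spin) :
    Measurable fun ω : Disorder P Γ => gibbsWeight ω m γ σ := by
  have h1 : ∀ (p : P) l ε, Measurable fun ω : Disorder P Γ => ω.edge p l ε := by
    intro p l ε; unfold Disorder.edge; fun_prop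
  have h2 : ∀ (p : P) l, Measurable fun ω : Disorder P Γ => ω.site p l := by
    intro p l; unfold Disorder.site; fun_prop
  have h3 : ∀ i s, Measurable fun ω : Disorder P Γ => ω.vertex i s := by
    intro i s; unfold Disorder.vertex; fun_prop
  have h4 : ∀ (p : P) n, Measurable fun ω : Disorder P Γ => fun l => ω.field p n l γ := by
    intro p n; unfold Disorder.field; fun_prop
  have h5 : Measurable fun ω : Disorder P Γ => ω.weight γ := by
    unfold Disorder.weight; fun_prop
  have h6 : ∀ (p : P) n s, Measurable fun ω : Disorder P Γ =>
      siteFun (ω.site p n) (fun l => ω.field p n l γ) s := fun p n s =>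
    Real.measurable_log.comp (measurable_bracketMinus_expFun (h2 p n) (h4 p n) s)
  unfold gibbsWeight edgeEnergy siteEnergy
  refine h5.mul (Real.measurable_exp.comp (((Finset.measurable_sum _ fun q _ =>
    Finset.measurable_sum _ fun l _ => h1 _ _ _).add (Finset.measurable_sum _ fun i _ =>
      h3 _ _)).add (Finset.measurable_sum _ fun q _ => Finset.measurable_sum _ fun l _ =>
        h6 _ _ _)))

lemma aemeasurable_partitionFun [Countable Γ] {μ : Measure (Disorder P Γ)}
    (hμ : ∀ᵐ ω ∂μ, ω.Good κ) (m : Matching d E S) :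
    AEMeasurable (fun ω => partitionFun ω m) μ := by
  refine aemeasurable_tsum_of_nonneg
    (fun γ => Finset.measurable_sum _ fun σ _ => measurable_gibbsWeight m γ σ) ?_
  filter_upwards [hμ] with ω hω γ
  exact Finset.sum_nonneg fun σ _ => gibbsWeight_nonneg hω m γ σ

lemma integrable_log_partitionFun [Countable Γ] {μ : Measure (Disorder P Γ)} [IsFiniteMeasure μ]
    (hμ : ∀ᵐ ω ∂μ, ω.Good κ) (m : Matching d E S) :
    Integrable (fun ω => Real.log (partitionFun ω m)) μ := by
  refine Integrable.of_bound (aemeasurable_partitionFun hμ m).log.aestronglyMeasurable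
    (Real.log (Fintype.card (Fin N → Spin)) + energyBound κ N E S) ?_
  filter_upwards [hμ] with ω hω
  exact abs_log_partitionFun_le hω m

lemma aemeasurable_gibbsAvg [Countable Γ] {T : Type*} [MeasurableSpace T]
    {μ : Measure (Disorder P Γ)} {τ : Measure T} [SFinite μ] [SFinite τ]
    (hμ : ∀ᵐ ω ∂μ, ω.Good κ) (m : Matching d E S) {g : T → (Fin N → Spin) → Γ → ℝ}
    (hg : ∀ σ γ, Measurable fun t => g t σ γ) (hg0 : ∀ t σ γ, 0 ≤ g t σ γ) :
    AEMeasurable (fun z : Disorder P Γ × T => gibbsAvg z.1 m (g z.2)) (μ.prod τ) := by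
  have hμ' : ∀ᵐ z : Disorder P Γ × T ∂μ.prod τ, z.1.Good κ :=
    Measure.quasiMeasurePreserving_fst.ae hμ
  refine AEMeasurable.div ?_
    ((aemeasurable_partitionFun hμ m).comp_quasiMeasurePreserving
      Measure.quasiMeasurePreserving_fst)
  refine aemeasurable_tsum_of_nonneg (fun γ => Finset.measurable_sum _ fun σ _ =>
    ((measurable_gibbsWeight m γ σ).comp measurable_fst).mul
      ((hg σ γ).comp measurable_snd)) ?_
  filter_upwards [hμ'] with z hz γ
  exact Finset.sum_nonneg fun σ _ => mul_nonneg (gibbsWeight_nonneg hz m γ σ) (hg0 _ _ _)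

lemma integrable_log_gibbsAvg [Countable Γ] {T : Type*} [MeasurableSpace T]
    {μ : Measure (Disorder P Γ)} {τ : Measure T} [IsFiniteMeasure μ] [IsFiniteMeasure τ]
    (hμ : ∀ᵐ ω ∂μ, ω.Good κ) (m : Matching d E S) {g : T → (Fin N → Spin) → Γ → ℝ}
    (hg : ∀ σ γ, Measurable fun t => g t σ γ) (hg0 : ∀ t σ γ, 0 ≤ g t σ γ)
    (hgκ : ∀ᵐ t ∂τ, ∀ σ γ, g t σ γ ∈ Set.Icc (Real.exp (-κ)) (Real.exp κ)) :
    Integrable (fun z : Disorder P Γ × T => Real.log (gibbsAvg z.1 m (g z.2))) (μ.prod τ) := by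
  refine Integrable.of_bound (aemeasurable_gibbsAvg hμ m hg hg0).log.aestronglyMeasurable κ ?_
  have hμ' : ∀ᵐ z : Disorder P Γ × T ∂μ.prod τ, z.1.Good κ :=
    Measure.quasiMeasurePreserving_fst.ae hμ
  filter_upwards [hμ', Measure.quasiMeasurePreserving_snd.ae hgκ] with z hz hgz
  exact abs_log_le_of_mem (gibbsAvg_mem hz m hgz)

end Gibbs

/-! ### The replica inequality -/

section Replica

/-- Weighted arithmetic-geometric mean inequality. For even p, passing to absolute values leaves the
right side unchanged and can only increase the left side. -/
lemma mul_mul_pow_le {p : ℕ} (hp : 1 ≤ p) {A B : ℝ} (h : Even p ∨ (0 ≤ A ∧ 0 ≤ B)) :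
    (p : ℝ) * (A * B ^ (p - 1)) ≤ A ^ p + ((p : ℝ) - 1) * B ^ p := by
  have key : ∀ A B : ℝ, 0 ≤ A → 0 ≤ B →
      (p : ℝ) * (A * B ^ (p - 1)) ≤ A ^ p + ((p : ℝ) - 1) * B ^ p := by
    intro A B hA hB
    clear h
    induction p, hp using Nat.le_induction with
    | base => simp
    | succ p hp ih =>
      obtain ⟨q, rfl⟩ : ∃ q, p = q + 1 := ⟨p - 1, by omega⟩
      simp only [Nat.add_sub_cancel] at ih ⊢
      -- Multiplying by B and adding (A^p − B^p)(A − B) ≥ 0 passes from p to p + 1.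
      have h1 := mul_le_mul_of_nonneg_right ih hB
      have h2 : 0 ≤ (A ^ (q + 1) - B ^ (q + 1)) * (A - B) := by
        rcases le_total A B with hAB | hAB
        · exact mul_nonneg_of_nonpos_of_nonpos
            (sub_nonpos.mpr (pow_le_pow_left₀ hA hAB _)) (sub_nonpos.mpr hAB)
        · exact mul_nonneg (sub_nonneg.mpr (pow_le_pow_left₀ hB hAB _)) (sub_nonneg.mpr hAB)
      push_cast at h1 ⊢
      have e1 : A ^ (q + 1 + 1) = A ^ (q + 1) * A := pow_succ _ _
      have e2 : B ^ (q + 1 + 1) = B ^ (q + 1) * B := pow_succ _ _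
      have e3 : B ^ (q + 1) = B ^ q * B := pow_succ _ _
      rw [e1, e2]
      rw [e3] at h1 h2 ⊢
      nlinarith
  rcases h with h | h
  · calc (p : ℝ) * (A * B ^ (p - 1)) ≤ p * (|A| * |B| ^ (p - 1)) := by
          refine mul_le_mul_of_nonneg_left ((le_abs_self _).trans ?_) (by positivity)
          rw [abs_mul, abs_pow]
      _ ≤ |A| ^ p + ((p : ℝ) - 1) * |B| ^ p := key _ _ (abs_nonneg _) (abs_nonneg _)
      _ = _ := by rw [h.pow_abs, h.pow_abs]
  · exact key A B h.1 h.2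

variable {K W : Type*} [MeasurableSpace K] [MeasurableSpace W] {p : ℕ}

/-- The average of a product of functions, the `l`-th one depending on the parameter `w l`. -/
def prodAvg (ρ : Measure K) (U : Fin p → W → K → ℝ) (w : Fin p → W) : ℝ :=
  ∫ k, ∏ l, U l (w l) k ∂ρ

variable {ρ : Measure K} [IsProbabilityMeasure ρ] {η : Measure W} [IsProbabilityMeasure η]
  {U : Fin p → W → K → ℝ} {M : ℝ}

lemma ae_pi_bound (hM : ∀ l, ∀ᵐ w ∂η, ∀ k, |U l w k| ≤ M) :
    ∀ᵐ w ∂(Measure.pi fun _ : Fin p => η), ∀ l k, |U l (w l) k| ≤ M := by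
  rw [ae_all_iff]
  exact fun l => (Measure.quasiMeasurePreserving_eval (fun _ : Fin p => η) l).ae (hM l)

lemma measurable_prodAvg (hU : ∀ l, Measurable (Function.uncurry (U l))) :
    Measurable (prodAvg ρ U) := by
  have h : StronglyMeasurable fun z : (Fin p → W) × K => ∏ l, U l (z.1 l) z.2 := by
    refine Measurable.stronglyMeasurable (Finset.measurable_prod _ fun l _ => ?_)
    exact (hU l).comp (by fun_prop : Measurable fun z : (Fin p → W) × K => (z.1 l, z.2))
  exact h.integral_prod_right.measurable

lemma abs_prodAvg_le {w : Fin p → W} (h : ∀ l k, |U l (w l) k| ≤ M) :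
    |prodAvg ρ U w| ≤ M ^ p := by
  have := norm_integral_le_of_norm_le_const (μ := ρ) (f := fun k => ∏ l, U l (w l) k)
    (C := M ^ p) (ae_of_all _ fun k => by
      rw [Real.norm_eq_abs, Finset.abs_prod]
      calc _ ≤ ∏ _l : Fin p, M :=
            Finset.prod_le_prod (fun _ _ => abs_nonneg _) fun l _ => h l k
        _ = M ^ p := by simp)
  simpa [prodAvg] using this

lemma integrable_prodAvg_pow (hU : ∀ l, Measurable (Function.uncurry (U l)))
    (hM : ∀ l, ∀ᵐ w ∂η, ∀ k, |U l w k| ≤ M) (n : ℕ) :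
    Integrable (fun w => prodAvg ρ U w ^ n) (Measure.pi fun _ : Fin p => η) := by
  refine Integrable.of_bound ((measurable_prodAvg hU).pow_const n).aestronglyMeasurable
    ((M ^ p) ^ n) ?_
  filter_upwards [ae_pi_bound hM] with w hw
  rw [norm_pow, Real.norm_eq_abs]
  exact pow_le_pow_left₀ (abs_nonneg _) (abs_prodAvg_le hw) n

/-- The mean of a product over replicas. -/
def replicaMean (η : Measure W) (u : W → K → ℝ) {n : ℕ} (k : Fin n → K) : ℝ :=
  ∫ w, ∏ r, u w (k r) ∂η

lemma measurable_replicaMean {u : W → K → ℝ} (hu : Measurable (Function.uncurry u)) (n : ℕ) :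
    Measurable (replicaMean η u : (Fin n → K) → ℝ) := by
  have h : StronglyMeasurable fun z : (Fin n → K) × W => ∏ r, u z.2 (z.1 r) := by
    refine Measurable.stronglyMeasurable (Finset.measurable_prod _ fun r _ => ?_)
    exact hu.comp (by fun_prop : Measurable fun z : (Fin n → K) × W => (z.2, z.1 r))
  exact h.integral_prod_right.measurable

lemma abs_replicaMean_le {u : W → K → ℝ} (hM : ∀ᵐ w ∂η, ∀ k, |u w k| ≤ M) {n : ℕ}
    (k : Fin n → K) : |replicaMean η u k| ≤ M ^ n := by
  have := norm_integral_le_of_norm_le_const (μ := η) (f := fun w => ∏ r, u w (k r))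
    (C := M ^ n) (by
      filter_upwards [hM] with w hw
      rw [Real.norm_eq_abs, Finset.abs_prod]
      calc _ ≤ ∏ _l : Fin n, M :=
            Finset.prod_le_prod (fun _ _ => abs_nonneg _) fun r _ => hw _
        _ = M ^ n := by simp)
  simpa [replicaMean] using this

/-- The n-th power of an integral against ρ is an integral over n independent replicas. After
exchanging the integrals, the independence of the parameters `w l` factorizes the inner one over the
places. -/
lemma integral_prodAvg_pow (hU : ∀ l, Measurable (Function.uncurry (U l)))
    (hM : ∀ l, ∀ᵐ w ∂η, ∀ k, |U l w k| ≤ M) (n : ℕ) :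
    ∫ w, prodAvg ρ U w ^ n ∂(Measure.pi fun _ : Fin p => η) =
      ∫ k, ∏ l, replicaMean η (U l) k ∂(Measure.pi fun _ : Fin n => ρ) := by
  have h1 : ∀ w : Fin p → W, prodAvg ρ U w ^ n =
      ∫ k, ∏ r, ∏ l, U l (w l) (k r) ∂(Measure.pi fun _ : Fin n => ρ) := by
    intro w
    have := integral_fintype_prod_eq_pow (ι := Fin n) (μ := ρ) fun k => ∏ l, U l (w l) k
    rw [Fintype.card_fin] at this
    exact this.symm
  simp only [h1]
  rw [integral_integral_swap]
  · congr 1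
    ext k
    simp only [replicaMean]
    rw [← integral_fintype_prod_eq_prod (μ := fun _ : Fin p => η)
      (f := fun l w => ∏ r, U l w (k r))]
    congr 1
    ext w
    exact Finset.prod_comm
  · have hmeas : Measurable (Function.uncurry fun (w : Fin p → W) (k : Fin n → K) =>
        ∏ r, ∏ l, U l (w l) (k r)) := by
      refine Finset.measurable_prod _ fun r _ => Finset.measurable_prod _ fun l _ => ?_
      exact (hU l).comp
        (by fun_prop : Measurable fun z : (Fin p → W) × (Fin n → K) => (z.1 l, z.2 r))
    refine Integrable.of_bound hmeas.aestronglyMeasurable ((M ^ p) ^ n) ?_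
    filter_upwards [Measure.quasiMeasurePreserving_fst.ae (ae_pi_bound hM)] with z hz
    rw [Function.uncurry, Real.norm_eq_abs, Finset.abs_prod]
    calc _ ≤ ∏ _r : Fin n, M ^ p := by
          refine Finset.prod_le_prod (fun _ _ => abs_nonneg _) fun r _ => ?_
          rw [Finset.abs_prod]
          calc _ ≤ ∏ _l : Fin p, M :=
                Finset.prod_le_prod (fun _ _ => abs_nonneg _) fun l _ => hz l _
            _ = M ^ p := by simp
      _ = (M ^ p) ^ n := by simp

/-- The family of functions with `u` at the last place and `u'` elsewhere. -/
def mixed (u u' : W → K → ℝ) (l : Fin p) : W → K → ℝ := if (l : ℕ) < p - 1 then u' else u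

lemma prod_mixed {X : Type*} {p : ℕ} (hp : 1 ≤ p) (F : X → ℝ) (x x' : X) :
    ∏ l : Fin p, F (if (l : ℕ) < p - 1 then x' else x) = F x * F x' ^ (p - 1) := by
  obtain ⟨q, rfl⟩ : ∃ q, p = q + 1 := ⟨p - 1, by omega⟩
  rw [Fin.prod_univ_castSucc]
  simp [mul_comm]

/-- The combination of the three averages in the interpolation inequality. -/
def tripleComb (p : ℕ) (y₁ y₂ y₃ : ℝ) : ℝ := (1 / p) * y₁ - y₂ + ((p : ℝ) - 1) / p * y₃

lemma integral_tripleComb {α : Type*} [MeasurableSpace α] {μ : Measure α} (p : ℕ)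
    {y₁ y₂ y₃ : α → ℝ} (h₁ : Integrable y₁ μ) (h₂ : Integrable y₂ μ) (h₃ : Integrable y₃ μ) :
    ∫ a, tripleComb p (y₁ a) (y₂ a) (y₃ a) ∂μ =
      tripleComb p (∫ a, y₁ a ∂μ) (∫ a, y₂ a ∂μ) (∫ a, y₃ a ∂μ) := by
  have e1 := integral_sub (h₁.const_mul (1 / (p : ℝ))) h₂
  have e2 := integral_add ((h₁.const_mul (1 / (p : ℝ))).sub h₂)
    (h₃.const_mul (((p : ℝ) - 1) / p))
  unfold tripleComb
  rw [← integral_const_mul, ← integral_const_mul, ← e1]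
  exact e2

/-- With A and B the replica means of `u` and `u'`, the three moments are the replica integrals of
A^p, A B^(p−1) and B^p. The inequality then holds pointwise in the replicas, by `mul_mul_pow_le`. -/
lemma integral_tripleComb_nonneg (hp : 1 ≤ p) {u u' : W → K → ℝ}
    (hu : Measurable (Function.uncurry u)) (hu' : Measurable (Function.uncurry u')) (hM0 : 0 ≤ M)
    (hM : ∀ᵐ w ∂η, ∀ k, |u w k| ≤ M) (hM' : ∀ᵐ w ∂η, ∀ k, |u' w k| ≤ M)
    (hpos : Even p ∨ ∀ᵐ w ∂η, ∀ k, 0 ≤ u w k ∧ 0 ≤ u' w k) (n : ℕ) :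
    0 ≤ ∫ w, tripleComb p (prodAvg ρ (fun _ => u) w ^ n) (prodAvg ρ (mixed u u') w ^ n)
      (prodAvg ρ (fun _ => u') w ^ n) ∂(Measure.pi fun _ : Fin p => η) := by
  have hp0 : (0 : ℝ) < p := by exact_mod_cast hp
  have hmix : ∀ l : Fin p, Measurable (Function.uncurry (mixed u u' l)) := by
    intro l; unfold mixed; split_ifs <;> assumption
  have hmixM : ∀ l : Fin p, ∀ᵐ w ∂η, ∀ k, |mixed u u' l w k| ≤ M := by
    intro l; unfold mixed; split_ifs <;> assumption
  have i1 := integrable_prodAvg_pow (ρ := ρ) (p := p) (fun _ => hu) (fun _ => hM) n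
  have i2 := integrable_prodAvg_pow (ρ := ρ) (p := p) hmix hmixM n
  have i3 := integrable_prodAvg_pow (ρ := ρ) (p := p) (fun _ => hu') (fun _ => hM') n
  rw [integral_tripleComb p i1 i2 i3,
    integral_prodAvg_pow (fun _ => hu) (fun _ => hM),
    integral_prodAvg_pow hmix hmixM, integral_prodAvg_pow (fun _ => hu') (fun _ => hM')]
  have hbd : ∀ (F : (Fin n → K) → ℝ), Measurable F → (∀ k, |F k| ≤ (M ^ n) ^ p) →
      Integrable F (Measure.pi fun _ : Fin n => ρ) := fun F hF hFb =>
    Integrable.of_bound hF.aestronglyMeasurable _ (ae_of_all _ hFb)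
  have hA := measurable_replicaMean (η := η) hu n
  have hB := measurable_replicaMean (η := η) hu' n
  have hAb : ∀ k : Fin n → K, |replicaMean η u k| ≤ M ^ n := abs_replicaMean_le hM
  have hBb : ∀ k : Fin n → K, |replicaMean η u' k| ≤ M ^ n := abs_replicaMean_le hM'
  have hMn : 0 ≤ M ^ n := pow_nonneg hM0 n
  have e2 : ∀ k : Fin n → K, ∏ l : Fin p, replicaMean η (mixed u u' l) k =
      replicaMean η u k * replicaMean η u' k ^ (p - 1) :=
    fun k => prod_mixed hp (fun v => replicaMean η v k) u u'
  simp only [e2, Finset.prod_const, Finset.card_univ, Fintype.card_fin]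
  have j1 : Integrable (fun k => replicaMean η u k ^ p) (Measure.pi fun _ : Fin n => ρ) :=
    hbd _ (hA.pow_const p) fun k => by
      rw [abs_pow]; exact pow_le_pow_left₀ (abs_nonneg _) (hAb k) p
  have j3 : Integrable (fun k => replicaMean η u' k ^ p) (Measure.pi fun _ : Fin n => ρ) :=
    hbd _ (hB.pow_const p) fun k => by
      rw [abs_pow]; exact pow_le_pow_left₀ (abs_nonneg _) (hBb k) p
  have j2 : Integrable (fun k => replicaMean η u k * replicaMean η u' k ^ (p - 1))
      (Measure.pi fun _ : Fin n => ρ) :=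
    hbd _ (hA.mul (hB.pow_const _)) fun k => by
      rw [abs_mul, abs_pow]
      calc _ ≤ M ^ n * (M ^ n) ^ (p - 1) :=
            mul_le_mul (hAb k) (pow_le_pow_left₀ (abs_nonneg _) (hBb k) _) (by positivity) hMn
        _ = (M ^ n) ^ p := by rw [← pow_succ', Nat.sub_add_cancel hp]
  rw [← integral_tripleComb p j1 j2 j3]
  refine integral_nonneg fun k => ?_
  have hk : Even p ∨ (0 ≤ replicaMean η u k ∧ 0 ≤ replicaMean η u' k) := by
    refine hpos.imp id fun h => ⟨integral_nonneg_of_ae ?_, integral_nonneg_of_ae ?_⟩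
    · filter_upwards [h] with w hw
      exact Finset.prod_nonneg fun r _ => (hw _).1
    · filter_upwards [h] with w hw
      exact Finset.prod_nonneg fun r _ => (hw _).2
  have := mul_mul_pow_le hp hk
  have h2 : 0 ≤ (p : ℝ)⁻¹ * (replicaMean η u k ^ p + ((p : ℝ) - 1) * replicaMean η u' k ^ p -
      p * (replicaMean η u k * replicaMean η u' k ^ (p - 1))) :=
    mul_nonneg (by positivity) (by linarith)
  refine h2.trans (le_of_eq ?_)
  simp only [tripleComb]
  field_simp
  ring

end Replica

/-! ### The logarithmic inequality -/

section LogInequality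

lemma abs_tripleComb_le {p : ℕ} (hp : 1 ≤ p) {y₁ y₂ y₃ : ℝ} (h₁ : |y₁| ≤ 1) (h₂ : |y₂| ≤ 1)
    (h₃ : |y₃| ≤ 1) : |tripleComb p y₁ y₂ y₃| ≤ 2 := by
  have hp0 : (1 : ℝ) ≤ p := by exact_mod_cast hp
  have h : (0 : ℝ) ≤ ((p : ℝ) - 1) / p := div_nonneg (by linarith) (by linarith)
  have h' : (0 : ℝ) ≤ 1 / (p : ℝ) := by positivity
  have hsum : 1 / (p : ℝ) + ((p : ℝ) - 1) / p = 1 := by field_simp; ring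
  unfold tripleComb
  rw [abs_le] at *
  constructor <;> nlinarith

lemma tripleComb_self {p : ℕ} (hp : 1 ≤ p) (y : ℝ) : tripleComb p y y y = 0 := by
  have hp0 : (p : ℝ) ≠ 0 := by positivity
  unfold tripleComb
  field_simp
  ring

lemma tripleComb_add (p : ℕ) (y₁ y₂ y₃ z₁ z₂ z₃ : ℝ) :
    tripleComb p (y₁ + z₁) (y₂ + z₂) (y₃ + z₃) = tripleComb p y₁ y₂ y₃ + tripleComb p z₁ z₂ z₃ := by
  unfold tripleComb; ring

lemma tripleComb_mul_left (p : ℕ) (c y₁ y₂ y₃ : ℝ) :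
    tripleComb p (c * y₁) (c * y₂) (c * y₃) = c * tripleComb p y₁ y₂ y₃ := by
  unfold tripleComb; ring

lemma abs_tripleComb_le_of_sub {p : ℕ} (hp : 1 ≤ p) {y₁ y₂ y₃ c : ℝ} (h₁ : |y₁ - y₂| ≤ c)
    (h₃ : |y₃ - y₂| ≤ c) : |tripleComb p y₁ y₂ y₃| ≤ c := by
  have hp0 : (1 : ℝ) ≤ p := by exact_mod_cast hp
  have h : (0 : ℝ) ≤ ((p : ℝ) - 1) / p := div_nonneg (by linarith) (by linarith)
  have h' : (0 : ℝ) ≤ 1 / (p : ℝ) := by positivity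
  have hsum : 1 / (p : ℝ) + ((p : ℝ) - 1) / p = 1 := by field_simp; ring
  have e : tripleComb p y₁ y₂ y₃ = 1 / (p : ℝ) * (y₁ - y₂) + ((p : ℝ) - 1) / p * (y₃ - y₂) := by
    unfold tripleComb; linear_combination y₂ * hsum
  rw [e]
  rw [abs_le] at *
  constructor <;> nlinarith

variable {p : ℕ} {X : Type*} [MeasurableSpace X] {κ₀ : Measure (ℝ × ℝ)} [IsProbabilityMeasure κ₀]
  {Q : Measure X} [IsProbabilityMeasure Q] {Y₁ Y₂ Y₃ : X → ℝ}

lemma measurable_tripleComb {α : Type*} [MeasurableSpace α] {y₁ y₂ y₃ : α → ℝ}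
    (h₁ : Measurable y₁) (h₂ : Measurable y₂) (h₃ : Measurable y₃) :
    Measurable fun a => tripleComb p (y₁ a) (y₂ a) (y₃ a) := by
  unfold tripleComb; fun_prop

/-- The inequality when the coupling constant is damped by a factor smaller than one. -/
lemma integral_log_damped_nonpos (hp : 1 ≤ p) (m₁ : Measurable Y₁) (m₂ : Measurable Y₂)
    (m₃ : Measurable Y₃)
    (hn : ∀ n, 0 ≤ ∫ x, tripleComb p (Y₁ x ^ n) (Y₂ x ^ n) (Y₃ x ^ n) ∂Q)
    (hb : ∀ n : ℕ, 1 ≤ n → 0 ≤ ∫ c, (-c.2) ^ n ∂κ₀)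
    (hY : ∀ᵐ z ∂κ₀.prod Q, |z.1.2 * Y₁ z.2| ≤ 1 ∧ |z.1.2 * Y₂ z.2| ≤ 1 ∧ |z.1.2 * Y₃ z.2| ≤ 1)
    {t : ℝ} (ht0 : 0 ≤ t) (ht1 : t < 1) :
    ∫ z, tripleComb p (Real.log (1 + t * (z.1.2 * Y₁ z.2))) (Real.log (1 + t * (z.1.2 * Y₂ z.2)))
      (Real.log (1 + t * (z.1.2 * Y₃ z.2))) ∂κ₀.prod Q ≤ 0 := by
  -- The terms of the series of −log(1 + t b Y). As |bY| ≤ 1, they are dominated by a geometric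
  -- series in t < 1, which allows termwise integration.
  let F : ℕ → (ℝ × ℝ) × X → ℝ := fun n z =>
    (t ^ (n + 1) / (n + 1)) * ((-z.1.2) ^ (n + 1) *
      tripleComb p (Y₁ z.2 ^ (n + 1)) (Y₂ z.2 ^ (n + 1)) (Y₃ z.2 ^ (n + 1)))
  have hFm : ∀ n, Measurable (F n) := by
    intro n
    have := (measurable_tripleComb (p := p) (m₁.pow_const (n + 1)) (m₂.pow_const (n + 1))
      (m₃.pow_const (n + 1))).comp
      (measurable_snd : Measurable (Prod.snd : (ℝ × ℝ) × X → X))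
    exact (((measurable_fst.snd.neg).pow_const _).mul this).const_mul _
  have hFb : ∀ n, ∀ᵐ z ∂κ₀.prod Q, ‖F n z‖ ≤ 2 * t ^ (n + 1) := by
    intro n
    filter_upwards [hY] with z hz
    have hpow : ∀ y, |z.1.2 * y| ≤ 1 → |(-z.1.2) ^ (n + 1) * y ^ (n + 1)| ≤ 1 := by
      intro y hy
      rw [← mul_pow, abs_pow, neg_mul, abs_neg]
      exact pow_le_one₀ (abs_nonneg _) hy
    simp only [F]
    rw [norm_mul, ← tripleComb_mul_left, Real.norm_eq_abs, Real.norm_eq_abs,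
      abs_of_nonneg (by positivity)]
    have h1 : t ^ (n + 1) / ((n : ℝ) + 1) ≤ t ^ (n + 1) :=
      div_le_self (by positivity) (by linarith [(Nat.cast_nonneg n : (0 : ℝ) ≤ n)])
    have h2 := abs_tripleComb_le hp (hpow _ hz.1) (hpow _ hz.2.1) (hpow _ hz.2.2)
    calc _ ≤ t ^ (n + 1) * 2 := mul_le_mul h1 h2 (abs_nonneg _) (by positivity)
      _ = _ := mul_comm _ _
  have hFi : ∀ n, Integrable (F n) (κ₀.prod Q) := fun n =>
    Integrable.of_bound (hFm n).aestronglyMeasurable _ (hFb n)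
  have hgeo : Summable fun n : ℕ => 2 * t ^ (n + 1) :=
    ((summable_geometric_of_lt_one ht0 ht1).comp_injective
      (add_left_injective 1)).mul_left 2
  have hsum : Summable fun n => ∫ z, ‖F n z‖ ∂κ₀.prod Q := by
    refine Summable.of_nonneg_of_le (fun n => integral_nonneg fun _ => norm_nonneg _)
      (fun n => ?_) hgeo
    have := integral_mono_ae (hFi n).norm (integrable_const _) (hFb n)
    simpa using this
  have hmain := hasSum_integral_of_summable_integral_norm hFi hsum
  have hpt : ∀ᵐ z ∂κ₀.prod Q, ∑' n, F n z =
      -tripleComb p (Real.log (1 + t * (z.1.2 * Y₁ z.2))) (Real.log (1 + t * (z.1.2 * Y₂ z.2)))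
      (Real.log (1 + t * (z.1.2 * Y₃ z.2))) := by
    filter_upwards [hY] with z hz
    have hs : ∀ y, |z.1.2 * y| ≤ 1 →
        HasSum (fun n : ℕ => t ^ (n + 1) / (n + 1) * ((-z.1.2) ^ (n + 1) * y ^ (n + 1)))
          (-Real.log (1 + t * (z.1.2 * y))) := by
      intro y hy
      have hlt : |-(t * (z.1.2 * y))| < 1 := by
        rw [abs_neg, abs_mul, abs_of_nonneg ht0]
        nlinarith [abs_nonneg (z.1.2 * y)]
      have := Real.hasSum_pow_div_log_of_abs_lt_one hlt
      rw [sub_neg_eq_add] at this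
      convert this using 2 with n
      rw [← mul_pow, div_mul_eq_mul_div, ← mul_pow]
      ring
    have h := (((hs _ hz.1).mul_left (1 / (p : ℝ))).sub (hs _ hz.2.1)).add
      ((hs _ hz.2.2).mul_left (((p : ℝ) - 1) / p))
    convert h.tsum_eq using 1
    · refine tsum_congr fun n => ?_
      simp only [F, tripleComb]
      ring
    · simp only [tripleComb]
      ring
  rw [integral_congr_ae hpt, integral_neg] at hmain
  have hnn : ∀ n, 0 ≤ ∫ z, F n z ∂κ₀.prod Q := by
    intro n
    simp only [F]
    -- The coupling b is independent of the places, so each term is E(−b)^(n+1) times a nonnegative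
    -- moment.
    rw [integral_const_mul, integral_prod_mul (fun c : ℝ × ℝ => (-c.2) ^ (n + 1))
      (fun x => tripleComb p (Y₁ x ^ (n + 1)) (Y₂ x ^ (n + 1)) (Y₃ x ^ (n + 1)))]
    exact mul_nonneg (by positivity) (mul_nonneg (hb _ (by omega)) (hn _))
  have := hmain.nonneg hnn
  linarith

/-- The factor a is not under control, so only differences of logarithms are bounded: the ratio of 1
+ y to 1 + z is at most e^(2κ), and mixing both numbers with 1 preserves this. The bound is uniform
in t, as dominated convergence requires. -/
lemma abs_log_damped_sub_le {a y z κ t : ℝ} (ha : 0 < a)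
    (hy : a * (1 + y) ∈ Set.Icc (Real.exp (-κ)) (Real.exp κ))
    (hz : a * (1 + z) ∈ Set.Icc (Real.exp (-κ)) (Real.exp κ)) (ht0 : 0 ≤ t) (ht1 : t ≤ 1) :
    |Real.log (1 + t * y) - Real.log (1 + t * z)| ≤ 2 * κ := by
  have key : ∀ y z : ℝ, a * (1 + y) ∈ Set.Icc (Real.exp (-κ)) (Real.exp κ) →
      a * (1 + z) ∈ Set.Icc (Real.exp (-κ)) (Real.exp κ) →
      Real.log (1 + t * y) - Real.log (1 + t * z) ≤ 2 * κ := by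
    intro y z hy hz
    have pos : ∀ y, a * (1 + y) ∈ Set.Icc (Real.exp (-κ)) (Real.exp κ) → 0 < 1 + t * y := by
      intro y hy
      have : 0 < 1 + y := pos_of_mul_pos_right ((Real.exp_pos _).trans_le hy.1) ha.le
      rcases ht0.eq_or_lt with h | h
      · rw [← h]; norm_num
      · have := mul_pos h this
        linarith
    have hκ : 0 ≤ κ := by
      have := Real.exp_le_exp.mp (hy.1.trans hy.2); linarith
    have h1 : 1 + y ≤ Real.exp (2 * κ) * (1 + z) := by
      have e : Real.exp κ = Real.exp (2 * κ) * Real.exp (-κ) := by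
        rw [← Real.exp_add]; ring_nf
      have : a * (1 + y) ≤ a * (Real.exp (2 * κ) * (1 + z)) := by
        calc a * (1 + y) ≤ Real.exp (2 * κ) * Real.exp (-κ) := e ▸ hy.2
          _ ≤ Real.exp (2 * κ) * (a * (1 + z)) :=
            mul_le_mul_of_nonneg_left hz.1 (Real.exp_pos _).le
          _ = _ := by ring
      exact le_of_mul_le_mul_left this ha
    have h2 : 1 + t * y ≤ Real.exp (2 * κ) * (1 + t * z) := by
      have : 1 ≤ Real.exp (2 * κ) := Real.one_le_exp (by linarith)
      nlinarith
    have h3 := Real.log_le_log (pos y hy) h2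
    rw [Real.log_mul (Real.exp_pos _).ne' (pos z hz).ne', Real.log_exp] at h3
    linarith
  rw [abs_le]
  exact ⟨by linarith [key z y hz hy], key y z hy hz⟩

/-- The damping is removed by letting t tend to 1. The terms log a drop out because the coefficients
of `tripleComb` add up to 0, and for the same reason the integrand is controlled by differences of
logarithms. -/
lemma integral_log_nonpos (hp : 1 ≤ p) (m₁ : Measurable Y₁) (m₂ : Measurable Y₂)
    (m₃ : Measurable Y₃)
    (hn : ∀ n, 0 ≤ ∫ x, tripleComb p (Y₁ x ^ n) (Y₂ x ^ n) (Y₃ x ^ n) ∂Q)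
    (hb : ∀ n : ℕ, 1 ≤ n → 0 ≤ ∫ c, (-c.2) ^ n ∂κ₀)
    (hY : ∀ᵐ z ∂κ₀.prod Q, |z.1.2 * Y₁ z.2| ≤ 1 ∧ |z.1.2 * Y₂ z.2| ≤ 1 ∧ |z.1.2 * Y₃ z.2| ≤ 1)
    {κ : ℝ} (ha : ∀ᵐ z ∂κ₀.prod Q, 0 < z.1.1 ∧
      z.1.1 * (1 + z.1.2 * Y₁ z.2) ∈ Set.Icc (Real.exp (-κ)) (Real.exp κ) ∧
      z.1.1 * (1 + z.1.2 * Y₂ z.2) ∈ Set.Icc (Real.exp (-κ)) (Real.exp κ) ∧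
      z.1.1 * (1 + z.1.2 * Y₃ z.2) ∈ Set.Icc (Real.exp (-κ)) (Real.exp κ)) :
    ∫ z, tripleComb p (Real.log (z.1.1 * (1 + z.1.2 * Y₁ z.2)))
      (Real.log (z.1.1 * (1 + z.1.2 * Y₂ z.2))) (Real.log (z.1.1 * (1 + z.1.2 * Y₃ z.2)))
      ∂κ₀.prod Q ≤ 0 := by
  let t : ℕ → ℝ := fun n => 1 - 1 / ((n : ℝ) + 1)
  have ht0 : ∀ n, 0 ≤ t n := fun n => by
    have : 1 / ((n : ℝ) + 1) ≤ 1 := by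
      rw [div_le_one (by positivity)]; linarith [(Nat.cast_nonneg n : (0 : ℝ) ≤ n)]
    simp only [t]; linarith
  have ht1 : ∀ n, t n < 1 := fun n => by
    have : 0 < 1 / ((n : ℝ) + 1) := by positivity
    simp only [t]; linarith
  have htlim : Tendsto t atTop (𝓝 1) := by
    have := tendsto_one_div_add_atTop_nhds_zero_nat (𝕜 := ℝ)
    simpa [t] using this.const_sub 1
  let D : ℝ → (ℝ × ℝ) × X → ℝ := fun s z =>
    tripleComb p (Real.log (1 + s * (z.1.2 * Y₁ z.2))) (Real.log (1 + s * (z.1.2 * Y₂ z.2)))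
      (Real.log (1 + s * (z.1.2 * Y₃ z.2)))
  have hcongr : ∫ z, tripleComb p (Real.log (z.1.1 * (1 + z.1.2 * Y₁ z.2)))
      (Real.log (z.1.1 * (1 + z.1.2 * Y₂ z.2))) (Real.log (z.1.1 * (1 + z.1.2 * Y₃ z.2)))
      ∂κ₀.prod Q = ∫ z, D 1 z ∂κ₀.prod Q := by
    refine integral_congr_ae ?_
    filter_upwards [ha] with z hz
    have hl : ∀ y, z.1.1 * (1 + y) ∈ Set.Icc (Real.exp (-κ)) (Real.exp κ) →
        Real.log (z.1.1 * (1 + y)) = Real.log z.1.1 + Real.log (1 + y) := fun y hy =>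
      Real.log_mul hz.1.ne'
        (pos_of_mul_pos_right ((Real.exp_pos _).trans_le hy.1) hz.1.le).ne'
    rw [hl _ hz.2.1, hl _ hz.2.2.1, hl _ hz.2.2.2, tripleComb_add, tripleComb_self hp, zero_add]
    simp only [D, one_mul]
  rw [hcongr]
  have hlim : Tendsto (fun n => ∫ z, D (t n) z ∂κ₀.prod Q) atTop (𝓝 (∫ z, D 1 z ∂κ₀.prod Q)) := by
    refine tendsto_integral_of_dominated_convergence (fun _ => 2 * κ) (fun n => ?_)
      (integrable_const _) (fun n => ?_) ?_
    · have hm : ∀ {Y : X → ℝ}, Measurable Y →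
          Measurable fun z : (ℝ × ℝ) × X => Real.log (1 + t n * (z.1.2 * Y z.2)) := by
        intro Y hY; fun_prop
      exact (measurable_tripleComb (hm m₁) (hm m₂) (hm m₃)).aestronglyMeasurable
    · filter_upwards [ha] with z hz
      exact abs_tripleComb_le_of_sub hp
        (abs_log_damped_sub_le hz.1 hz.2.1 hz.2.2.1 (ht0 n) (ht1 n).le)
        (abs_log_damped_sub_le hz.1 hz.2.2.2 hz.2.2.1 (ht0 n) (ht1 n).le)
    · filter_upwards [ha] with z hz
      have hl : ∀ y, z.1.1 * (1 + y) ∈ Set.Icc (Real.exp (-κ)) (Real.exp κ) →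
          Tendsto (fun n => Real.log (1 + t n * y)) atTop (𝓝 (Real.log (1 + 1 * y))) := by
        intro y hy
        have hpos : 0 < 1 + 1 * y := by
          rw [one_mul]
          exact pos_of_mul_pos_right ((Real.exp_pos _).trans_le hy.1) hz.1.le
        exact ((htlim.mul_const y).const_add 1).log hpos.ne'
      exact (((hl _ hz.2.1).const_mul _).sub (hl _ hz.2.2.1)).add ((hl _ hz.2.2.2).const_mul _)
  exact le_of_tendsto' hlim fun n =>
    integral_log_damped_nonpos hp m₁ m₂ m₃ hn hb hY (ht0 n) (ht1 n)

end LogInequality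

/-! ### Local averages of product functions -/

section ProductFunctions

/-- The average of a function of one spin in the field `y`. -/
def locAvg (f : Spin → ℝ) (y : ℝ) : ℝ :=
  (∑ s, f s * Real.exp (y * ((s : ℤ) : ℝ))) / ∑ s : Spin, Real.exp (y * ((s : ℤ) : ℝ))

lemma sum_exp_pos (y : ℝ) : 0 < ∑ s : Spin, Real.exp (y * ((s : ℤ) : ℝ)) :=
  Finset.sum_pos (fun _ _ => Real.exp_pos _) Finset.univ_nonempty

lemma measurable_locAvg : Measurable fun z : (Spin → ℝ) × ℝ => locAvg z.1 z.2 := by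
  unfold locAvg
  fun_prop

lemma locAvg_mem {f : Spin → ℝ} {lo hi : ℝ} (hf : ∀ s, f s ∈ Set.Icc lo hi) (y : ℝ) :
    locAvg f y ∈ Set.Icc lo hi :=
  weighted_mean_mem (fun _ => Real.exp_pos _) hf

lemma sum_prod_mul_exp (q : ℕ) (f : Fin q → Spin → ℝ) (y : Fin q → ℝ) :
    ∑ ε : Fin q → Spin, (∏ l, f l (ε l)) * Real.exp (∑ l, y l * ((ε l : ℤ) : ℝ)) =
      ∏ l, ∑ s, f l s * Real.exp (y l * ((s : ℤ) : ℝ)) := by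
  rw [Finset.prod_univ_sum, Fintype.piFinset_univ]
  refine Finset.sum_congr rfl fun ε _ => ?_
  rw [Real.exp_sum, Finset.prod_mul_distrib]

lemma sum_exp_sum (q : ℕ) (y : Fin q → ℝ) :
    ∑ ε : Fin q → Spin, Real.exp (∑ l, y l * ((ε l : ℤ) : ℝ)) =
      ∏ l, ∑ s : Spin, Real.exp (y l * ((s : ℤ) : ℝ)) := by
  simpa using sum_prod_mul_exp q (fun _ _ => 1) y

/-- The spins are independent under the weights e^(y_l ε_l), so the mean of a product is the product
of the means. -/
lemma mean_affine_prod (q : ℕ) (f : Fin q → Spin → ℝ) (y : Fin q → ℝ) (a b : ℝ) :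
    (∑ ε : Fin q → Spin, a * (1 + b * ∏ l, f l (ε l)) *
        Real.exp (∑ l, y l * ((ε l : ℤ) : ℝ))) /
      ∑ ε : Fin q → Spin, Real.exp (∑ l, y l * ((ε l : ℤ) : ℝ)) =
      a * (1 + b * ∏ l, locAvg (f l) (y l)) := by
  have h0 : (∏ l, ∑ s : Spin, Real.exp (y l * ((s : ℤ) : ℝ))) ≠ 0 :=
    (Finset.prod_pos fun l _ => sum_exp_pos _).ne'
  have h1 : ∑ ε : Fin q → Spin, a * (1 + b * ∏ l, f l (ε l)) *
      Real.exp (∑ l, y l * ((ε l : ℤ) : ℝ)) =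
      a * (∏ l, ∑ s : Spin, Real.exp (y l * ((s : ℤ) : ℝ))) +
        a * b * ∏ l, ∑ s, f l s * Real.exp (y l * ((s : ℤ) : ℝ)) := by
    rw [← sum_prod_mul_exp, ← sum_exp_sum, Finset.mul_sum, Finset.mul_sum,
      ← Finset.sum_add_distrib]
    exact Finset.sum_congr rfl fun ε _ => by ring
  simp only [locAvg]
  rw [h1, sum_exp_sum, Finset.prod_div_distrib]
  field_simp

variable {p : ℕ}

lemma bracket_affine_prod (f : Fin p → Spin → ℝ) (x : ℕ → ℝ) (a b : ℝ) :
    bracket (fun ε => a * (1 + b * ∏ l, f l (ε l))) x =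
      a * (1 + b * ∏ l, locAvg (f l) (x l)) :=
  mean_affine_prod p f (fun l => x l) a b

lemma bracketMinus_affine_prod (hp : 1 ≤ p) (f : Fin p → Spin → ℝ) (x : ℕ → ℝ) (s : Spin)
    (a b : ℝ) :
    bracketMinus (fun ε : Fin p → Spin => a * (1 + b * ∏ l, f l (ε l))) x s =
      a * (1 + b * ∏ l : Fin p, if (l : ℕ) < p - 1 then locAvg (f l) (x l) else f l s) := by
  obtain ⟨q, rfl⟩ : ∃ q, p = q + 1 := ⟨p - 1, by omega⟩
  -- The factor of the frozen last spin is absorbed into the coupling b.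
  have := mean_affine_prod q (fun l => f l.castSucc) (fun l => x l) a (b * f (Fin.last q) s)
  simp only [Fin.prod_univ_castSucc (n := q), Nat.add_sub_cancel, Fin.val_castSucc, Fin.is_lt,
    Fin.val_last, lt_irrefl, if_true, if_false]
  have e : ∀ c : ℝ, b * (c * f (Fin.last q) s) = b * f (Fin.last q) s * c := fun c => by ring
  rw [e, ← this]
  unfold bracketMinus
  simp only [Nat.add_sub_cancel, Fin.val_castSucc, Fin.is_lt, Fin.val_last, lt_irrefl, dite_true,
    dite_false, e]
  rfl

end ProductFunctions

/-! ### Measure preserving rearrangements -/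

section Rearrange

/-- The uniform probability measure on a finite type. -/
def unifMeasure (F : Type*) [Fintype F] [MeasurableSpace F] : Measure F :=
  (Fintype.card F : ENNReal)⁻¹ • Measure.count

variable {F : Type*} [Fintype F] [MeasurableSpace F] [DiscreteMeasurableSpace F] [Nonempty F]

instance : IsProbabilityMeasure (unifMeasure F) := by
  constructor
  have h : (Fintype.card F : ENNReal) ≠ 0 := by exact_mod_cast Fintype.card_ne_zero
  simp only [unifMeasure, Measure.smul_apply, smul_eq_mul]
  rw [Measure.count_univ, ENat.card_eq_coe_fintype_card]
  exact ENNReal.inv_mul_cancel h (ENNReal.natCast_ne_top _)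

lemma integral_unifMeasure (f : F → ℝ) : ∫ i, f i ∂unifMeasure F = unifAvg f := by
  rw [unifMeasure, integral_smul_measure, integral_count, unifAvg, ENNReal.toReal_inv,
    ENNReal.toReal_natCast, smul_eq_mul]

lemma integral_pi_unifMeasure {p : ℕ} (f : (Fin p → F) → ℝ) :
    ∫ i, f i ∂(Measure.pi fun _ : Fin p => unifMeasure F) = unifAvg f := by
  rw [integral_fintype .of_finite, unifAvg, Finset.mul_sum]
  refine Finset.sum_congr rfl fun i _ => ?_
  have h1 : ∀ a : F, unifMeasure F {a} = (Fintype.card F : ENNReal)⁻¹ := fun a => by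
    simp [unifMeasure]
  rw [Measure.real, Measure.pi_singleton]
  simp only [h1, Finset.prod_const, Finset.card_univ, Fintype.card_fin, smul_eq_mul,
    ENNReal.toReal_pow, ENNReal.toReal_inv, ENNReal.toReal_natCast, Fintype.card_fun,
    Nat.cast_pow, inv_pow]

lemma measurePreserving_zip {A B : Type*} [MeasurableSpace A] [MeasurableSpace B] (p : ℕ)
    (μ : Measure A) (ν : Measure B) [SigmaFinite μ] [SigmaFinite ν] :
    MeasurePreserving (fun (z : (Fin p → A) × (Fin p → B)) l => (z.1 l, z.2 l))
      ((Measure.pi fun _ : Fin p => μ).prod (Measure.pi fun _ : Fin p => ν))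
      (Measure.pi fun _ : Fin p => μ.prod ν) :=
  MeasurePreserving.symm _
    (measurePreserving_arrowProdEquivProdArrow A B (Fin p) (fun _ => μ) fun _ => ν)

lemma measurePreserving_initial {A : Type*} [MeasurableSpace A] (p : ℕ) (μ : Measure A)
    [IsProbabilityMeasure μ] :
    MeasurePreserving (fun (x : ℕ → A) (l : Fin p) => x l) (Measure.infinitePi fun _ : ℕ => μ)
      (Measure.pi fun _ : Fin p => μ) := by
  have hm : Measurable (fun (x : ℕ → A) (l : Fin p) => x l) := by fun_prop
  refine ⟨hm, (Measure.pi_eq fun s hs => ?_).symm⟩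
  rw [Measure.map_apply hm (MeasurableSet.univ_pi hs)]
  have hpre : (fun (x : ℕ → A) (l : Fin p) => x l) ⁻¹' Set.pi Set.univ s =
      Set.pi ((Finset.range p : Finset ℕ) : Set ℕ)
        (fun n => if h : n < p then s ⟨n, h⟩ else Set.univ) := by
    ext x
    simp only [Set.mem_preimage, Set.mem_pi, Set.mem_univ, true_imp_iff, Finset.coe_range,
      Set.mem_Iio]
    constructor
    · intro h n hn
      simpa [hn] using h ⟨n, hn⟩
    · intro h l
      simpa using h l l.2
  rw [hpre, Measure.infinitePi_pi, Finset.prod_range]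
  · simp
  · intro n _
    split_ifs
    · exact hs _
    · exact MeasurableSet.univ

variable {A B C : Type*} [MeasurableSpace A] [MeasurableSpace B] [MeasurableSpace C]
  {μ : Measure A} {ν : Measure B} {τ : Measure C} [SFinite μ] [SFinite ν] [SFinite τ]

lemma measurePreserving_leftComm :
    MeasurePreserving (fun z : A × B × C => (z.2.1, z.1, z.2.2)) (μ.prod (ν.prod τ))
      (ν.prod (μ.prod τ)) :=
  (measurePreserving_prodAssoc ν μ τ).comp
    (((Measure.measurePreserving_swap (μ := μ) (ν := ν)).prod (MeasurePreserving.id τ)).comp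
      (MeasurePreserving.symm MeasurableEquiv.prodAssoc (measurePreserving_prodAssoc μ ν τ)))

lemma integral_comp_measurePreserving {α β : Type*} [MeasurableSpace α] [MeasurableSpace β]
    {μ : Measure α} {ν : Measure β} {T : α → β} (hT : MeasurePreserving T μ ν) {f : β → ℝ}
    (hf : AEStronglyMeasurable f ν) : ∫ a, f (T a) ∂μ = ∫ b, f b ∂ν := by
  rw [← hT.map_eq] at hf ⊢
  exact (integral_map hT.measurable.aemeasurable hf).symm

lemma measurable_apply_countable {α F : Type*} [MeasurableSpace α] [MeasurableSpace F]
    [Countable F] [MeasurableSingletonClass F] {h : α → F} (hh : Measurable h) {f : F → α → ℝ}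
    (hf : ∀ i, Measurable (f i)) : Measurable fun a => f (h a) a := by
  have : Measurable fun z : F × α => f z.1 z.2 := measurable_from_prod_countable_right hf
  exact this.comp (hh.prodMk measurable_id)

end Rearrange

/-! ### Functions of the form exp θ = a(1 + b f_1 ⋯ f_p) -/

section Coupling

variable {p : ℕ}

/-- The function `θ` with `exp θ = a (1 + b f_1 ⋯ f_p)`. -/
def couplingFun (w : (ℝ × ℝ) × (Fin p → Spin → ℝ)) : EdgeFun p :=
  fun σ => Real.log (w.1.1 * (1 + w.1.2 * ∏ l, w.2 l (σ l)))

/-- The almost sure properties of the parameters of a factorized function. -/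
structure IsNice (κ : ℝ) (w : (ℝ × ℝ) × (Fin p → Spin → ℝ)) : Prop where
  pos : ∀ σ : Fin p → Spin, 0 < w.1.1 * (1 + w.1.2 * ∏ l, w.2 l (σ l))
  lt_one : ∀ σ : Fin p → Spin, |w.1.2 * ∏ l, w.2 l (σ l)| < 1
  bound : ∀ σ : Fin p → Spin, |couplingFun w σ| ≤ κ

lemma measurable_couplingFun : Measurable (couplingFun (p := p)) := by
  unfold couplingFun
  fun_prop

variable {κ : ℝ} {w : (ℝ × ℝ) × (Fin p → Spin → ℝ)}

lemma IsNice.expFun_eq (h : IsNice κ w) :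
    expFun (couplingFun w) = fun ε => w.1.1 * (1 + w.1.2 * ∏ l, w.2 l (ε l)) :=
  funext fun ε => Real.exp_log (h.pos ε)

lemma IsNice.pos_left (h : IsNice κ w) : 0 < w.1.1 := by
  have h1 := h.pos (fun _ => 1)
  have h2 := abs_lt.mp (h.lt_one (fun _ => 1))
  exact pos_of_mul_pos_left h1 (by linarith)

/-- The redundant factor 1 plays the role of a in `bracket_affine_prod`; this is how |b ∏ f| < 1
yields a bound for the locally averaged products. -/
lemma IsNice.one_add_mem (h : IsNice κ w) (ε : Fin p → Spin) :
    1 * (1 + w.1.2 * ∏ l, w.2 l (ε l)) ∈ Set.Icc (0 : ℝ) 2 := by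
  have := abs_lt.mp (h.lt_one ε)
  constructor <;> linarith

/-- Fix b ≠ 0 for which the products are almost surely bounded. If a factor exceeded M = max(1,
1/|b|) with positive probability, then by independence all p factors would do so together, giving
|b| M^p ≥ 1. The boundedness of the factors is what justifies Fubini's theorem in the replica
argument. -/
lemma exists_bound_of_ae_lt_one {κ₀ : Measure (ℝ × ℝ)} [IsProbabilityMeasure κ₀]
    {φ : Measure (Spin → ℝ)} [IsProbabilityMeasure φ] (hp : 1 ≤ p)
    (h : ∀ᵐ w ∂κ₀.prod (Measure.pi fun _ : Fin p => φ), ∀ σ : Fin p → Spin,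
      |w.1.2 * ∏ l, w.2 l (σ l)| < 1) :
    (∀ᵐ c ∂κ₀, c.2 = 0) ∨ ∃ M : ℝ, 0 ≤ M ∧ ∀ᵐ g ∂φ, ∀ s, |g s| ≤ M := by
  by_cases h0 : ∀ᵐ c ∂κ₀, c.2 = 0
  · exact Or.inl h0
  right
  have h1 := Measure.ae_ae_of_ae_prod h
  obtain ⟨c, hc0, hc⟩ := ((not_eventually.mp h0).and_eventually h1).exists
  have hcpos : 0 < |c.2| := abs_pos.mpr hc0
  set M : ℝ := max 1 (1 / |c.2|) with hM
  have hM1 : 1 ≤ M := le_max_left _ _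
  have hcM : 1 ≤ |c.2| * M := by
    have : 1 / |c.2| ≤ M := le_max_right _ _
    rw [div_le_iff₀ hcpos] at this
    linarith
  refine ⟨M, by linarith, ?_⟩
  set B : Set (Spin → ℝ) := {g | ∃ s, M < |g s|} with hB
  have hbox : (Measure.pi fun _ : Fin p => φ) (Set.pi Set.univ fun _ => B) = 0 := by
    refine measure_mono_null (fun f hf => ?_) hc
    have hf' : ∀ l, ∃ s, M < |f l s| := fun l => hf l trivial
    choose σ hσ using hf'
    intro hcon
    have := hcon σ
    rw [abs_mul, Finset.abs_prod] at this
    have h2 : M ^ p ≤ ∏ l, |f l (σ l)| := by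
      calc M ^ p = ∏ _l : Fin p, M := by simp
        _ ≤ _ := Finset.prod_le_prod (fun _ _ => by linarith) fun l _ => (hσ l).le
    have h3 : M ≤ M ^ p := le_self_pow₀ hM1 (by omega)
    have h4 := mul_le_mul_of_nonneg_left (h3.trans h2) hcpos.le
    linarith
  rw [Measure.pi_pi, Finset.prod_const, Finset.card_univ, Fintype.card_fin,
    pow_eq_zero_iff (by omega)] at hbox
  have hB' : ∀ᵐ g ∂φ, g ∉ B := measure_eq_zero_iff_ae_notMem.mp hbox
  filter_upwards [hB'] with g hg s
  by_contra hcon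
  exact hg ⟨s, not_le.mp hcon⟩

end Coupling

/-! ### Edge, site and cavity averages for a fixed Gibbs measure -/

section FixedGraph

variable {p : ℕ} {Γ K F : Type*} [Countable Γ] [MeasurableSpace K] [DiscreteMeasurableSpace K]
  [Countable K] [Fintype F] [MeasurableSpace F] [DiscreteMeasurableSpace F] [Nonempty F]
  (s : K → F → Spin) (g : K → Γ) (ρ : Measure K) [IsProbabilityMeasure ρ]

/-- The average of the exponential of an edge function placed at given points. -/
def edgeMean (θ : EdgeFun p) (i : Fin p → F) : ℝ := ∫ k, expFun θ (fun j => s k (i j)) ∂ρ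

/-- The average of the exponential of a site function placed at a given point. -/
def siteMean (θ : EdgeFun p) (i : F) (x : ℕ → Γ → ℝ) : ℝ :=
  ∫ k, bracketMinus (expFun θ) (fun l => x l (g k)) (s k i) ∂ρ

/-- The average of the exponential of an edge function in the fields of the sites. -/
def cavityMean (θ : EdgeFun p) (x : ℕ → Γ → ℝ) : ℝ :=
  ∫ k, bracket (expFun θ) (fun l => x l (g k)) ∂ρ

lemma integral_mem_of_mem {f : K → ℝ} {lo hi : ℝ} (hf : ∀ k, f k ∈ Set.Icc lo hi) :
    ∫ k, f k ∂ρ ∈ Set.Icc lo hi := by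
  have hint : Integrable f ρ := Integrable.of_bound (measurable_of_countable _).aestronglyMeasurable
    (max |lo| |hi|) (ae_of_all _ fun k => abs_le_max_abs_abs (hf k).1 (hf k).2)
  constructor
  · simpa using integral_mono (integrable_const lo) hint fun k => (hf k).1
  · simpa using integral_mono hint (integrable_const hi) fun k => (hf k).2

variable {κ : ℝ}

lemma edgeMean_mem {θ : EdgeFun p} (h : ∀ ε, |θ ε| ≤ κ) (i : Fin p → F) :
    edgeMean s ρ θ i ∈ Set.Icc (Real.exp (-κ)) (Real.exp κ) :=
  integral_mem_of_mem ρ fun _ => expFun_mem h _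

lemma siteMean_mem {θ : EdgeFun p} (h : ∀ ε, |θ ε| ≤ κ) (i : F) (x : ℕ → Γ → ℝ) :
    siteMean s g ρ θ i x ∈ Set.Icc (Real.exp (-κ)) (Real.exp κ) :=
  integral_mem_of_mem ρ fun _ => bracketMinus_mem (expFun_mem h) _ _

lemma cavityMean_mem {θ : EdgeFun p} (h : ∀ ε, |θ ε| ≤ κ) (x : ℕ → Γ → ℝ) :
    cavityMean g ρ θ x ∈ Set.Icc (Real.exp (-κ)) (Real.exp κ) :=
  integral_mem_of_mem ρ fun _ => bracket_mem (expFun_mem h) _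

lemma measurable_integral_countable {α : Type*} [MeasurableSpace α] {f : K → α → ℝ}
    (hf : ∀ k, Measurable (f k)) : Measurable fun a => ∫ k, f k a ∂ρ := by
  have h : StronglyMeasurable fun z : α × K => f z.2 z.1 :=
    (measurable_from_prod_countable_left hf).stronglyMeasurable
  exact h.integral_prod_right.measurable

lemma measurable_edgeMean :
    Measurable fun z : EdgeFun p × (Fin p → F) => edgeMean s ρ z.1 z.2 := by
  refine measurable_integral_countable ρ fun k => ?_
  have h := measurable_apply_countable (α := EdgeFun p × (Fin p → F))
    (h := fun z => z.2) measurable_snd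
    (f := fun i z => expFun z.1 (fun j => s k (i j))) fun i => by
      unfold expFun; fun_prop
  exact h

lemma measurable_siteMean :
    Measurable fun z : F × EdgeFun p × (ℕ → Γ → ℝ) => siteMean s g ρ z.2.1 z.1 z.2.2 := by
  refine measurable_integral_countable ρ fun k => ?_
  have h := measurable_apply_countable (α := F × EdgeFun p × (ℕ → Γ → ℝ))
    (h := fun z => z.1) measurable_fst
    (f := fun i z => bracketMinus (expFun z.2.1) (fun l => z.2.2 l (g k)) (s k i))
    fun i => measurable_bracketMinus_expFun (by fun_prop) (by fun_prop) _
  exact h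

lemma measurable_cavityMean :
    Measurable fun z : EdgeFun p × (ℕ → Γ → ℝ) => cavityMean g ρ z.1 z.2 := by
  refine measurable_integral_countable ρ fun k => ?_
  exact measurable_bracket_expFun (by fun_prop) (by fun_prop)

/-- The parameters attached to one of the `p` places. -/
abbrev PlaceParam (Γ F : Type*) : Type _ := (Spin → ℝ) × F × (Γ → ℝ)

/-- The function of one place when its spin is a spin of the graph. -/
def graphPlace (w : PlaceParam Γ F) (k : K) : ℝ := w.1 (s k w.2.1)

/-- The function of one place when its spin is averaged in a field. -/
def fieldPlace (w : PlaceParam Γ F) (k : K) : ℝ := locAvg w.1 (w.2.2 (g k))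

lemma measurable_graphPlace :
    Measurable (Function.uncurry (graphPlace s : PlaceParam Γ F → K → ℝ)) := by
  refine measurable_from_prod_countable_left fun k => ?_
  have h := measurable_apply_countable (α := PlaceParam Γ F) (h := fun w => w.2.1)
    (by fun_prop) (f := fun i w => w.1 (s k i)) fun i => by fun_prop
  exact h

lemma measurable_fieldPlace :
    Measurable (Function.uncurry (fieldPlace g : PlaceParam Γ F → K → ℝ)) := by
  refine measurable_from_prod_countable_left fun k => ?_
  exact measurable_locAvg.comp (by fun_prop : Measurable fun w : PlaceParam Γ F =>
    (w.1, w.2.2 (g k)))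

/-- Only the product b f is bounded by hypothesis, so integrability is taken from it and not from f.
-/
lemma integral_affine {a b : ℝ} {f : K → ℝ} (hf : ∀ k, |b * f k| ≤ 1) :
    ∫ k, a * (1 + b * f k) ∂ρ = a * (1 + b * ∫ k, f k ∂ρ) := by
  have hint : Integrable (fun k => b * f k) ρ :=
    Integrable.of_bound (measurable_of_countable _).aestronglyMeasurable 1 (ae_of_all _ hf)
  rw [integral_const_mul, integral_add (integrable_const _) hint, integral_const_mul]
  simp

/-- The places of an edge, with their parameters. -/
def places (f : Fin p → Spin → ℝ) (i : Fin p → F) (x : ℕ → Γ → ℝ) (l : Fin p) :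
    PlaceParam Γ F := (f l, i l, x l)

variable {w : (ℝ × ℝ) × (Fin p → Spin → ℝ)}

lemma IsNice.edge_identity (hw : IsNice κ w) (i : Fin p → F) (x : ℕ → Γ → ℝ) :
    edgeMean s ρ (couplingFun w) i =
        w.1.1 * (1 + w.1.2 * prodAvg ρ (fun _ => graphPlace s) (places w.2 i x)) ∧
      |w.1.2 * prodAvg ρ (fun _ => graphPlace s) (places w.2 i x)| ≤ 1 := by
  have hb : ∀ k, |w.1.2 * ∏ l, graphPlace s (places w.2 i x l) k| ≤ 1 :=
    fun k => (hw.lt_one fun l => s k (i l)).le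
  constructor
  · unfold edgeMean prodAvg
    rw [← integral_affine ρ hb]
    simp only [hw.expFun_eq]
    rfl
  · unfold prodAvg
    rw [← integral_const_mul, abs_le]
    exact integral_mem_of_mem ρ fun k => abs_le.mp (hb k)

/-- Averaging spins in fields turns each factor into `locAvg`. The product of local averages is
itself an average of products, so it inherits the bound 1 needed for the series of the logarithm. -/
lemma IsNice.cavity_identity (hw : IsNice κ w) (i : Fin p → F) (x : ℕ → Γ → ℝ) :
    cavityMean g ρ (couplingFun w) x =
        w.1.1 * (1 + w.1.2 * prodAvg ρ (fun _ => fieldPlace g) (places w.2 i x)) ∧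
      |w.1.2 * prodAvg ρ (fun _ => fieldPlace g) (places w.2 i x)| ≤ 1 := by
  have hb : ∀ k, |w.1.2 * ∏ l, fieldPlace g (places w.2 i x l) k| ≤ 1 := by
    intro k
    have := bracket_mem hw.one_add_mem (fun l => x l (g k))
    rw [bracket_affine_prod w.2 (fun l => x l (g k)) 1 w.1.2] at this
    rw [abs_le]
    exact ⟨by linarith [this.1, show 1 * (1 + w.1.2 * ∏ l, locAvg (w.2 l) (x l (g k))) =
        1 + w.1.2 * ∏ l, fieldPlace g (places w.2 i x l) k from one_mul _],
      by linarith [this.2, show 1 * (1 + w.1.2 * ∏ l, locAvg (w.2 l) (x l (g k))) =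
        1 + w.1.2 * ∏ l, fieldPlace g (places w.2 i x l) k from one_mul _]⟩
  constructor
  · unfold cavityMean prodAvg
    rw [← integral_affine ρ hb]
    simp only [hw.expFun_eq, bracket_affine_prod]
    rfl
  · unfold prodAvg
    rw [← integral_const_mul, abs_le]
    exact integral_mem_of_mem ρ fun k => abs_le.mp (hb k)

/-- The last place keeps the spin of the graph and the other p − 1 are averaged in fields, as in
`mixed`. -/
lemma IsNice.site_identity (hp : 1 ≤ p) (hw : IsNice κ w) (i : Fin p → F) (x : ℕ → Γ → ℝ) :
    siteMean s g ρ (couplingFun w) (i ⟨p - 1, by omega⟩) x =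
        w.1.1 * (1 + w.1.2 * prodAvg ρ (mixed (graphPlace s) (fieldPlace g))
          (places w.2 i x)) ∧
      |w.1.2 * prodAvg ρ (mixed (graphPlace s) (fieldPlace g)) (places w.2 i x)| ≤ 1 := by
  have he : ∀ k, ∏ l : Fin p, mixed (graphPlace s) (fieldPlace g) l (places w.2 i x l) k =
      ∏ l : Fin p, if (l : ℕ) < p - 1 then locAvg (w.2 l) (x l (g k))
        else w.2 l (s k (i ⟨p - 1, by omega⟩)) := by
    intro k
    refine Finset.prod_congr rfl fun l _ => ?_
    unfold mixed
    split_ifs with hl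
    · rfl
    · have : l = ⟨p - 1, by omega⟩ := Fin.ext (by have := l.2; simp only; omega)
      rw [← this]
      rfl
  have hb : ∀ k, |w.1.2 * ∏ l, mixed (graphPlace s) (fieldPlace g) l (places w.2 i x l) k| ≤ 1 := by
    intro k
    have := bracketMinus_mem hw.one_add_mem (fun l => x l (g k)) (s k (i ⟨p - 1, by omega⟩))
    rw [bracketMinus_affine_prod hp w.2 (fun l => x l (g k)) _ 1 w.1.2, ← he k, one_mul] at this
    rw [abs_le]
    exact ⟨by linarith [this.1], by linarith [this.2]⟩
  constructor
  · unfold siteMean prodAvg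
    rw [← integral_affine ρ hb]
    simp only [hw.expFun_eq, bracketMinus_affine_prod hp, he]
  · unfold prodAvg
    rw [← integral_const_mul, abs_le]
    exact integral_mem_of_mem ρ fun k => abs_le.mp (hb k)

end FixedGraph

/-! ### The interpolation inequality for a fixed Gibbs measure -/

section FixedGraphInequality

variable {p : ℕ} {Γ K F : Type*} [Countable Γ] [MeasurableSpace K] [DiscreteMeasurableSpace K]
  [Countable K] [Fintype F] [MeasurableSpace F] [DiscreteMeasurableSpace F] [Nonempty F]
  (s : K → F → Spin) (g : K → Γ) (ρ : Measure K) [IsProbabilityMeasure ρ] {κ : ℝ}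

lemma measurable_places : Measurable
    fun z : (Fin p → Spin → ℝ) × (Fin p → F) × (ℕ → Γ → ℝ) => places z.1 z.2.1 z.2.2 := by
  unfold places
  fun_prop

/-- Grouping factor, vertex and field of each place yields p i.i.d. parameters. This needs the
vertices to be drawn with replacement. -/
lemma measurePreserving_places (φ : Measure (Spin → ℝ)) [IsProbabilityMeasure φ]
    (u : Measure F) [IsProbabilityMeasure u] (X : Measure (Γ → ℝ)) [IsProbabilityMeasure X] :
    MeasurePreserving
      (fun z : (Fin p → Spin → ℝ) × (Fin p → F) × (ℕ → Γ → ℝ) => places z.1 z.2.1 z.2.2)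
      ((Measure.pi fun _ : Fin p => φ).prod
        ((Measure.pi fun _ : Fin p => u).prod (Measure.infinitePi fun _ : ℕ => X)))
      (Measure.pi fun _ : Fin p => φ.prod (u.prod X)) := by
  have h1 := (MeasurePreserving.id (Measure.pi fun _ : Fin p => u)).prod
    (measurePreserving_initial p X)
  have h2 := (measurePreserving_zip p u X).comp h1
  have h3 := (MeasurePreserving.id (Measure.pi fun _ : Fin p => φ)).prod h2
  exact (measurePreserving_zip p φ (u.prod X)).comp h3

/-- The three terms of the interpolation inequality for given disorder. -/
def stepIntegrand (hp : 1 ≤ p) (z : EdgeFun p × (Fin p → F) × (ℕ → Γ → ℝ)) : ℝ :=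
  tripleComb p (Real.log (edgeMean s ρ z.1 z.2.1))
    (Real.log (siteMean s g ρ z.1 (z.2.1 ⟨p - 1, by omega⟩) z.2.2))
    (Real.log (cavityMean g ρ z.1 z.2.2))

lemma measurable_edge_term : Measurable
    fun z : EdgeFun p × (Fin p → F) × (ℕ → Γ → ℝ) => Real.log (edgeMean s ρ z.1 z.2.1) := by
  have h := (measurable_edgeMean (p := p) s ρ).comp
    (by fun_prop : Measurable fun z : EdgeFun p × (Fin p → F) × (ℕ → Γ → ℝ) => (z.1, z.2.1))
  exact Real.measurable_log.comp h

lemma measurable_site_term (l : Fin p) : Measurable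
    fun z : EdgeFun p × (Fin p → F) × (ℕ → Γ → ℝ) =>
      Real.log (siteMean s g ρ z.1 (z.2.1 l) z.2.2) := by
  have h := (measurable_siteMean (p := p) s g ρ).comp
    (by fun_prop : Measurable fun z : EdgeFun p × (Fin p → F) × (ℕ → Γ → ℝ) =>
      (z.2.1 l, z.1, z.2.2))
  exact Real.measurable_log.comp h

lemma measurable_cavity_term : Measurable
    fun z : EdgeFun p × (Fin p → F) × (ℕ → Γ → ℝ) => Real.log (cavityMean g ρ z.1 z.2.2) := by
  have h := (measurable_cavityMean (p := p) g ρ).comp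
    (by fun_prop : Measurable fun z : EdgeFun p × (Fin p → F) × (ℕ → Γ → ℝ) => (z.1, z.2.2))
  exact Real.measurable_log.comp h

/-- The law of θ is pulled back to the parameters (a, b, f). There the three averages are a(1 +
bY_i) with Y_i depending on the i.i.d. places only, so that `integral_log_nonpos` applies. -/
lemma integral_stepIntegrand_nonpos (hp : 1 ≤ p) {θlaw : ProbabilityMeasure (EdgeFun p)}
    (hfac : Factorizes p θlaw) (hκ : ∀ᵐ θ ∂(θlaw : Measure (EdgeFun p)), ∀ σ, |θ σ| ≤ κ)
    (X : Measure (Γ → ℝ)) [IsProbabilityMeasure X] :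
    ∫ z, stepIntegrand s g ρ hp z ∂(θlaw : Measure (EdgeFun p)).prod
      ((Measure.pi fun _ : Fin p => unifMeasure F).prod (Measure.infinitePi fun _ : ℕ => X)) ≤
      0 := by
  obtain ⟨κ₀, φ, hmap, hae, hb, hpos⟩ := hfac
  set R := (Measure.pi fun _ : Fin p => unifMeasure F).prod (Measure.infinitePi fun _ : ℕ => X)
    with hR
  set Φ : Measure (Fin p → Spin → ℝ) := Measure.pi fun _ : Fin p => (φ : Measure (Spin → ℝ))
    with hΦ
  have hΘ : MeasurePreserving couplingFun ((κ₀ : Measure (ℝ × ℝ)).prod Φ)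
      (θlaw : Measure (EdgeFun p)) := ⟨measurable_couplingFun, hmap.symm⟩
  have hnice : ∀ᵐ w ∂(κ₀ : Measure (ℝ × ℝ)).prod Φ, IsNice κ w := by
    filter_upwards [hae, hΘ.quasiMeasurePreserving.ae hκ] with w h1 h2
    exact ⟨fun σ => (h1 σ).1, fun σ => (h1 σ).2, h2⟩
  have hassoc := MeasurePreserving.symm MeasurableEquiv.prodAssoc
    (measurePreserving_prodAssoc (κ₀ : Measure (ℝ × ℝ)) Φ R)
  have hnice' : ∀ᵐ z ∂(κ₀ : Measure (ℝ × ℝ)).prod (Φ.prod R), IsNice κ (z.1, z.2.1) :=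
    hassoc.quasiMeasurePreserving.ae (Measure.quasiMeasurePreserving_fst.ae hnice)
  have hT := (hΘ.prod (MeasurePreserving.id R)).comp hassoc
  have hmeas : Measurable (stepIntegrand s g ρ hp) :=
    measurable_tripleComb (measurable_edge_term s ρ) (measurable_site_term s g ρ _)
      (measurable_cavity_term g ρ)
  rw [← integral_comp_measurePreserving hT hmeas.aestronglyMeasurable]
  have hpl := measurable_places (p := p) (Γ := Γ) (F := F)
  have m1 : ∀ U : Fin p → PlaceParam Γ F → K → ℝ, (∀ l, Measurable (Function.uncurry (U l))) →
      Measurable fun z : (Fin p → Spin → ℝ) × (Fin p → F) × (ℕ → Γ → ℝ) =>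
        prodAvg ρ U (places z.1 z.2.1 z.2.2) := fun U hU => (measurable_prodAvg hU).comp hpl
  have hu := measurable_graphPlace (Γ := Γ) s
  have hu' := measurable_fieldPlace (F := F) g
  have hmix : ∀ l : Fin p, Measurable (Function.uncurry
      (mixed (graphPlace s) (fieldPlace g) l : PlaceParam Γ F → K → ℝ)) := by
    intro l; unfold mixed; split_ifs <;> assumption
  let Y₁ := fun z : (Fin p → Spin → ℝ) × (Fin p → F) × (ℕ → Γ → ℝ) =>
    prodAvg ρ (fun _ => graphPlace s) (places z.1 z.2.1 z.2.2)
  let Y₂ := fun z : (Fin p → Spin → ℝ) × (Fin p → F) × (ℕ → Γ → ℝ) =>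
    prodAvg ρ (mixed (graphPlace s) (fieldPlace g)) (places z.1 z.2.1 z.2.2)
  let Y₃ := fun z : (Fin p → Spin → ℝ) × (Fin p → F) × (ℕ → Γ → ℝ) =>
    prodAvg ρ (fun _ => fieldPlace g) (places z.1 z.2.1 z.2.2)
  have hcongr : ∫ z, stepIntegrand s g ρ hp
      ((Prod.map couplingFun id ∘ ⇑(MeasurableEquiv.prodAssoc (α := ℝ × ℝ)
        (β := Fin p → Spin → ℝ) (γ := (Fin p → F) × (ℕ → Γ → ℝ))).symm) z)
        ∂(κ₀ : Measure (ℝ × ℝ)).prod (Φ.prod R) =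
      ∫ z, tripleComb p (Real.log (z.1.1 * (1 + z.1.2 * Y₁ z.2)))
        (Real.log (z.1.1 * (1 + z.1.2 * Y₂ z.2))) (Real.log (z.1.1 * (1 + z.1.2 * Y₃ z.2)))
        ∂(κ₀ : Measure (ℝ × ℝ)).prod (Φ.prod R) := by
    refine integral_congr_ae ?_
    filter_upwards [hnice'] with z hz
    change tripleComb p (Real.log (edgeMean s ρ (couplingFun (z.1, z.2.1)) z.2.2.1))
      (Real.log (siteMean s g ρ (couplingFun (z.1, z.2.1)) (z.2.2.1 ⟨p - 1, _⟩) z.2.2.2))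
      (Real.log (cavityMean g ρ (couplingFun (z.1, z.2.1)) z.2.2.2)) = _
    rw [(hz.edge_identity s ρ z.2.2.1 z.2.2.2).1, (hz.site_identity s g ρ hp z.2.2.1 z.2.2.2).1,
      (hz.cavity_identity g ρ z.2.2.1 z.2.2.2).1]
  rw [hcongr]
  -- If b vanishes almost surely, all three logarithms equal log a and cancel; otherwise the factors
  -- are bounded and the replica argument runs.
  rcases exists_bound_of_ae_lt_one hp (hae.mono fun w hw σ => (hw σ).2) with hb0 | ⟨M, hM0, hM⟩
  · have h0 := Measure.quasiMeasurePreserving_fst (μ := (κ₀ : Measure (ℝ × ℝ)))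
      (ν := Φ.prod R) |>.ae hb0
    refine le_of_eq (integral_eq_zero_of_ae ?_)
    filter_upwards [h0] with z hz
    simp only [hz, zero_mul, add_zero, mul_one, Pi.zero_apply]
    exact tripleComb_self hp _
  · refine integral_log_nonpos hp (m1 _ fun _ => hu) (m1 _ hmix) (m1 _ fun _ => hu')
      (fun n => ?_) (fun n hn => (hb n hn).2) ?_ (κ := κ) ?_
    · have hP := measurePreserving_places (p := p) (φ : Measure (Spin → ℝ)) (unifMeasure F) X
      have mm : ∀ U : Fin p → PlaceParam Γ F → K → ℝ, (∀ l, Measurable (Function.uncurry (U l))) →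
          Measurable fun w => prodAvg ρ U w ^ n := fun U hU => (measurable_prodAvg hU).pow_const n
      have hq := integral_comp_measurePreserving hP
        (f := fun w => tripleComb p (prodAvg ρ (fun _ => graphPlace s) w ^ n)
          (prodAvg ρ (mixed (graphPlace s) (fieldPlace g)) w ^ n)
          (prodAvg ρ (fun _ => fieldPlace g) w ^ n))
        (measurable_tripleComb (mm _ fun _ => hu) (mm _ hmix) (mm _ fun _ => hu')).aestronglyMeasurable
      rw [hq]
      refine integral_tripleComb_nonneg hp hu hu' hM0 ?_ ?_ ?_ n
      · filter_upwards [Measure.quasiMeasurePreserving_fst.ae hM] with w hw k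
        exact hw _
      · filter_upwards [Measure.quasiMeasurePreserving_fst.ae hM] with w hw k
        exact abs_le.mpr (locAvg_mem (fun s => abs_le.mp (hw s)) _)
      · refine hpos.imp id fun h => ?_
        filter_upwards [Measure.quasiMeasurePreserving_fst.ae hM,
          Measure.quasiMeasurePreserving_fst.ae h] with w hw hw0 k
        exact ⟨hw0 _, (locAvg_mem (fun s => ⟨hw0 s, (abs_le.mp (hw s)).2⟩) _).1⟩
    · filter_upwards [hnice'] with z hz
      exact ⟨(hz.edge_identity s ρ z.2.2.1 z.2.2.2).2,
        (hz.site_identity s g ρ hp z.2.2.1 z.2.2.2).2,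
        (hz.cavity_identity g ρ z.2.2.1 z.2.2.2).2⟩
    · filter_upwards [hnice'] with z hz
      refine ⟨hz.pos_left, ?_, ?_, ?_⟩
      · have := edgeMean_mem s ρ hz.bound z.2.2.1
        rwa [(hz.edge_identity s ρ z.2.2.1 z.2.2.2).1] at this
      · have := siteMean_mem s g ρ hz.bound (z.2.2.1 ⟨p - 1, by omega⟩) z.2.2.2
        rwa [(hz.site_identity s g ρ hp z.2.2.1 z.2.2.2).1] at this
      · have := cavityMean_mem g ρ hz.bound z.2.2.2
        rwa [(hz.cavity_identity g ρ z.2.2.1 z.2.2.2).1] at this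

/-- The interpolation inequality when the vertices are sampled with replacement. -/
theorem fixedGraph_inequality (hp : 1 ≤ p) {θlaw : ProbabilityMeasure (EdgeFun p)}
    (hfac : Factorizes p θlaw) (hκ : ∀ᵐ θ ∂(θlaw : Measure (EdgeFun p)), ∀ σ, |θ σ| ≤ κ)
    (X : Measure (Γ → ℝ)) [IsProbabilityMeasure X] :
    tripleComb p
      (unifAvg fun i : Fin p → F => ∫ θ, Real.log (edgeMean s ρ θ i) ∂(θlaw : Measure (EdgeFun p)))
      (unifAvg fun i : F => ∫ z, Real.log (siteMean s g ρ z.1 i z.2)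
        ∂(θlaw : Measure (EdgeFun p)).prod (Measure.infinitePi fun _ : ℕ => X))
      (∫ z, Real.log (cavityMean g ρ z.1 z.2)
        ∂(θlaw : Measure (EdgeFun p)).prod (Measure.infinitePi fun _ : ℕ => X)) ≤ 0 := by
  have hmain := integral_stepIntegrand_nonpos s g ρ (F := F) hp hfac hκ X
  set T := (θlaw : Measure (EdgeFun p)) with hT
  set V := Measure.pi fun _ : Fin p => unifMeasure F with hV
  set I := Measure.infinitePi fun _ : ℕ => X with hI
  have hκ' : ∀ᵐ z ∂T.prod (V.prod I), ∀ σ, |z.1 σ| ≤ κ :=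
    Measure.quasiMeasurePreserving_fst.ae hκ
  have i1 : Integrable (fun z => Real.log (edgeMean s ρ z.1 z.2.1)) (T.prod (V.prod I)) := by
    refine Integrable.of_bound (measurable_edge_term s ρ).aestronglyMeasurable κ ?_
    filter_upwards [hκ'] with z hz
    exact abs_log_le_of_mem (edgeMean_mem s ρ hz _)
  have i2 : Integrable (fun z => Real.log (siteMean s g ρ z.1 (z.2.1 ⟨p - 1, by omega⟩) z.2.2))
      (T.prod (V.prod I)) := by
    refine Integrable.of_bound (measurable_site_term s g ρ _).aestronglyMeasurable κ ?_
    filter_upwards [hκ'] with z hz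
    exact abs_log_le_of_mem (siteMean_mem s g ρ hz _ _)
  have i3 : Integrable (fun z => Real.log (cavityMean g ρ z.1 z.2.2)) (T.prod (V.prod I)) := by
    refine Integrable.of_bound (measurable_cavity_term g ρ).aestronglyMeasurable κ ?_
    filter_upwards [hκ'] with z hz
    exact abs_log_le_of_mem (cavityMean_mem g ρ hz _)
  unfold stepIntegrand at hmain
  rw [integral_tripleComb p i1 i2 i3] at hmain
  have e1 : ∫ z, Real.log (edgeMean s ρ z.1 z.2.1) ∂T.prod (V.prod I) =
      unifAvg fun i : Fin p → F => ∫ θ, Real.log (edgeMean s ρ θ i) ∂T := by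
    have hm := (measurable_edgeMean (p := p) s ρ).log
    refine (integral_comp_measurePreserving ((MeasurePreserving.id T).prod
      (measurePreserving_fst (μ := V) (ν := I)))
      (f := fun z => Real.log (edgeMean s ρ z.1 z.2)) hm.aestronglyMeasurable).trans ?_
    rw [integral_prod_symm _ (Integrable.of_bound hm.aestronglyMeasurable κ ?_),
      hV, integral_pi_unifMeasure]
    filter_upwards [Measure.quasiMeasurePreserving_fst.ae hκ] with z hz
    exact abs_log_le_of_mem (edgeMean_mem s ρ hz _)
  have e2 : ∫ z, Real.log (siteMean s g ρ z.1 (z.2.1 ⟨p - 1, by omega⟩) z.2.2)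
      ∂T.prod (V.prod I) =
      unifAvg fun i : F => ∫ z, Real.log (siteMean s g ρ z.1 i z.2) ∂T.prod I := by
    have hm := (measurable_siteMean (p := p) s g ρ).log
    -- A site uses only the last of the p sampled vertices, whose marginal law is uniform.
    have hmp := (measurePreserving_leftComm (μ := T) (ν := unifMeasure F) (τ := I)).comp
      ((MeasurePreserving.id T).prod ((measurePreserving_eval (fun _ : Fin p => unifMeasure F)
        ⟨p - 1, by omega⟩).prod (MeasurePreserving.id I)))
    refine (integral_comp_measurePreserving hmp
      (f := fun z => Real.log (siteMean s g ρ z.2.1 z.1 z.2.2)) hm.aestronglyMeasurable).trans ?_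
    rw [integral_prod _ (Integrable.of_bound hm.aestronglyMeasurable κ ?_), integral_unifMeasure]
    filter_upwards [Measure.quasiMeasurePreserving_snd.ae
      (Measure.quasiMeasurePreserving_fst.ae hκ)] with z hz
    exact abs_log_le_of_mem (siteMean_mem s g ρ hz _ _)
  have e3 : ∫ z, Real.log (cavityMean g ρ z.1 z.2.2) ∂T.prod (V.prod I) =
      ∫ z, Real.log (cavityMean g ρ z.1 z.2) ∂T.prod I := by
    have hm := (measurable_cavityMean (p := p) g ρ).log
    exact integral_comp_measurePreserving ((MeasurePreserving.id T).prod
      (measurePreserving_snd (μ := V) (ν := I)))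
      (f := fun z => Real.log (cavityMean g ρ z.1 z.2)) hm.aestronglyMeasurable
  rwa [e1, e2, e3] at hmain

end FixedGraphInequality

/-! ### Adding one edge or one site to the random graph -/

section Steps

lemma integral_unifAvg {α β : Type*} [Fintype α] [MeasurableSpace β] {μ : Measure β}
    {f : α → β → ℝ} (hf : ∀ a, Integrable (f a) μ) :
    ∫ b, unifAvg (fun a => f a b) ∂μ = unifAvg fun a => ∫ b, f a b ∂μ := by
  unfold unifAvg
  rw [integral_const_mul, integral_finsetSum _ fun a _ => hf a]

variable {P : Set ℕ} {Γ : Type*} [Countable Γ] {N : ℕ} {d : Fin N → ℕ} {E E' S S' : P →₀ ℕ}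
  (L : Laws P Γ) {κ : ℝ} {p : P}

/-- The expected logarithm of the partition function. -/
def logZ (L : Laws P Γ) (d : Fin N → ℕ) (E S : P →₀ ℕ) : ℝ :=
  matchAvg d E S fun m => ∫ ω, Real.log (partitionFun ω m) ∂L.disorder

/-- The expected gain when an edge is added at given places. -/
def edgeGain (p : P) (m : Matching d E S) (i : Fin (p : ℕ) → Free m) : ℝ :=
  ∫ z, Real.log (gibbsAvg z.1 m fun σ _ => expFun z.2 fun j => σ (i j).val.1)
    ∂L.disorder.prod (L.θ p : Measure (EdgeFun p))

/-- The expected gain when a site is added at a given place. -/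
def siteGain (p : P) (m : Matching d E S) (i : Free m) : ℝ :=
  ∫ z, Real.log (gibbsAvg z.1 m fun σ γ =>
    bracketMinus (expFun z.2.1) (fun l => z.2.2 l γ) (σ i.val.1)) ∂L.disorderFresh p

/-- The expected logarithm of the average of an edge function in the fields. -/
def cavityGain (p : P) (m : Matching d E S) : ℝ :=
  ∫ z, Real.log (gibbsAvg z.1 m fun _ γ => bracket (expFun z.2.1) fun l => z.2.2 l γ)
    ∂L.disorderFresh p

/-- A bound valid for every θ, not just almost every one, so that the Gibbs averages can be
rewritten as integrals under the expectation. -/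
lemma expFun_mem_sum {p : ℕ} (θ : EdgeFun p) (ε : Fin p → Spin) :
    expFun θ ε ∈ Set.Icc 0 (∑ ε, expFun θ ε) :=
  ⟨(Real.exp_pos _).le, Finset.single_le_sum (f := expFun θ)
    (fun _ _ => (Real.exp_pos _).le) (Finset.mem_univ ε)⟩

lemma gibbsWeight_setEdge_addEdge (h : IsSuccAt p E E') (ω : Disorder P Γ) (θ : EdgeFun p)
    (m : Matching d E S) (i : Fin (p : ℕ) ↪ Free m) (γ : Γ) (σ : Fin N → Spin) :
    gibbsWeight (ω.setEdge p (E p) θ) (h.addEdge m i) γ σ =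
      gibbsWeight ω m γ σ * expFun θ fun j => σ (i j).val.1 := by
  have h1 : (ω.setEdge p (E p) θ).edge p (E p) = θ := Function.update_self _ _ _
  unfold gibbsWeight expFun
  rw [h.edgeEnergy_addEdge, h.siteEnergy_addEdge, edgeEnergy_setEdge, siteEnergy_setEdge, h1,
    mul_assoc, ← Real.exp_add, add_right_comm]
  rfl

lemma gibbsWeight_setSite_addSite (h : IsSuccAt p S S') (ω : Disorder P Γ) (θ : EdgeFun p)
    (x : ℕ → Γ → ℝ) (m : Matching d E S) (i : Free m) (γ : Γ) (σ : Fin N → Spin) :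
    gibbsWeight (ω.setSite p (S p) θ x) (h.addSite m i) γ σ =
      gibbsWeight ω m γ σ * bracketMinus (expFun θ) (fun l => x l γ) (σ i.val.1) := by
  have h1 : (ω.setSite p (S p) θ x).site p (S p) = θ := Function.update_self _ _ _
  have h2 : ∀ l, (ω.setSite p (S p) θ x).field p (S p) l γ = x l γ := fun l => by
    simp [Disorder.field, Disorder.setSite]
  unfold gibbsWeight
  rw [h.edgeEnergy_addSite, h.siteEnergy_addSite, edgeEnergy_setSite, siteEnergy_setSite, h1,
    ← exp_siteFun]
  simp only [h2]
  rw [mul_assoc, ← Real.exp_add, add_assoc]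
  rfl

variable (hgood : ∀ᵐ ω ∂L.disorder, Disorder.Good κ ω)
  (hθκ : ∀ p : P, ∀ᵐ θ ∂(L.θ p : Measure (EdgeFun p)), ∀ σ, |θ σ| ≤ κ)

include hgood hθκ

lemma integrable_edgeGain (m : Matching d E S) (i : Fin (p : ℕ) → Free m) :
    Integrable (fun z : Disorder P Γ × EdgeFun p =>
      Real.log (gibbsAvg z.1 m fun σ _ => expFun z.2 fun j => σ (i j).val.1))
      (L.disorder.prod (L.θ p : Measure (EdgeFun p))) := by
  refine integrable_log_gibbsAvg hgood m
    (g := fun θ : EdgeFun p => fun σ _ => expFun θ fun j => σ (i j).val.1)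
    (fun σ γ => by unfold expFun; fun_prop) (fun θ σ γ => (Real.exp_pos _).le) ?_
  filter_upwards [hθκ p] with θ hθ σ γ
  exact expFun_mem hθ _

lemma integrable_siteGain (m : Matching d E S) (i : Free m) :
    Integrable (fun z : Disorder P Γ × EdgeFun p × (ℕ → Γ → ℝ) => Real.log (gibbsAvg z.1 m
      fun σ γ => bracketMinus (expFun z.2.1) (fun l => z.2.2 l γ) (σ i.val.1)))
      (L.disorderFresh p) := by
  refine integrable_log_gibbsAvg hgood m (g := fun z : EdgeFun p × (ℕ → Γ → ℝ) =>
    fun σ γ => bracketMinus (expFun z.1) (fun l => z.2 l γ) (σ i.val.1))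
    (fun σ γ => measurable_bracketMinus_expFun (by fun_prop) (by fun_prop) _)
    (fun θ σ γ => (bracketMinus_expFun_pos _ _ _).le) ?_
  filter_upwards [Measure.quasiMeasurePreserving_fst.ae (hθκ p)] with z hz σ γ
  exact bracketMinus_mem (expFun_mem hz) _ _

lemma integrable_cavityGain (m : Matching d E S) :
    Integrable (fun z : Disorder P Γ × EdgeFun p × (ℕ → Γ → ℝ) => Real.log (gibbsAvg z.1 m
      fun _ γ => bracket (expFun z.2.1) fun l => z.2.2 l γ)) (L.disorderFresh p) := by
  refine integrable_log_gibbsAvg hgood m (g := fun z : EdgeFun p × (ℕ → Γ → ℝ) =>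
    fun _ γ => bracket (expFun z.1) fun l => z.2 l γ)
    (fun σ γ => measurable_bracket_expFun (by fun_prop) (by fun_prop))
    (fun θ σ γ => bracket_expFun_nonneg _ _) ?_
  filter_upwards [Measure.quasiMeasurePreserving_fst.ae (hθκ p)] with z hz σ γ
  exact bracket_mem (expFun_mem hz) _

lemma abs_edgeGain_le (m : Matching d E S) (i : Fin (p : ℕ) → Free m) :
    |edgeGain L p m i| ≤ κ := by
  have h1 : ∀ᵐ z : Disorder P Γ × EdgeFun p ∂L.disorder.prod (L.θ p : Measure (EdgeFun p)),
      ‖Real.log (gibbsAvg z.1 m fun σ _ => expFun z.2 fun j => σ (i j).val.1)‖ ≤ κ := by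
    filter_upwards [Measure.quasiMeasurePreserving_fst.ae hgood,
      Measure.quasiMeasurePreserving_snd.ae (hθκ p)] with z hz hz2
    exact abs_log_le_of_mem (gibbsAvg_mem hz m fun _ _ => expFun_mem hz2 _)
  simpa [edgeGain] using norm_integral_le_of_norm_le_const h1

lemma abs_siteGain_le (m : Matching d E S) (i : Free m) : |siteGain L p m i| ≤ κ := by
  have h1 : ∀ᵐ z : Disorder P Γ × EdgeFun p × (ℕ → Γ → ℝ) ∂L.disorderFresh p,
      ‖Real.log (gibbsAvg z.1 m fun σ γ =>
        bracketMinus (expFun z.2.1) (fun l => z.2.2 l γ) (σ i.val.1))‖ ≤ κ := by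
    filter_upwards [Measure.quasiMeasurePreserving_fst.ae hgood,
      Measure.quasiMeasurePreserving_snd.ae (Measure.quasiMeasurePreserving_fst.ae (hθκ p))]
      with z hz hz2
    exact abs_log_le_of_mem (gibbsAvg_mem hz m fun _ _ => bracketMinus_mem (expFun_mem hz2) _ _)
  simpa [siteGain] using norm_integral_le_of_norm_le_const h1

lemma abs_cavityGain_le (m : Matching d E S) : |cavityGain L p m| ≤ κ := by
  have h1 : ∀ᵐ z : Disorder P Γ × EdgeFun p × (ℕ → Γ → ℝ) ∂L.disorderFresh p,
      ‖Real.log (gibbsAvg z.1 m fun _ γ =>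
        bracket (expFun z.2.1) fun l => z.2.2 l γ)‖ ≤ κ := by
    filter_upwards [Measure.quasiMeasurePreserving_fst.ae hgood,
      Measure.quasiMeasurePreserving_snd.ae (Measure.quasiMeasurePreserving_fst.ae (hθκ p))]
      with z hz hz2
    exact abs_log_le_of_mem (gibbsAvg_mem hz m fun _ _ => bracket_mem (expFun_mem hz2) _)
  simpa [cavityGain] using norm_integral_le_of_norm_le_const h1

/-- The function of the new edge is resampled without changing the law; the Gibbs weight is then
multiplied by the exponential of a fresh edge function, and the cavity identity applies. -/
lemma integral_log_addEdge (h : IsSuccAt p E E') (m : Matching d E S)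
    (i : Fin (p : ℕ) ↪ Free m) :
    ∫ ω, Real.log (partitionFun ω (h.addEdge m i)) ∂L.disorder =
      (∫ ω, Real.log (partitionFun ω m) ∂L.disorder) + edgeGain L p m i := by
  have hi := integrable_log_partitionFun hgood m
  rw [← integral_comp_measurePreserving (measurePreserving_setEdge L p (E p))
    (integrable_log_partitionFun hgood (h.addEdge m i)).aestronglyMeasurable,
    ← integral_comp_measurePreserving (measurePreserving_fst
      (ν := (L.θ p : Measure (EdgeFun p)))) hi.aestronglyMeasurable]
  unfold edgeGain
  rw [← integral_add (hi.comp_fst _) (integrable_edgeGain L hgood hθκ m i)]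
  refine integral_congr_ae ?_
  filter_upwards [Measure.quasiMeasurePreserving_fst.ae hgood,
    Measure.quasiMeasurePreserving_snd.ae (hθκ p)] with z hz hz2
  exact log_partitionFun_of_mul hz m (h.addEdge m i) (Real.exp_pos _)
    (fun _ _ => expFun_mem hz2 _) fun γ σ => gibbsWeight_setEdge_addEdge h z.1 z.2 m i γ σ

lemma integral_log_addSite (h : IsSuccAt p S S') (m : Matching d E S) (i : Free m) :
    ∫ ω, Real.log (partitionFun ω (h.addSite m i)) ∂L.disorder =
      (∫ ω, Real.log (partitionFun ω m) ∂L.disorder) + siteGain L p m i := by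
  have hi := integrable_log_partitionFun hgood m
  rw [← integral_comp_measurePreserving (measurePreserving_setSite L p (S p))
    (integrable_log_partitionFun hgood (h.addSite m i)).aestronglyMeasurable,
    ← integral_comp_measurePreserving (measurePreserving_fst
      (ν := (L.θ p : Measure (EdgeFun p)).prod
        (Measure.infinitePi fun _ : ℕ => (L.x : Measure (Γ → ℝ))))) hi.aestronglyMeasurable]
  unfold siteGain
  rw [Laws.disorderFresh, ← integral_add (hi.comp_fst _) (integrable_siteGain L hgood hθκ m i)]
  refine integral_congr_ae ?_
  filter_upwards [Measure.quasiMeasurePreserving_fst.ae hgood,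
    Measure.quasiMeasurePreserving_snd.ae (Measure.quasiMeasurePreserving_fst.ae (hθκ p))]
    with z hz hz2
  exact log_partitionFun_of_mul hz m (h.addSite m i) (Real.exp_pos _)
    (fun _ _ => bracketMinus_mem (expFun_mem hz2) _ _)
    fun γ σ => gibbsWeight_setSite_addSite h z.1 z.2.1 z.2.2 m i γ σ

lemma logZ_addEdge_sub (h : IsSuccAt p E E')
    (hM : ∀ m : Matching d E S, (p : ℕ) ≤ Fintype.card (Free m)) :
    logZ L d E' S - logZ L d E S = unifAvg fun m : Matching d E S =>
      unifAvg fun i : Fin (p : ℕ) ↪ Free m => edgeGain L p m i := by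
  unfold logZ
  rw [h.matchAvg_edge, matchAvg_eq_unifAvg, matchAvg_eq_unifAvg, ← unifAvg_sub]
  congr 1
  ext m
  -- There must be room for the new edge: otherwise the average over its places would be 0 even for
  -- constants.
  have : Nonempty (Fin (p : ℕ) ↪ Free m) :=
    Function.Embedding.nonempty_of_card_le (by simpa using hM m)
  simp only [integral_log_addEdge L hgood hθκ h, unifAvg_add, unifAvg_const]
  ring

lemma logZ_addSite_sub (h : IsSuccAt p S S')
    (hM : ∀ m : Matching d E S, 0 < Fintype.card (Free m)) :
    logZ L d E S' - logZ L d E S = unifAvg fun m : Matching d E S =>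
      unifAvg fun i : Free m => siteGain L p m i := by
  unfold logZ
  rw [h.matchAvg_site, matchAvg_eq_unifAvg, matchAvg_eq_unifAvg, ← unifAvg_sub]
  congr 1
  ext m
  have : Nonempty (Free m) := Fintype.card_pos_iff.mp (hM m)
  simp only [integral_log_addSite L hgood hθκ h, unifAvg_add, unifAvg_const]
  ring

/-- Given the disorder of the graph, θ and the fields are fresh, so the inequality for a fixed Gibbs
measure is applied and then integrated over the disorder. -/
lemma tripleComb_gain_nonpos (hp : 1 ≤ (p : ℕ)) (hfac : Factorizes p (L.θ p))
    (m : Matching d E S) (hM : 0 < Fintype.card (Free m)) :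
    tripleComb p (unifAvg fun i : Fin (p : ℕ) → Free m => edgeGain L p m i)
      (unifAvg fun i : Free m => siteGain L p m i) (cavityGain L p m) ≤ 0 := by
  have hne : Nonempty (Free m) := Fintype.card_pos_iff.mp hM
  set X := Measure.infinitePi fun _ : ℕ => (L.x : Measure (Γ → ℝ)) with hX
  have j1 := fun i => integrable_edgeGain L hgood hθκ (p := p) m i
  have j2 := fun i => integrable_siteGain L hgood hθκ (p := p) m i
  have j3 := integrable_cavityGain L hgood hθκ (p := p) m
  unfold Laws.disorderFresh at j2 j3
  have e1 : ∀ i, edgeGain L p m i = _ := fun i => integral_prod _ (j1 i)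
  have e2 : ∀ i, siteGain L p m i = _ := fun i => integral_prod _ (j2 i)
  have e3 : cavityGain L p m = _ := integral_prod _ j3
  have k1 := fun i => (j1 i).integral_prod_left
  have k2 := fun i => (j2 i).integral_prod_left
  have k3 := j3.integral_prod_left
  simp only [e1, e2, e3]
  have hint : ∀ {α : Type} [Fintype α] (f : α → Disorder P Γ → ℝ),
      (∀ a, Integrable (f a) L.disorder) → Integrable (fun ω => unifAvg fun a => f a ω)
        L.disorder := fun f hf => by
    unfold unifAvg
    exact (integrable_finsetSum _ fun a _ => hf a).const_mul _
  rw [← integral_unifAvg k1, ← integral_unifAvg k2,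
    ← integral_tripleComb p (hint _ k1) (hint _ k2) k3]
  refine integral_nonpos_of_ae ?_
  filter_upwards [hgood] with ω hω
  let mK : MeasurableSpace (Γ × (Fin N → Spin)) := ⊤
  have hK : DiscreteMeasurableSpace (Γ × (Fin N → Spin)) := ⟨fun _ => trivial⟩
  let mF : MeasurableSpace (Free m) := ⊤
  have hF : DiscreteMeasurableSpace (Free m) := ⟨fun _ => trivial⟩
  obtain ⟨ρ, hρ, hint⟩ := exists_gibbsMeasure hω m mK
  have hmain := fixedGraph_inequality (F := Free m)
    (fun (k : Γ × (Fin N → Spin)) (i : Free m) => k.2 i.val.1) (fun k => k.1) ρ hp hfac (hθκ p)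
    (L.x : Measure (Γ → ℝ))
  have g1 : ∀ (θ : EdgeFun p) (i : Fin (p : ℕ) → Free m),
      gibbsAvg ω m (fun σ _ => expFun θ fun j => σ (i j).val.1) =
        edgeMean (fun (k : Γ × (Fin N → Spin)) (i : Free m) => k.2 i.val.1) ρ θ i := fun θ i =>
    hint _ (∑ ε, expFun θ ε) fun σ γ => by
      rw [abs_of_nonneg (expFun_mem_sum θ _).1]; exact (expFun_mem_sum θ _).2
  have g2 : ∀ (z : EdgeFun p × (ℕ → Γ → ℝ)) (i : Free m),
      gibbsAvg ω m (fun σ γ => bracketMinus (expFun z.1) (fun l => z.2 l γ) (σ i.val.1)) =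
        siteMean (fun (k : Γ × (Fin N → Spin)) (i : Free m) => k.2 i.val.1) (fun k => k.1) ρ
          z.1 i z.2 := fun z i =>
    hint _ (∑ ε, expFun z.1 ε) fun σ γ => by
      have := bracketMinus_mem (expFun_mem_sum z.1) (fun l => z.2 l γ) (σ i.val.1)
      rw [abs_of_nonneg this.1]; exact this.2
  have g3 : ∀ (z : EdgeFun p × (ℕ → Γ → ℝ)),
      gibbsAvg ω m (fun _ γ => bracket (expFun z.1) (fun l => z.2 l γ)) =
        cavityMean (fun k : Γ × (Fin N → Spin) => k.1) ρ z.1 z.2 := fun z =>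
    hint _ (∑ ε, expFun z.1 ε) fun σ γ => by
      have := bracket_mem (expFun_mem_sum z.1) (fun l => z.2 l γ)
      rw [abs_of_nonneg this.1]; exact this.2
  simp only [g1, g2, g3]
  exact hmain

/-- The change of the free energy in one step of the interpolation. -/
theorem tripleComb_logZ_le (hκ : 0 ≤ κ) (hp : 1 ≤ (p : ℕ)) (hfac : Factorizes p (L.θ p))
    (hE : IsSuccAt p E E') (hS : IsSuccAt p S S') {M : ℕ}
    (hM : ∀ m : Matching d E S, Fintype.card (Free m) = M) (hpM : (p : ℕ) ≤ M) :
    tripleComb p (logZ L d E' S - logZ L d E S) (logZ L d E S' - logZ L d E S)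
      (matchAvg d E S fun m => cavityGain L p m) ≤ 2 * κ * ((p : ℕ) / M) := by
  have hp0 : (0 : ℝ) < (p : ℕ) := by exact_mod_cast hp
  have hM0 : 0 < M := by omega
  have hM0' : (0 : ℝ) < M := by exact_mod_cast hM0
  rw [logZ_addEdge_sub L hgood hθκ hE fun m => (hM m).symm ▸ hpM,
    logZ_addSite_sub L hgood hθκ hS fun m => (hM m).symm ▸ hM0, matchAvg_eq_unifAvg]
  unfold tripleComb
  rw [← unifAvg_mul_left, ← unifAvg_mul_left, ← unifAvg_sub, ← unifAvg_add]
  have hc : 0 ≤ 2 * κ * ((p : ℕ) / M : ℝ) := by positivity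
  rcases isEmpty_or_nonempty (Matching d E S) with he | he
  · simpa [unifAvg] using hc
  rw [← unifAvg_const (α := Matching d E S) (2 * κ * ((p : ℕ) / M : ℝ))]
  refine unifAvg_mono fun m => ?_
  have h1 := tripleComb_gain_nonpos L hgood hθκ hp hfac m ((hM m).symm ▸ hM0)
  have h2 := abs_unifAvg_embedding_sub_le (F := Free m) ((hM m).symm ▸ hpM)
    ((hM m).symm ▸ hM0) hκ (fun i : Fin (p : ℕ) → Free m => edgeGain L p m i)
    fun i => abs_edgeGain_le L hgood hθκ m i
  rw [hM m] at h2
  -- The sampling error 2κp²/M of the edge term enters with weight 1/p. The site term samples a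
  -- single place and has no error.
  have h3 := mul_le_mul_of_nonneg_left ((le_abs_self _).trans h2)
    (by positivity : (0 : ℝ) ≤ 1 / (p : ℕ))
  have h4 : (1 : ℝ) / (p : ℕ) * (2 * κ * ((p : ℕ) ^ 2 / M : ℝ)) = 2 * κ * ((p : ℕ) / M : ℝ) := by
    field_simp
  rw [h4] at h3
  unfold tripleComb at h1
  linarith

end Steps

/-! ### The random walk -/

section Walk

/-- Expectation of a function of the number of successes among `t` trials. -/
def countAvg (p t : ℕ) (g : ℕ → ℝ) : ℝ := walkAvg p t fun X => g (∑ k, (X k).toNat)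

variable {p : ℕ}

lemma countAvg_zero (g : ℕ → ℝ) : countAvg p 0 g = g 0 := by
  simp [countAvg, walkAvg]

lemma countAvg_succ (t : ℕ) (g : ℕ → ℝ) :
    countAvg p (t + 1) g =
      countAvg p t fun n => (1 / p : ℝ) * g (n + 1) + (1 - 1 / p) * g n := by
  unfold countAvg walkAvg
  rw [← (Fin.consEquiv fun _ : Fin (t + 1) => Bool).sum_comp, Fintype.sum_prod_type,
    Fintype.sum_bool, ← Finset.sum_add_distrib]
  refine Finset.sum_congr rfl fun X _ => ?_
  simp only [Fin.consEquiv_apply, Fin.prod_univ_succ, Fin.sum_univ_succ, Fin.cons_zero,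
    Fin.cons_succ, Bool.toNat_true, Bool.toNat_false, if_true, zero_add, add_comm 1]
  simp only [Bool.false_eq_true, if_false]
  ring

lemma countAvg_mono (hp : 1 ≤ p) (t : ℕ) {f g : ℕ → ℝ} (h : ∀ n, f n ≤ g n) :
    countAvg p t f ≤ countAvg p t g := by
  refine Finset.sum_le_sum fun X _ => mul_le_mul_of_nonneg_left (h _)
    (Finset.prod_nonneg fun k _ => ?_)
  have : (1 : ℝ) / p ≤ 1 := by
    rw [div_le_one (by positivity)]; exact_mod_cast hp
  split_ifs
  · positivity
  · linarith

lemma countAvg_add (t : ℕ) (f g : ℕ → ℝ) :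
    countAvg p t (fun n => f n + g n) = countAvg p t f + countAvg p t g := by
  simp only [countAvg, walkAvg, mul_add, Finset.sum_add_distrib]

lemma countAvg_mul_left (t : ℕ) (c : ℝ) (f : ℕ → ℝ) :
    countAvg p t (fun n => c * f n) = c * countAvg p t f := by
  simp only [countAvg, walkAvg, Finset.mul_sum]
  exact Finset.sum_congr rfl fun X _ => by ring

lemma countAvg_const (t : ℕ) (c : ℝ) : countAvg p t (fun _ => c) = c := by
  induction t with
  | zero => exact countAvg_zero _
  | succ t ih =>
    rw [countAvg_succ]
    convert ih using 2
    ext; ring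

lemma countAvg_sub (t : ℕ) (f g : ℕ → ℝ) :
    countAvg p t (fun n => f n - g n) = countAvg p t f - countAvg p t g := by
  simp only [countAvg, walkAvg, mul_sub, Finset.sum_sub_distrib]

lemma abs_countAvg_le (hp : 1 ≤ p) (t : ℕ) {f : ℕ → ℝ} {c : ℝ} (h : ∀ n, |f n| ≤ c) :
    |countAvg p t f| ≤ c := by
  rw [abs_le, ← countAvg_const (p := p) t c, ← countAvg_const (p := p) t (-_)]
  constructor
  · refine countAvg_mono hp t fun n => ?_
    rw [countAvg_const]
    exact (abs_le.mp (h n)).1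
  · exact countAvg_mono hp t fun n => (abs_le.mp (h n)).2

/-- The increments pX − 1 are centred with variance p − 1. -/
lemma countAvg_variance (hp : 1 ≤ p) (t : ℕ) :
    countAvg p t (fun n => ((p : ℝ) * n - t) ^ 2) = t * ((p : ℝ) - 1) := by
  have hp0 : (p : ℝ) ≠ 0 := by positivity
  induction t with
  | zero => simp [countAvg_zero]
  | succ t ih =>
    rw [countAvg_succ]
    have e : (fun n : ℕ => (1 / p : ℝ) * ((p : ℝ) * ((n + 1 : ℕ) : ℝ) - ((t + 1 : ℕ) : ℝ)) ^ 2 +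
        (1 - 1 / p) * ((p : ℝ) * n - ((t + 1 : ℕ) : ℝ)) ^ 2) =
        fun n : ℕ => ((p : ℝ) * n - t) ^ 2 + ((p : ℝ) - 1) := by
      ext n
      push_cast
      field_simp
      ring
    rw [e, countAvg_add, countAvg_const, ih]
    push_cast
    ring

lemma countAvg_sq_le (hp : 1 ≤ p) (t : ℕ) {s : ℕ} (hts : t ≤ s) :
    countAvg p t (fun n => ((p : ℝ) * n - t) ^ 2) ≤ s * p := by
  rw [countAvg_variance hp]
  have h1 : (t : ℝ) ≤ s := by exact_mod_cast hts
  have h2 : (1 : ℝ) ≤ p := by exact_mod_cast hp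
  have h3 : (0 : ℝ) ≤ t := by positivity
  nlinarith

end Walk

/-! ### Comparison along the walk -/

section Comparison

/-- The properties of the free energies `a n m` of the graphs with `n` hyperedges and `m` sites of
the current type `p`, room being left for `s` half-edges of that type. -/
structure WalkData (p s : ℕ) (κ : ℝ) (a T : ℕ → ℕ → ℝ) : Prop where
  edge : ∀ n m, p * n + p + m ≤ s → |a (n + 1) m - a n m| ≤ κ
  site : ∀ n m, p * n + m + 1 ≤ s → |a n (m + 1) - a n m| ≤ κ
  cavity : ∀ n m, |T n m| ≤ κ
  step : ∀ n m, p * n + p + m ≤ s →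
    tripleComb p (a (n + 1) m - a n m) (a n (m + 1) - a n m) (T n m) ≤
      2 * κ * (p / (s - p * n - m : ℝ))

variable {p s : ℕ} {κ : ℝ} {a T : ℕ → ℕ → ℝ}

/-- The extension of `a` to infeasible numbers of hyperedges. -/
def truncated (p s : ℕ) (a : ℕ → ℕ → ℝ) (n m : ℕ) : ℝ := a (min n ((s - m) / p)) m

lemma WalkData.kappa_nonneg (h : WalkData p s κ a T) : 0 ≤ κ :=
  (abs_nonneg _).trans (h.cavity 0 0)

lemma WalkData.truncated_edge (h : WalkData p s κ a T) (hp : 1 ≤ p) (n : ℕ) {m : ℕ} (hm : m ≤ s) :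
    |truncated p s a (n + 1) m - truncated p s a n m| ≤ κ := by
  unfold truncated
  by_cases hn : n + 1 ≤ (s - m) / p
  · rw [min_eq_left hn, min_eq_left (by omega)]
    refine h.edge n m ?_
    have := (Nat.le_div_iff_mul_le (by omega)).mp hn
    rw [add_mul, one_mul, mul_comm] at this
    omega
  · rw [min_eq_right (by omega), min_eq_right (by omega)]
    simpa using h.kappa_nonneg

/-- An additional site lowers the cap on the number of edges by at most one, so at worst one edge
and one site are exchanged. -/
lemma WalkData.truncated_site (h : WalkData p s κ a T) (hp : 1 ≤ p) (n : ℕ) {m : ℕ}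
    (hm : m + 1 ≤ s) : |truncated p s a n (m + 1) - truncated p s a n m| ≤ 2 * κ := by
  have hκ := h.kappa_nonneg
  set c := (s - m) / p with hc
  set c' := (s - (m + 1)) / p with hc'
  have h1 : c' ≤ c := Nat.div_le_div_right (by omega)
  have h2 : c ≤ c' + 1 := by
    rw [hc, hc', ← Nat.add_div_right _ (by omega : 0 < p)]
    exact Nat.div_le_div_right (by omega)
  have hc1 : p * c + m ≤ s := by
    have := Nat.mul_div_le (s - m) p
    rw [← hc] at this; omega
  have hc1' : p * c' + m + 1 ≤ s := by
    have := Nat.mul_div_le (s - (m + 1)) p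
    rw [← hc'] at this; omega
  have hsite : |a (min n c') (m + 1) - a (min n c') m| ≤ κ := by
    refine h.site _ _ ?_
    have : p * min n c' ≤ p * c' := Nat.mul_le_mul_left _ (min_le_right _ _)
    omega
  change |a (min n c') (m + 1) - a (min n c) m| ≤ 2 * κ
  rcases (by omega : min n c = min n c' ∨ min n c = min n c' + 1) with h3 | h3
  · rw [h3]; linarith
  · have hedge : |a (min n c' + 1) m - a (min n c') m| ≤ κ := by
      refine h.edge _ _ ?_
      have : p * (min n c' + 1) ≤ p * c := Nat.mul_le_mul_left _ (by omega)
      rw [mul_add, mul_one] at this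
      omega
    rw [h3]
    rw [abs_le] at *
    constructor <;> linarith

lemma abs_tripleComb_le_three {p : ℕ} (hp : 1 ≤ p) {y₁ y₂ y₃ κ : ℝ} (h₁ : |y₁| ≤ κ)
    (h₂ : |y₂| ≤ 2 * κ) (h₃ : |y₃| ≤ κ) : |tripleComb p y₁ y₂ y₃| ≤ 3 * κ := by
  have hp0 : (1 : ℝ) ≤ p := by exact_mod_cast hp
  have h : (0 : ℝ) ≤ ((p : ℝ) - 1) / p := div_nonneg (by linarith) (by linarith)
  have h' : (0 : ℝ) ≤ 1 / (p : ℝ) := by positivity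
  have hsum : 1 / (p : ℝ) + ((p : ℝ) - 1) / p = 1 := by field_simp; ring
  unfold tripleComb
  rw [abs_le] at *
  constructor <;> nlinarith

/-- The change of the truncated free energy, uniformly in the number of hyperedges. -/
lemma WalkData.truncated_step (h : WalkData p s κ a T) (hp : 1 ≤ p) {δ t τ : ℕ} (hδ : 1 ≤ δ)
    (hs : s = τ + 2 * δ) (ht : t < τ) (n : ℕ) :
    tripleComb p
      (truncated p s a (n + 1) (τ - t - 1) - truncated p s a n (τ - t - 1))
      (truncated p s a n (τ - t) - truncated p s a n (τ - t - 1)) (T n (τ - t - 1)) ≤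
      3 * κ * (p / δ + ((p : ℝ) * n - t) ^ 2 / δ ^ 2) := by
  have hκ := h.kappa_nonneg
  obtain ⟨m, hm⟩ : ∃ m, τ = t + m + 1 := ⟨τ - t - 1, by omega⟩
  have e1 : τ - t - 1 = m := by omega
  have e2 : τ - t = m + 1 := by omega
  rw [e1, e2]
  have hδ0 : (1 : ℝ) ≤ δ := by exact_mod_cast hδ
  have hp0 : (1 : ℝ) ≤ p := by exact_mod_cast hp
  have htriv := (abs_le.mp (abs_tripleComb_le_three hp (h.truncated_edge hp n (m := m) (by omega))
    (h.truncated_site hp n (m := m) (by omega)) (h.cavity n m))).2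
  have hsq : 0 ≤ ((p : ℝ) * n - t) ^ 2 / (δ : ℝ) ^ 2 := by positivity
  -- If at least δ ≥ p half-edges are free, the truncation is inactive and the true step inequality
  -- applies. In each remaining case the trivial bound 3κ suffices, since p/δ or (pn − t)²/δ² is at
  -- least 1.
  by_cases hgood : p * n + m + δ ≤ s
  · by_cases hpδ : p ≤ δ
    · have hn1 : n + 1 ≤ (s - m) / p := by
        rw [Nat.le_div_iff_mul_le (by omega), add_mul, one_mul, mul_comm n p]
        omega
      have hn2 : n ≤ (s - (m + 1)) / p := by
        rw [Nat.le_div_iff_mul_le (by omega), mul_comm n p]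
        omega
      have := h.step n m (by omega)
      unfold truncated
      rw [min_eq_left hn1, min_eq_left (by omega), min_eq_left hn2]
      refine this.trans ?_
      have hle : (δ : ℝ) ≤ s - p * n - m := by
        have : ((p * n + m + δ : ℕ) : ℝ) ≤ s := by exact_mod_cast hgood
        push_cast at this
        linarith
      have h2 : (p : ℝ) / (s - p * n - m : ℝ) ≤ p / δ :=
        div_le_div_of_nonneg_left (by linarith) (by linarith) hle
      have h3 : 0 ≤ (p : ℝ) / δ := by positivity
      nlinarith
    · have h1 : 1 ≤ (p : ℝ) / δ := by
        rw [le_div_iff₀ (by linarith), one_mul]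
        exact_mod_cast (not_le.mp hpδ).le
      nlinarith
  -- From s = t + m + 1 + 2δ, fewer than δ free half-edges forces pn − t to exceed δ.
  · have h1 : (δ : ℝ) ≤ p * n - t := by
      have : s + 1 ≤ p * n + m + δ := by omega
      have : ((t + δ : ℕ) : ℝ) ≤ ((p * n : ℕ) : ℝ) := by
        exact_mod_cast (by omega : t + δ ≤ p * n)
      push_cast at this
      linarith
    have h2 : 1 ≤ ((p : ℝ) * n - t) ^ 2 / (δ : ℝ) ^ 2 := by
      rw [le_div_iff₀ (by positivity), one_mul]
      exact pow_le_pow_left₀ (by linarith) h1 2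
    have h3 : 0 ≤ (p : ℝ) / δ := by positivity
    nlinarith

lemma WalkData.abs_edge_sub_le (h : WalkData p s κ a T) (n k : ℕ) (hk : p * (n + k) ≤ s) :
    |a (n + k) 0 - a n 0| ≤ κ * k := by
  induction k with
  | zero => simp
  | succ k ih =>
    have h1 := ih (le_trans (Nat.mul_le_mul_left _ (by omega)) hk)
    have h2 := h.edge (n + k) 0 (by
      have : p * (n + (k + 1)) = p * (n + k) + p + 0 := by ring
      omega)
    rw [← add_assoc]
    push_cast
    rw [abs_le] at *
    constructor <;> linarith

lemma WalkData.abs_site_sub_le (h : WalkData p s κ a T) (m k : ℕ) (hk : m + k ≤ s) :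
    |a 0 (m + k) - a 0 m| ≤ κ * k := by
  induction k with
  | zero => simp
  | succ k ih =>
    have h1 := ih (by omega)
    have h2 := h.site 0 (m + k) (by omega)
    rw [← add_assoc]
    push_cast
    rw [abs_le] at *
    constructor <;> linarith

/-- The sum over the walk of the expected cavity terms. -/
def walkSum (p τ : ℕ) (T : ℕ → ℕ → ℝ) : ℝ :=
  ∑ t ∈ Finset.range τ, ((p : ℝ) - 1) / p * countAvg p t fun n => T n (τ - t - 1)

lemma WalkData.abs_walkSum_le (h : WalkData p s κ a T) (hp : 1 ≤ p) (τ : ℕ) :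
    |walkSum p τ T| ≤ κ * τ := by
  have hp0 : (1 : ℝ) ≤ p := by exact_mod_cast hp
  have h1 : |((p : ℝ) - 1) / p| ≤ 1 := by
    rw [abs_of_nonneg (div_nonneg (by linarith) (by linarith)), div_le_one (by linarith)]
    linarith
  refine (Finset.abs_sum_le_sum_abs _ _).trans
    ((Finset.sum_le_sum (g := fun _ => κ) fun t _ => ?_).trans ?_)
  · rw [abs_mul]
    have h2 := abs_countAvg_le hp t fun n => h.cavity n (τ - t - 1)
    nlinarith [abs_nonneg (countAvg p t fun n => T n (τ - t - 1))]
  · simp [mul_comm]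

/-- Both endpoints are within κs of `a 0 0`, and the walk sum is at most κs in absolute value. -/
lemma WalkData.trivial_bound (h : WalkData p s κ a T) (hp : 1 ≤ p) {e τ : ℕ} (hs : s = p * e)
    (hτ : τ ≤ s) : a e 0 ≤ a 0 s - walkSum p τ T + 3 * κ * s := by
  have hκ := h.kappa_nonneg
  have h1 := (abs_le.mp (h.abs_edge_sub_le 0 e (by simp [hs]))).2
  have h2 := (abs_le.mp (h.abs_site_sub_le 0 s (by simp))).1
  have h3 := (abs_le.mp (h.abs_walkSum_le hp τ)).2
  rw [zero_add] at h1 h2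
  have he : (e : ℝ) ≤ s := by
    exact_mod_cast hs ▸ Nat.le_mul_of_pos_left e (by omega)
  have hτ' : (τ : ℝ) ≤ s := by exact_mod_cast hτ
  nlinarith

/-- Telescoping in time: the expected increment is the expected triple combination minus the cavity
term, and averaging the pointwise error turns (pn − t)² into its variance. -/
lemma WalkData.walk_bound (h : WalkData p s κ a T) (hp : 1 ≤ p) {δ τ : ℕ} (hδ : 1 ≤ δ)
    (hs : s = τ + 2 * δ) :
    countAvg p τ (fun n => truncated p s a n 0) ≤
      a 0 τ - walkSum p τ T + s * (3 * κ * (p / δ + s * p / δ ^ 2)) := by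
  have hκ := h.kappa_nonneg
  have hδ0 : (1 : ℝ) ≤ δ := by exact_mod_cast hδ
  let φ : ℕ → ℝ := fun t => countAvg p t fun n => truncated p s a n (τ - t)
  have hstep : ∀ t ∈ Finset.range τ, φ (t + 1) - φ t ≤ 3 * κ * (p / δ + s * p / δ ^ 2) -
      ((p : ℝ) - 1) / p * countAvg p t fun n => T n (τ - t - 1) := by
    intro t ht
    rw [Finset.mem_range] at ht
    have hp0 : (p : ℝ) ≠ 0 := by positivity
    -- All values are measured from the state with n edges and τ − t − 1 sites: the next time adds
    -- an edge to it with probability 1/p, while the present time has one more site.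
    have e : φ (t + 1) - φ t = countAvg p t (fun n => tripleComb p
        (truncated p s a (n + 1) (τ - t - 1) - truncated p s a n (τ - t - 1))
        (truncated p s a n (τ - t) - truncated p s a n (τ - t - 1)) (T n (τ - t - 1))) -
        ((p : ℝ) - 1) / p * countAvg p t fun n => T n (τ - t - 1) := by
      simp only [φ]
      rw [countAvg_succ, ← countAvg_sub, ← countAvg_mul_left, ← countAvg_sub]
      congr 1
      ext n
      rw [show τ - (t + 1) = τ - t - 1 by omega]
      unfold tripleComb
      ring
    rw [e]
    have h1 := countAvg_mono hp t (h.truncated_step hp hδ hs ht)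
    rw [countAvg_mul_left, countAvg_add, countAvg_const] at h1
    have h2 : countAvg p t (fun n => ((p : ℝ) * n - t) ^ 2 / (δ : ℝ) ^ 2) ≤ s * p / δ ^ 2 := by
      have h3 := countAvg_sq_le (p := p) (s := s) hp t (by omega)
      have : (fun n : ℕ => ((p : ℝ) * n - t) ^ 2 / (δ : ℝ) ^ 2) =
          fun n : ℕ => ((δ : ℝ) ^ 2)⁻¹ * ((p : ℝ) * n - t) ^ 2 := by
        ext n; ring
      rw [this, countAvg_mul_left, div_eq_inv_mul]
      exact mul_le_mul_of_nonneg_left h3 (by positivity)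
    nlinarith
  have hsum := Finset.sum_le_sum hstep
  rw [Finset.sum_range_sub, Finset.sum_sub_distrib] at hsum
  simp only [Finset.sum_const, Finset.card_range, nsmul_eq_mul] at hsum
  have e0 : φ 0 = a 0 τ := by
    simp only [φ]
    rw [countAvg_zero]
    simp [truncated]
  have eτ : φ τ = countAvg p τ fun n => truncated p s a n 0 := by simp only [φ, Nat.sub_self]
  have hτs : (τ : ℝ) * (3 * κ * (p / δ + s * p / δ ^ 2)) ≤
      s * (3 * κ * (p / δ + s * p / δ ^ 2)) :=
    mul_le_mul_of_nonneg_right (by exact_mod_cast (by omega : τ ≤ s)) (by positivity)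
  rw [e0, eτ] at hsum
  unfold walkSum
  linarith

/-- The walk ends with n edges, where pn fluctuates around τ = s − 2δ. At most 2δ + |pn − τ| edges
are missing, each worth at most κ, and |x| ≤ δ + x²/δ reduces the fluctuation to the variance. -/
lemma WalkData.end_bound (h : WalkData p s κ a T) (hp : 1 ≤ p) {e δ τ : ℕ} (hδ : 1 ≤ δ)
    (hse : s = p * e) (hs : s = τ + 2 * δ) :
    a e 0 ≤ countAvg p τ (fun n => truncated p s a n 0) + κ * (3 * δ + s * p / δ) := by
  have hκ := h.kappa_nonneg
  have hδ0 : (1 : ℝ) ≤ δ := by exact_mod_cast hδ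
  have hp0 : (1 : ℝ) ≤ p := by exact_mod_cast hp
  have hpt : ∀ n : ℕ, a e 0 ≤ truncated p s a n 0 +
      κ * (3 * δ + (δ : ℝ)⁻¹ * ((p : ℝ) * n - τ) ^ 2) := by
    intro n
    have hdiv : (s - 0) / p = e := by
      rw [hse, Nat.sub_zero, Nat.mul_div_cancel_left _ (by omega)]
    unfold truncated
    rw [hdiv]
    obtain ⟨k, hk⟩ : ∃ k, e = min n e + k := ⟨e - min n e, by omega⟩
    have h1 := (abs_le.mp (h.abs_edge_sub_le (min n e) k (by rw [← hk, hse]))).2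
    rw [← hk] at h1
    have hyoung : ∀ x : ℝ, |x| ≤ δ + (δ : ℝ)⁻¹ * x ^ 2 := by
      intro x
      have h0 : 0 < (δ : ℝ)⁻¹ := by positivity
      have h2 : 0 ≤ (δ : ℝ)⁻¹ * (|x| - δ) ^ 2 := by positivity
      have h3 : (δ : ℝ)⁻¹ * (|x| - δ) ^ 2 = (δ : ℝ)⁻¹ * x ^ 2 - 2 * |x| + δ := by
        rw [sub_sq, sq_abs]; field_simp
      nlinarith [abs_nonneg x]
    have h4 : (k : ℝ) ≤ 2 * δ + |(p : ℝ) * n - τ| := by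
      rcases le_total e n with hen | hen
      · have : k = 0 := by rw [min_eq_right hen] at hk; omega
        rw [this]
        push_cast
        positivity
      · rw [min_eq_left hen] at hk
        have h5 : (k : ℝ) ≤ p * k := le_mul_of_one_le_left (by positivity) hp0
        have h6 : (p : ℝ) * n + p * k = τ + 2 * δ := by
          have : p * n + p * k = τ + 2 * δ := by rw [← hs, hse, hk]; ring
          exact_mod_cast this
        have := neg_abs_le ((p : ℝ) * n - τ)
        linarith
    have h7 := hyoung ((p : ℝ) * n - τ)
    have h8 : κ * k ≤ κ * (3 * δ + (δ : ℝ)⁻¹ * ((p : ℝ) * n - τ) ^ 2) :=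
      mul_le_mul_of_nonneg_left (by linarith) hκ
    linarith
  have hm := countAvg_mono hp τ hpt
  rw [countAvg_const, countAvg_add, countAvg_mul_left, countAvg_add, countAvg_const,
    countAvg_mul_left] at hm
  have h3 := countAvg_sq_le (p := p) (s := s) hp τ (by omega)
  have h4 : (δ : ℝ)⁻¹ * countAvg p τ (fun n => ((p : ℝ) * n - τ) ^ 2) ≤ s * p / δ := by
    rw [div_eq_inv_mul]
    exact mul_le_mul_of_nonneg_left h3 (by positivity)
  nlinarith

/-- The total error along the walk, per half-edge. -/
lemma WalkData.bound (h : WalkData p s κ a T) (hp : 1 ≤ p) {e δ : ℕ} (hδ : 1 ≤ δ)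
    (hse : s = p * e) (hs : 2 * δ ≤ s) :
    a e 0 ≤ a 0 s - walkSum p (s - 2 * δ) T +
      κ * s * (5 * (δ / s : ℝ) + 4 * p / δ + 3 * p * (s / δ ^ 2)) := by
  have hκ := h.kappa_nonneg
  have hτ : s = (s - 2 * δ) + 2 * δ := by omega
  have hs0 : (s : ℝ) ≠ 0 := by exact_mod_cast (by omega : s ≠ 0)
  have h1 := h.walk_bound hp hδ hτ
  have h2 := h.end_bound hp hδ hse hτ
  have h3 := (abs_le.mp (h.abs_site_sub_le (s - 2 * δ) (2 * δ) (by omega))).1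
  rw [← hτ] at h3
  push_cast at h3
  -- The terms are the cost 2δ of the sites held back at the start, the cost 3δ + sp/δ of the end,
  -- and the error of the walk.
  have h4 : κ * s * (5 * (δ / s : ℝ) + 4 * p / δ + 3 * p * (s / δ ^ 2)) =
      κ * (2 * δ) + (κ * (3 * δ + s * p / δ) + s * (3 * κ * (p / δ + s * p / δ ^ 2))) := by
    field_simp
    ring
  rw [h4]
  linarith

end Comparison

/-! ### The interpolation path -/

section Path

variable {P : Set ℕ} {N : ℕ} {d : Fin N → ℕ} {E : P →₀ ℕ} {rank : P → ℕ} {p : P}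

lemma card_free_matching {e s : P →₀ ℕ} {A : Finset P} (he : e.support ⊆ A) (hs : s.support ⊆ A)
    (m : Matching d e s) :
    Fintype.card (Free m) = ∑ i, d i - ∑ q ∈ A, ((q : ℕ) * e q + s q) := by
  rw [card_free, Fintype.card_sigma, Fintype.card_sum, Fintype.card_sigma, Fintype.card_sigma]
  simp only [Fintype.card_prod, Fintype.card_fin]
  rw [Finset.sum_coe_sort e.support (fun q => e q * (q : ℕ)),
    Finset.sum_coe_sort s.support (fun q => s q), Finset.sum_add_distrib,
    Finset.sum_subset he, Finset.sum_subset hs]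
  · simp only [mul_comm]
  · intro q _ hq; exact Finsupp.notMem_support_iff.mp hq
  · intro q _ hq; rw [Finsupp.notMem_support_iff.mp hq, zero_mul]

lemma bigSizes_subset : bigSizes E ⊆ E.support := Finset.filter_subset _ _

lemma startEdges_apply (q : P) : startEdges E q = if q ∈ bigSizes E then 0 else E q := by
  unfold startEdges
  by_cases hq : q ∈ E.support
  · rw [Finsupp.indicator_of_mem hq]
  · rw [Finsupp.indicator_of_notMem hq, if_neg fun h => hq (bigSizes_subset h),
      Finsupp.notMem_support_iff.mp hq]

lemma startSites_apply (q : P) : startSites E q = if q ∈ bigSizes E then (q : ℕ) * E q else 0 := by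
  unfold startSites
  by_cases hq : q ∈ E.support
  · rw [Finsupp.indicator_of_mem hq]
  · rw [Finsupp.indicator_of_notMem hq, if_neg fun h => hq (bigSizes_subset h)]

lemma pathEdges_apply {q : P} (hq : q ∈ E.support) (n : ℕ) :
    pathEdges E rank p n q =
      if rank q < rank p then E q else if q = p then n else startEdges E q := by
  unfold pathEdges
  rw [Finsupp.indicator_of_mem hq]

lemma pathSites_apply {q : P} (hq : q ∈ E.support) (n : ℕ) :
    pathSites E rank p n q =
      if rank q < rank p then 0 else if q = p then n else startSites E q := by
  unfold pathSites
  rw [Finsupp.indicator_of_mem hq]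

lemma isSuccAt_pathEdges (hp : p ∈ E.support) (n : ℕ) :
    IsSuccAt p (pathEdges E rank p n) (pathEdges E rank p (n + 1)) where
  at_self := by simp [pathEdges_apply hp]
  at_ne q hq := by
    by_cases hqE : q ∈ E.support
    · simp [pathEdges_apply hqE, hq]
    · unfold pathEdges
      rw [Finsupp.indicator_of_notMem hqE, Finsupp.indicator_of_notMem hqE]

lemma isSuccAt_pathSites (hp : p ∈ E.support) (n : ℕ) :
    IsSuccAt p (pathSites E rank p n) (pathSites E rank p (n + 1)) where
  at_self := by simp [pathSites_apply hp]
  at_ne q hq := by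
    by_cases hqE : q ∈ E.support
    · simp [pathSites_apply hqE, hq]
    · unfold pathSites
      rw [Finsupp.indicator_of_notMem hqE, Finsupp.indicator_of_notMem hqE]

/-- Every size q ≠ p uses exactly q E_q half-edges, as hyperedges or as sites, whether or not it has
been treated. The term p E_p is moved to the left to avoid truncated subtraction. -/
lemma sum_path (hp : p ∈ E.support) (n m : ℕ) :
    ∑ q ∈ E.support, ((q : ℕ) * pathEdges E rank p n q + pathSites E rank p m q) + p * E p =
      ∑ q ∈ E.support, (q : ℕ) * E q + (p * n + m) := by
  classical
  rw [← Finset.add_sum_erase _ _ hp, ← Finset.add_sum_erase _ (fun q : P => (q : ℕ) * E q) hp,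
    pathEdges_apply hp, pathSites_apply hp]
  have : ∑ q ∈ E.support.erase p,
      ((q : ℕ) * pathEdges E rank p n q + pathSites E rank p m q) =
      ∑ q ∈ E.support.erase p, (q : ℕ) * E q := by
    refine Finset.sum_congr rfl fun q hq => ?_
    obtain ⟨hqp, hqE⟩ := Finset.mem_erase.mp hq
    rw [pathEdges_apply hqE, pathSites_apply hqE, startEdges_apply, startSites_apply]
    split_ifs <;> simp
  rw [this]
  simp only [lt_irrefl, if_false, if_true]
  ring

/-- The degrees add up to the half-edges of the full hypergraph, so what is free is exactly what the
current size does not use. -/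
lemma card_free_path (hp : p ∈ E.support) (hdE : ∑ i, d i = ∑ q ∈ E.support, (q : ℕ) * E q)
    (n m : ℕ) (x : Matching d (pathEdges E rank p n) (pathSites E rank p m)) :
    Fintype.card (Free x) = p * E p - p * n - m := by
  have h : Fintype.card (Free x) = ∑ i, d i -
      ∑ q ∈ E.support, ((q : ℕ) * pathEdges E rank p n q + pathSites E rank p m q) :=
    card_free_matching
      (Finsupp.support_indicator_subset _ _) (Finsupp.support_indicator_subset _ _) x
  have := sum_path (rank := rank) hp n m
  rw [hdE] at h
  omega

variable {Γ : Type*} [Countable Γ] (L : Laws P Γ) {κ : ℝ}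

/-- The free energies along the walk for the size `p`. -/
def pathFree (d : Fin N → ℕ) (E : P →₀ ℕ) (rank : P → ℕ) (p : P) (n m : ℕ) : ℝ :=
  logZ L d (pathEdges E rank p n) (pathSites E rank p m)

/-- The cavity terms along the walk for the size `p`. -/
def pathCavity (d : Fin N → ℕ) (E : P →₀ ℕ) (rank : P → ℕ) (p : P) (n m : ℕ) : ℝ :=
  matchAvg d (pathEdges E rank p n) (pathSites E rank p m) fun x => cavityGain L p x

lemma walkData_path (hgood : ∀ᵐ ω ∂L.disorder, Disorder.Good κ ω)
    (hθκ : ∀ p : P, ∀ᵐ θ ∂(L.θ p : Measure (EdgeFun p)), ∀ σ, |θ σ| ≤ κ) (hκ : 0 ≤ κ)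
    (hp1 : 1 ≤ (p : ℕ)) (hfac : Factorizes p (L.θ p)) (hp : p ∈ E.support)
    (hdE : ∑ i, d i = ∑ q ∈ E.support, (q : ℕ) * E q) :
    WalkData p (p * E p) κ (pathFree L d E rank p) (pathCavity L d E rank p) where
  edge n m h := by
    unfold pathFree
    rw [logZ_addEdge_sub L hgood hθκ (isSuccAt_pathEdges hp n) fun x => by
      rw [card_free_path hp hdE]; omega]
    exact abs_unifAvg_le hκ fun x => abs_unifAvg_le hκ fun i => abs_edgeGain_le L hgood hθκ x i
  site n m h := by
    unfold pathFree
    rw [logZ_addSite_sub L hgood hθκ (isSuccAt_pathSites hp m) fun x => by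
      rw [card_free_path hp hdE]; omega]
    exact abs_unifAvg_le hκ fun x => abs_unifAvg_le hκ fun i => abs_siteGain_le L hgood hθκ x i
  cavity n m := by
    unfold pathCavity
    rw [matchAvg_eq_unifAvg]
    exact abs_unifAvg_le hκ fun x => abs_cavityGain_le L hgood hθκ x
  step n m h := by
    have := tripleComb_logZ_le L hgood hθκ hκ hp1 hfac (isSuccAt_pathEdges (rank := rank) hp n)
      (isSuccAt_pathSites (rank := rank) hp m) (d := d) (M := p * E p - p * n - m)
      (card_free_path hp hdE n m) (by omega)
    rw [Nat.cast_sub (by omega), Nat.cast_sub (by omega)] at this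
    push_cast at this ⊢
    exact this

/-- Numbers of hyperedges when the sizes of rank smaller than `k` have been treated. -/
def stageEdges (E : P →₀ ℕ) (rank : P → ℕ) (k : ℕ) : P →₀ ℕ :=
  Finsupp.indicator E.support fun q _ => if rank q < k then E q else startEdges E q

/-- Numbers of sites when the sizes of rank smaller than `k` have been treated. -/
def stageSites (E : P →₀ ℕ) (rank : P → ℕ) (k : ℕ) : P →₀ ℕ :=
  Finsupp.indicator E.support fun q _ => if rank q < k then 0 else startSites E q

lemma indicator_congr {A : Finset P} {f g : ∀ q ∈ A, ℕ} (h : ∀ q hq, f q hq = g q hq) :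
    Finsupp.indicator A f = Finsupp.indicator A g := by
  congr 1
  ext q hq
  exact h q hq

lemma stageEdges_zero : stageEdges E rank 0 = startEdges E := by
  ext q
  unfold stageEdges
  by_cases hq : q ∈ E.support
  · rw [Finsupp.indicator_of_mem hq]; simp
  · rw [Finsupp.indicator_of_notMem hq, startEdges_apply, Finsupp.notMem_support_iff.mp hq,
      ite_self]

lemma stageSites_zero : stageSites E rank 0 = startSites E := by
  ext q
  unfold stageSites
  by_cases hq : q ∈ E.support
  · rw [Finsupp.indicator_of_mem hq]; simp
  · rw [Finsupp.indicator_of_notMem hq, startSites_apply, Finsupp.notMem_support_iff.mp hq,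
      mul_zero, ite_self]

lemma stageEdges_top {k : ℕ} (hk : ∀ q ∈ E.support, rank q < k) : stageEdges E rank k = E := by
  ext q
  unfold stageEdges
  by_cases hq : q ∈ E.support
  · rw [Finsupp.indicator_of_mem hq, if_pos (hk q hq)]
  · rw [Finsupp.indicator_of_notMem hq, Finsupp.notMem_support_iff.mp hq]

lemma stageSites_top {k : ℕ} (hk : ∀ q ∈ E.support, rank q < k) : stageSites E rank k = 0 := by
  ext q
  unfold stageSites
  by_cases hq : q ∈ E.support
  · rw [Finsupp.indicator_of_mem hq, if_pos (hk q hq)]; rfl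
  · rw [Finsupp.indicator_of_notMem hq]; rfl

lemma pathFree_start (hp : p ∈ bigSizes E) : pathFree L d E rank p 0 (p * E p) =
    logZ L d (stageEdges E rank (rank p)) (stageSites E rank (rank p)) := by
  unfold pathFree
  congr 1
  · refine indicator_congr fun q _ => ?_
    by_cases hq : q = p
    · subst hq; simp [startEdges_apply, hp]
    · simp [hq]
  · refine indicator_congr fun q _ => ?_
    by_cases hq : q = p
    · subst hq; simp [startSites_apply, hp]
    · simp [hq]

/-- Injectivity of the rank is needed: the sizes of rank at most that of p are those of smaller rank
together with p itself. -/
lemma pathFree_end (hrank : Set.InjOn rank (E.support : Set P)) (hp : p ∈ E.support) :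
    pathFree L d E rank p (E p) 0 =
      logZ L d (stageEdges E rank (rank p + 1)) (stageSites E rank (rank p + 1)) := by
  unfold pathFree
  congr 1
  · refine indicator_congr fun q hqE => ?_
    by_cases hq : q = p
    · subst hq; simp
    · have : rank q ≠ rank p := fun h => hq (hrank hqE hp h)
      simp only [hq, if_false]
      congr 1
      exact propext ⟨fun h => by omega, fun h => by omega⟩
  · refine indicator_congr fun q hqE => ?_
    by_cases hq : q = p
    · subst hq; simp
    · have : rank q ≠ rank p := fun h => hq (hrank hqE hp h)
      simp only [hq, if_false]
      congr 1
      exact propext ⟨fun h => by omega, fun h => by omega⟩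

/-- Sizes outside `bigSizes E` have all their hyperedges and no sites from the start, so treating
them changes nothing. -/
lemma stage_succ_of_forall_ne {k : ℕ} (hk : ∀ q ∈ bigSizes E, rank q ≠ k) :
    logZ L d (stageEdges E rank (k + 1)) (stageSites E rank (k + 1)) =
      logZ L d (stageEdges E rank k) (stageSites E rank k) := by
  congr 1
  · refine indicator_congr fun q hqE => ?_
    by_cases hq : q ∈ bigSizes E
    · have := hk q hq
      congr 1
      exact propext ⟨fun h => by omega, fun h => by omega⟩
    · simp [startEdges_apply, hq]
  · refine indicator_congr fun q hqE => ?_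
    by_cases hq : q ∈ bigSizes E
    · have := hk q hq
      congr 1
      exact propext ⟨fun h => by omega, fun h => by omega⟩
    · simp [startSites_apply, hq]

/-- The changes of the free energy along the walks for the different sizes add up. -/
lemma sum_pathFree_sub (hrank : Set.InjOn rank (E.support : Set P)) :
    ∑ p ∈ bigSizes E, (pathFree L d E rank p (E p) 0 - pathFree L d E rank p 0 (p * E p)) =
      logZ L d E 0 - logZ L d (startEdges E) (startSites E) := by
  classical
  set k := E.support.sup rank + 1 with hk
  have hlt : ∀ q ∈ E.support, rank q < k := fun q hq =>
    Nat.lt_succ_of_le (Finset.le_sup (f := rank) hq)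
  let φ : ℕ → ℝ := fun j => logZ L d (stageEdges E rank j) (stageSites E rank j)
  have htel := Finset.sum_range_sub φ k
  have e0 : φ 0 = logZ L d (startEdges E) (startSites E) := by
    simp only [φ, stageEdges_zero, stageSites_zero]
  have ek : φ k = logZ L d E 0 := by
    simp only [φ, stageEdges_top hlt, stageSites_top hlt]
  -- The ranks need not be consecutive nor all belong to `bigSizes E`, so the sizes are grouped by
  -- rank and unused ranks contribute 0.
  rw [← ek, ← e0, ← htel, ← Finset.sum_fiberwise_of_maps_to (s := bigSizes E)
    (t := Finset.range k) (g := rank)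
    fun q hq => Finset.mem_range.mpr (hlt q (bigSizes_subset hq))]
  refine Finset.sum_congr rfl fun j _ => ?_
  by_cases hj : ∃ p ∈ bigSizes E, rank p = j
  · obtain ⟨p, hp, rfl⟩ := hj
    have : (bigSizes E).filter (fun q => rank q = rank p) = {p} := by
      ext q
      simp only [Finset.mem_filter, Finset.mem_singleton]
      constructor
      · rintro ⟨hq, hqp⟩
        exact hrank (bigSizes_subset hq) (bigSizes_subset hp) hqp
      · rintro rfl
        exact ⟨hp, rfl⟩
    rw [this, Finset.sum_singleton, pathFree_start L hp,
      pathFree_end L hrank (bigSizes_subset hp)]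
  · push Not at hj
    rw [Finset.filter_eq_empty_iff.mpr fun q hq => hj q hq, Finset.sum_empty]
    exact (sub_eq_zero.mpr (stage_succ_of_forall_ne L hj)).symm

lemma weightedFreeEnergy_eq (e s : P →₀ ℕ) :
    weightedFreeEnergy L d e s = (N : ℝ)⁻¹ * logZ L d e s := rfl

/-- Without sites the energy does not depend on γ and the weights sum to one. -/
lemma freeEnergy_eq (hgood : ∀ᵐ ω ∂L.disorder, Disorder.Good κ ω) :
    freeEnergy L d E = (N : ℝ)⁻¹ * logZ L d E 0 := by
  unfold freeEnergy logZ
  congr 2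
  ext m
  refine integral_congr_ae ?_
  filter_upwards [hgood] with ω hω
  have h1 : ∀ γ σ, siteEnergy ω m γ σ = 0 := fun γ σ => by simp [siteEnergy]
  unfold partitionFun gibbsWeight
  simp only [h1, add_zero, ← Finset.mul_sum]
  rw [tsum_mul_right, hω.weight_sum.tsum_eq, one_mul]

end Path

/-! ### Asymptotics -/

section Rates

/-- The number `⌈√(s log s)⌉`. -/
def sqrtGap (s : ℕ) : ℕ := ⌈Real.sqrt ((s : ℝ) * Real.log (s : ℝ))⌉₊

lemma tendsto_sqrtGap_atTop : Tendsto (fun s => (sqrtGap s : ℝ)) atTop atTop := by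
  refine tendsto_atTop_mono (fun s => Nat.le_ceil _) (Real.tendsto_sqrt_atTop.comp ?_)
  exact tendsto_natCast_atTop_atTop.atTop_mul_atTop₀
    (Real.tendsto_log_atTop.comp tendsto_natCast_atTop_atTop)

lemma tendsto_sqrtGap_div : Tendsto (fun s : ℕ => (sqrtGap s : ℝ) / s) atTop (𝓝 0) := by
  have h1 : Tendsto (fun s : ℕ => Real.log (s : ℝ) / (s : ℝ)) atTop (𝓝 0) :=
    Real.isLittleO_log_id_atTop.tendsto_div_nhds_zero.comp tendsto_natCast_atTop_atTop
  have h2 : Tendsto (fun s : ℕ => Real.sqrt (Real.log (s : ℝ) / (s : ℝ)) + 1 / (s : ℝ))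
      atTop (𝓝 0) := by
    have := ((Real.continuous_sqrt.tendsto 0).comp h1).add tendsto_one_div_atTop_nhds_zero_nat
    simpa using this
  refine squeeze_zero' (Eventually.of_forall fun s => by positivity) ?_ h2
  filter_upwards [eventually_ge_atTop 1] with s hs
  have hs0 : (0 : ℝ) < s := by exact_mod_cast hs
  have h3 : (sqrtGap s : ℝ) ≤ Real.sqrt ((s : ℝ) * Real.log (s : ℝ)) + 1 :=
    (Nat.ceil_lt_add_one (Real.sqrt_nonneg _)).le
  have h4 : Real.sqrt ((s : ℝ) * Real.log (s : ℝ)) = Real.sqrt (Real.log s / s) * s := by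
    rw [show (s : ℝ) * Real.log s = Real.log s / s * (s : ℝ) ^ 2 by field_simp,
      Real.sqrt_mul' _ (by positivity), Real.sqrt_sq hs0.le]
  rw [h4] at h3
  rw [div_le_iff₀ hs0, add_mul, one_div, inv_mul_cancel₀ hs0.ne']
  exact h3

/-- The ratio is at most 1/log s: the logarithm in δ is what makes Chebyshev's bound vanish. -/
lemma tendsto_div_sqrtGap_sq :
    Tendsto (fun s : ℕ => (s : ℝ) / (sqrtGap s : ℝ) ^ 2) atTop (𝓝 0) := by
  have hlog : Tendsto (fun s : ℕ => Real.log (s : ℝ)) atTop atTop :=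
    Real.tendsto_log_atTop.comp tendsto_natCast_atTop_atTop
  refine squeeze_zero' (Eventually.of_forall fun s => by positivity) ?_ hlog.inv_tendsto_atTop
  filter_upwards [eventually_ge_atTop 2] with s hs
  have hs0 : (0 : ℝ) < s := by exact_mod_cast (by omega : 0 < s)
  have hl : 0 < Real.log (s : ℝ) := Real.log_pos (by exact_mod_cast hs)
  have h1 : (s : ℝ) * Real.log s ≤ (sqrtGap s : ℝ) ^ 2 := by
    rw [← Real.sq_sqrt (by positivity : 0 ≤ (s : ℝ) * Real.log s)]
    exact pow_le_pow_left₀ (Real.sqrt_nonneg _) (Nat.le_ceil _) 2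
  have h2 : 0 < (s : ℝ) * Real.log s := by positivity
  simp only [Pi.inv_apply]
  rw [div_le_iff₀ (h2.trans_le h1), ← div_eq_inv_mul, le_div_iff₀ hl]
  exact h1

/-- For fixed p the relative error of `WalkData.bound` is eventually below η; the threshold depends
on p. -/
lemma eventually_sqrtGap (p : ℕ) {η : ℝ} (hη : 0 < η) :
    ∀ᶠ s : ℕ in atTop, 1 ≤ sqrtGap s ∧ 2 * sqrtGap s ≤ s ∧
      5 * ((sqrtGap s : ℝ) / s) + 4 * p / (sqrtGap s : ℝ) +
        3 * p * ((s : ℝ) / (sqrtGap s : ℝ) ^ 2) ≤ η := by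
  have h : Tendsto (fun s : ℕ => 5 * ((sqrtGap s : ℝ) / s) + 4 * p / (sqrtGap s : ℝ) +
      3 * p * ((s : ℝ) / (sqrtGap s : ℝ) ^ 2)) atTop (𝓝 0) := by
    have := ((tendsto_sqrtGap_div.const_mul 5).add
      (tendsto_sqrtGap_atTop.const_div_atTop (4 * (p : ℝ)))).add
      (tendsto_div_sqrtGap_sq.const_mul (3 * (p : ℝ)))
    simpa using this
  filter_upwards [tendsto_sqrtGap_atTop.eventually_ge_atTop 1,
    tendsto_sqrtGap_div.eventually_le_const (by norm_num : (0 : ℝ) < 1 / 2),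
    h.eventually_le_const hη, eventually_ge_atTop 1] with s h1 h2 h3 h4
  refine ⟨by exact_mod_cast h1, ?_, h3⟩
  rw [div_le_iff₀ (by exact_mod_cast h4)] at h2
  exact_mod_cast (by linarith : 2 * (sqrtGap s : ℝ) ≤ s)

end Rates

/-! ### Sizes with few half-edges are negligible -/

section Tightness

variable {P : Set ℕ}

/-- The sizes of which there are boundedly many half-edges carry a vanishing proportion of the
half-edges. -/
lemma eventually_sum_small_le (hP : ∀ p ∈ P, 1 ≤ p) {E : ℕ → P →₀ ℕ} {ν : PMF P} {C : ℝ}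
    (hC : 0 < C) (hE : ∀ N : ℕ, 1 ≤ N → ∑ p ∈ (E N).support, ((p : ℕ) : ℝ) * E N p ≤ C * N)
    (hν : Tendsto (fun N : ℕ => ∑' p : P,
      ((p : ℕ) : ℝ) * |(E N p : ℝ) / (∑ q ∈ (E N).support, (E N q : ℝ)) - (ν p).toReal|)
      atTop (𝓝 0))
    (hν1 : Summable fun p : P => ((p : ℕ) : ℝ) * (ν p).toReal)
    (S : P → ℕ) {η : ℝ} (hη : 0 < η) :
    ∀ᶠ N : ℕ in atTop, ∀ B ⊆ (E N).support, (∀ p ∈ B, (p : ℕ) * E N p < S p) →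
      ∑ p ∈ B, ((p : ℕ) : ℝ) * E N p ≤ η * N := by
  classical
  set η' : ℝ := η / (3 * C) with hη'
  have hη'0 : 0 < η' := by positivity
  -- Outside the finite set A the first moment of ν is below η'. Inside A the small sizes have at
  -- most a fixed number of half-edges, which is o(N).
  obtain ⟨A, hA⟩ := summable_iff_vanishing_norm.mp hν1 η' hη'0
  have hlarge : ∀ᶠ N : ℕ in atTop, (∑ p ∈ A, (S p : ℝ)) ≤ η / 3 * N :=
    (tendsto_natCast_atTop_atTop.const_mul_atTop (by positivity : 0 < η / 3)).eventually_ge_atTop _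
  filter_upwards [hlarge, hν.eventually_le_const hη'0, eventually_ge_atTop 1] with N h1 h2 h3 B hB hS
  set T : ℝ := ∑ q ∈ (E N).support, (E N q : ℝ) with hT
  have hp1 : ∀ p : P, (1 : ℝ) ≤ (p : ℕ) := fun p => by exact_mod_cast hP p p.2
  have hTC : T ≤ C * N := le_trans
    (Finset.sum_le_sum fun p _ => le_mul_of_one_le_left (by positivity) (hp1 p)) (hE N h3)
  have hT0 : 0 ≤ T := Finset.sum_nonneg fun _ _ => by positivity
  have hsum : Summable fun p : P => ((p : ℕ) : ℝ) * |(E N p : ℝ) / T - (ν p).toReal| := by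
    have hfin : Summable fun p : P => ((p : ℕ) : ℝ) * ((E N p : ℝ) / T) := by
      refine summable_of_ne_finset_zero (s := (E N).support) fun p hp => ?_
      simp [Finsupp.notMem_support_iff.mp hp]
    refine (hfin.add hν1).of_nonneg_of_le (fun p => by positivity) fun p => ?_
    rw [← mul_add]
    refine mul_le_mul_of_nonneg_left ?_ (by positivity)
    refine (abs_sub _ _).trans_eq ?_
    rw [abs_of_nonneg (by positivity), abs_of_nonneg ENNReal.toReal_nonneg]
  have hin : ∑ p ∈ B ∩ A, ((p : ℕ) : ℝ) * E N p ≤ η / 3 * N := by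
    refine le_trans ?_ h1
    refine le_trans (Finset.sum_le_sum fun p hp => ?_)
      (Finset.sum_le_sum_of_subset_of_nonneg (Finset.inter_subset_right (s₁ := B))
        fun p _ _ => by positivity)
    exact_mod_cast (hS p (Finset.mem_inter.mp hp).1).le
  have hout : ∑ p ∈ B \ A, ((p : ℕ) : ℝ) * E N p ≤ 2 * η / 3 * N := by
    -- Outside A, E_p/T is at most ν(p) plus its distance to ν(p); the two weighted sums are each at
    -- most η', and T ≤ CN.
    have e1 : ∀ p ∈ B \ A, ((p : ℕ) : ℝ) * E N p ≤
        T * (((p : ℕ) : ℝ) * (ν p).toReal + ((p : ℕ) : ℝ) * |(E N p : ℝ) / T - (ν p).toReal|) := by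
      intro p hp
      have hpE := hB (Finset.mem_sdiff.mp hp).1
      have hEp : (0 : ℝ) < E N p := by
        exact_mod_cast Nat.pos_of_ne_zero (Finsupp.mem_support_iff.mp hpE)
      have hTp : 0 < T := hEp.trans_le
        (Finset.single_le_sum (f := fun q => (E N q : ℝ)) (fun _ _ => by positivity) hpE)
      rw [← mul_add, mul_left_comm]
      refine mul_le_mul_of_nonneg_left ?_ (by positivity)
      rw [← div_le_iff₀' hTp]
      linarith [le_abs_self ((E N p : ℝ) / T - (ν p).toReal)]
    refine (Finset.sum_le_sum e1).trans ?_
    rw [← Finset.mul_sum, Finset.sum_add_distrib]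
    have e2 := (abs_lt.mp (hA (B \ A) Finset.sdiff_disjoint)).2
    have e3 := (hsum.sum_le_tsum (B \ A) fun p _ => by positivity).trans h2
    calc T * _ ≤ T * (η' + η') := mul_le_mul_of_nonneg_left (by linarith) hT0
      _ ≤ (C * N) * (η' + η') := mul_le_mul_of_nonneg_right hTC (by positivity)
      _ = 2 * η / 3 * N := by rw [hη']; field_simp; ring
  rw [← Finset.sum_inter_add_sum_sdiff B A]
  linarith

end Tightness

/-! ### The error along the walk for one size -/

section Defect

variable {P : Set ℕ} {N : ℕ} {Γ : Type*} [Countable Γ] (L : Laws P Γ) {κ : ℝ}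
  {d : Fin N → ℕ} {E : P →₀ ℕ} {rank : P → ℕ} {p : P}

/-- The error of the interpolation bound along the walk for the size `p`. -/
def pathDefect (d : Fin N → ℕ) (E : P →₀ ℕ) (rank : P → ℕ) (p : P) : ℝ :=
  pathFree L d E rank p (E p) 0 - pathFree L d E rank p 0 (p * E p) +
    walkSum p (steps E p) (pathCavity L d E rank p)

lemma pathDefect_le_trivial
    (h : WalkData p (p * E p) κ (pathFree L d E rank p) (pathCavity L d E rank p))
    (hp : 1 ≤ (p : ℕ)) : pathDefect L d E rank p ≤ 3 * κ * (((p : ℕ) : ℝ) * E p) := by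
  have := h.trivial_bound hp rfl (Nat.sub_le (p * E p) (2 * gap E p))
  rw [Nat.cast_mul] at this
  unfold pathDefect steps
  linarith

lemma pathDefect_le
    (h : WalkData p (p * E p) κ (pathFree L d E rank p) (pathCavity L d E rank p))
    (hp : 1 ≤ (p : ℕ)) {η : ℝ} (hs : 1 ≤ sqrtGap (p * E p) ∧ 2 * sqrtGap (p * E p) ≤ p * E p ∧
      5 * ((sqrtGap (p * E p) : ℝ) / (p * E p : ℕ)) + 4 * (p : ℕ) / (sqrtGap (p * E p) : ℝ) +
        3 * (p : ℕ) * (((p * E p : ℕ) : ℝ) / (sqrtGap (p * E p) : ℝ) ^ 2) ≤ η) :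
    pathDefect L d E rank p ≤ κ * η * (((p : ℕ) : ℝ) * E p) := by
  obtain ⟨h1, h2, h3⟩ := hs
  have hb := h.bound hp h1 rfl h2
  have h4 := mul_le_mul_of_nonneg_left h3
    (mul_nonneg h.kappa_nonneg (Nat.cast_nonneg (α := ℝ) (p * E p)))
  have h5 : pathDefect L d E rank p ≤ κ * ((p * E p : ℕ) : ℝ) * η := by
    have : steps E p = p * E p - 2 * sqrtGap (p * E p) := rfl
    unfold pathDefect
    rw [this]
    linarith
  rw [Nat.cast_mul] at h5
  linarith

/-- An exact identity, with all the error collected in the defects; `pathTerm` is by definition the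
walk average of the cavity terms. -/
lemma freeEnergy_eq_add_sum_pathDefect (hgood : ∀ᵐ ω ∂L.disorder, Disorder.Good κ ω)
    (hrank : Set.InjOn rank (E.support : Set P)) :
    freeEnergy L d E = weightedFreeEnergy L d (startEdges E) (startSites E) -
      (1 / (N : ℝ)) * ∑ p ∈ bigSizes E, ∑ t ∈ Finset.range (steps E p),
        (((p : ℕ) : ℝ) - 1) / ((p : ℕ) : ℝ) * pathTerm L d E rank p t +
      (N : ℝ)⁻¹ * ∑ p ∈ bigSizes E, pathDefect L d E rank p := by
  have h : ∑ p ∈ bigSizes E, pathDefect L d E rank p =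
      logZ L d E 0 - logZ L d (startEdges E) (startSites E) +
        ∑ p ∈ bigSizes E, ∑ t ∈ Finset.range (steps E p),
          (((p : ℕ) : ℝ) - 1) / ((p : ℕ) : ℝ) * pathTerm L d E rank p t := by
    rw [← sum_pathFree_sub L hrank, ← Finset.sum_add_distrib]
    rfl
  rw [h, freeEnergy_eq L hgood, weightedFreeEnergy_eq]
  ring

end Defect

end

end Diluted

/-! ### The general bound -/

theorem theorem4 {P : Set ℕ} (hP : ∀ p ∈ P, 2 ≤ p) {Γ : Type*} [Countable Γ]
    (L : Diluted.Laws P Γ)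
    -- assumptions on the random functions `θ_p` and `h`
    (hθ : ∀ p : P, Diluted.Factorizes p (L.θ p))
    (κ : ℝ) (hκ : 0 < κ)
    (hθκ : ∀ p : P, ∀ᵐ θ ∂(L.θ p : Measure (Diluted.EdgeFun p)), ∀ σ, |θ σ| ≤ κ)
    (hhκ : ∀ᵐ g ∂(L.h : Measure (Diluted.Spin → ℝ)), ∀ s, |g s| ≤ κ)
    -- the weights are nonnegative and sum to one
    (hv : ∀ᵐ v ∂(L.v : Measure (Γ → ℝ)), (∀ γ, 0 ≤ v γ) ∧ HasSum v 1)
    -- degrees, numbers of hyperedges, and their limiting distributions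
    (d : (N : ℕ) → Fin N → ℕ) (E : ℕ → P →₀ ℕ) (μ : PMF ℕ) (ν : PMF P)
    (hdE : ∀ N, ∑ i, d N i = ∑ p ∈ (E N).support, (p : ℕ) * E N p)
    (hμ : Tendsto (fun N : ℕ => ∑' k : ℕ,
      (k : ℝ) * |((Finset.univ.filter fun i => d N i = k).card : ℝ) / N - (μ k).toReal|)
      atTop (𝓝 0))
    (hν : Tendsto (fun N : ℕ => ∑' p : P,
      ((p : ℕ) : ℝ) * |(E N p : ℝ) / (∑ q ∈ (E N).support, (E N q : ℝ)) - (ν p).toReal|)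
      atTop (𝓝 0))
    (hd2 : ∃ C : ℝ, ∀ N : ℕ, 1 ≤ N → (∑ i, (d N i : ℝ) ^ 2) / N ≤ C)
    (hμ2 : Summable fun k : ℕ => (k : ℝ) ^ 2 * (μ k).toReal)
    (hν1 : Summable fun p : P => ((p : ℕ) : ℝ) * (ν p).toReal)
    -- for each `N`, an enumeration of the sizes of the hyperedges that appear
    (rank : ℕ → P → ℕ) (hrank : ∀ N, Set.InjOn (rank N) ((E N).support : Set P)) :
    ∃ o : ℕ → ℝ, Tendsto o atTop (𝓝 0) ∧ ∀ N : ℕ, 1 ≤ N →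
      Diluted.freeEnergy L (d N) (E N) ≤
        Diluted.weightedFreeEnergy L (d N) (Diluted.startEdges (E N)) (Diluted.startSites (E N))
        - (1 / (N : ℝ)) * ∑ p ∈ Diluted.bigSizes (E N),
            ∑ t ∈ Finset.range (Diluted.steps (E N) p),
              (((p : ℕ) : ℝ) - 1) / ((p : ℕ) : ℝ) *
                Diluted.pathTerm L (d N) (E N) (rank N) p t
        + o N := by
  have hP1 : ∀ p ∈ P, 1 ≤ p := fun p hp => le_trans one_le_two (hP p hp)
  have hgood := Diluted.ae_good L hθκ hhκ hv
  obtain ⟨C, hC⟩ := hd2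
  have hE : ∀ N : ℕ, 1 ≤ N →
      ∑ p ∈ (E N).support, ((p : ℕ) : ℝ) * E N p ≤ (|C| + 1) * N := by
    intro N hN
    have hN0 : (0 : ℝ) < N := by exact_mod_cast hN
    have h1 : ∑ p ∈ (E N).support, ((p : ℕ) : ℝ) * E N p = ∑ i, (d N i : ℝ) := by
      exact_mod_cast (hdE N).symm
    -- Degrees are integers, so the second moment controls the total number of half-edges.
    have h2 : ∑ i, (d N i : ℝ) ≤ ∑ i, (d N i : ℝ) ^ 2 :=
      Finset.sum_le_sum fun i _ => by exact_mod_cast Nat.le_self_pow two_ne_zero (d N i)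
    have h3 := (div_le_iff₀ hN0).mp (hC N hN)
    rw [h1]
    refine h2.trans (h3.trans (mul_le_mul_of_nonneg_right ?_ hN0.le))
    linarith [le_abs_self C]
  have hC0 : 0 < |C| + 1 := by positivity
  have hwalk : ∀ N, ∀ p ∈ Diluted.bigSizes (E N), Diluted.WalkData p (p * E N p) κ
      (Diluted.pathFree L (d N) (E N) (rank N) p) (Diluted.pathCavity L (d N) (E N) (rank N) p) :=
    fun N p hp => Diluted.walkData_path L hgood hθκ hκ.le (hP1 p p.2) (hθ p)
      (Diluted.bigSizes_subset hp) (hdE N)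
  set D : ℕ → ℝ := fun N =>
    (N : ℝ)⁻¹ * ∑ p ∈ Diluted.bigSizes (E N), Diluted.pathDefect L (d N) (E N) (rank N) p with hD
  -- Only upper bounds for the defects are available, so the positive part is used as error.
  refine ⟨fun N => max 0 (D N), ?_, fun N _ => ?_⟩
  · refine (tendsto_order.mpr ⟨fun a ha => Eventually.of_forall fun N => ha.trans_le
      (le_max_left _ _), fun ε hε => ?_⟩)
    -- Sizes with few half-edges contribute at most 3κη and the others κη(|C| + 1), which add up to
    -- ε/2.
    set η : ℝ := ε / 2 / (3 * κ + κ * (|C| + 1)) with hη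
    have hη0 : 0 < η := by positivity
    choose S hS using fun p : P => eventually_atTop.mp (Diluted.eventually_sqrtGap p hη0)
    filter_upwards [Diluted.eventually_sum_small_le hP1 hC0 hE hν hν1 S hη0,
      eventually_ge_atTop 1] with N hN hN1
    have hN0 : (0 : ℝ) < N := by exact_mod_cast hN1
    refine max_lt hε (lt_of_le_of_lt ?_ (half_lt_self hε))
    have hsmall : ∑ p ∈ (Diluted.bigSizes (E N)).filter fun p : P => (p : ℕ) * E N p < S p,
        Diluted.pathDefect L (d N) (E N) (rank N) p ≤ 3 * κ * (η * N) := by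
      refine (Finset.sum_le_sum fun p hp => Diluted.pathDefect_le_trivial L
        (hwalk N p (Finset.mem_filter.mp hp).1) (hP1 p p.2)).trans ?_
      rw [← Finset.mul_sum]
      exact mul_le_mul_of_nonneg_left (hN _ ((Finset.filter_subset _ _).trans
        Diluted.bigSizes_subset) fun p hp => (Finset.mem_filter.mp hp).2) (by positivity)
    have hlarge : ∑ p ∈ (Diluted.bigSizes (E N)).filter fun p : P => ¬ (p : ℕ) * E N p < S p,
        Diluted.pathDefect L (d N) (E N) (rank N) p ≤ κ * η * ((|C| + 1) * N) := by
      refine (Finset.sum_le_sum fun p hp => Diluted.pathDefect_le L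
        (hwalk N p (Finset.mem_filter.mp hp).1) (hP1 p p.2)
        (hS p _ (not_lt.mp (Finset.mem_filter.mp hp).2))).trans ?_
      rw [← Finset.mul_sum]
      refine mul_le_mul_of_nonneg_left (le_trans ?_ (hE N hN1)) (by positivity)
      exact Finset.sum_le_sum_of_subset_of_nonneg ((Finset.filter_subset _ _).trans
        Diluted.bigSizes_subset) fun p _ _ => by positivity
    have hsum := add_le_add hsmall hlarge
    rw [Finset.sum_filter_add_sum_filter_not] at hsum
    rw [hD, inv_mul_le_iff₀ hN0]
    refine hsum.trans_eq ?_
    rw [show 3 * κ * (η * N) + κ * η * ((|C| + 1) * N) =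
      N * (η * (3 * κ + κ * (|C| + 1))) by ring, hη, div_mul_cancel₀ _ (by positivity)]
  · rw [Diluted.freeEnergy_eq_add_sum_pathDefect L hgood (hrank N)]
    linarith [le_max_right 0 (D N)]
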